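/- Let $I=(-1,1)$ and, for $k,\ell\in\mathbb Z$ with $k\neq 0$, let $\eta=(k^2+\ell^2)^{1/2}$. There exist absolute constants $\epsilon_1>0$ and $C>0$ such that the following holds for all $\nu>0$, all $k,\ell\in\mathbb Z$ with $k\ne0$, all $a\in[0,\epsilon_1]$ and all $T\in(0,+\infty]$. Write $\|F\|_{L^qL^2}=\|F\|_{L^q(0,T;L^2(I))}\in[0,\infty]$, $\|\cdot\|_{L^2}=\|\cdot\|_{L^2(I)}$, and let $'$ and $\partial_y$ denote the weak derivative in $y$. Let $f_1,f_2,f_3\in L^2_{loc}([0,T);L^2(I))$ and $f_4\in L^2_{loc}([0,T);H^1_0(I))$ (so $f_4(t,\pm1)=0$), let $\omega_{in}\in L^2(I)$, and let $\omega\in L^2_{loc}([0,T);H^1_0(I))$ be a weak solution of $$\partial_t\omega-\nu(\partial_y^2-\eta^2)\omega+iky\,\omega=-ikf_1-\partial_yf_2-i\ell f_3-f_4,\qquad \omega|_{y=\pm1}=0,\qquad \omega|_{t=0}=\omega_{in},$$ that is, for every $\varphi\in C_c^\infty((-\infty,T)\times I)$, $$\int_0^T\!\!\int_I\big(-\omega\,\partial_t\varphi+\nu\,\omega'\partial_y\varphi+(\nu\eta^2+iky)\omega\varphi\big)\,dy\,dt=\int_I\omega_{in}\varphi(0,\cdot)\,dy+\int_0^T\!\!\int_I\big((-ikf_1-i\ell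 f_3-f_4)\varphi+f_2\,\partial_y\varphi\big)\,dy\,dt .$$ Then $$\begin{aligned} &\|e^{a\nu^{1/3}t}\omega\|^2_{L^\infty L^2}+\nu\|e^{a\nu^{1/3}t}\omega'\|^2_{L^2L^2}+\big(\nu\eta^2+(\nu k^2)^{1/3}\big)\|e^{a\nu^{1/3}t}\omega\|^2_{L^2L^2}\\ &\le C\Big(\|\omega_{in}\|_{L^2}^2+\nu^{-1}\|e^{a\nu^{1/3}t}f_2\|^2_{L^2L^2}+(\eta|k|)^{-1}\|e^{a\nu^{1/3}t}\partial_yf_4\|^2_{L^2L^2}+\eta|k|^{-1}\|e^{a\nu^{1/3}t}f_4\|^2_{L^2L^2}\\ &\qquad+\min\big((\nu\eta^2)^{-1},(\nu k^2)^{-1/3}\big)\|e^{a\nu^{1/3}t}(kf_1+\ell f_3)\|^2_{L^2L^2}\Big). \end{aligned}$$ Moreover, if in addition $\omega_{in}\in H^1_0(I)$ (so $\omega_{in}(\pm1)=0$) and $f_2\in L^2_{loc}([0,T);H^1(I))$, then $\omega'\in L^2_{loc}([0,T);H^1(I))$ and $$\begin{aligned} &\|e^{a\nu^{1/3}t}\omega'\|^2_{L^\infty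 L^2}+\nu\|e^{a\nu^{1/3}t}\omega''\|^2_{L^2L^2}+\nu\eta^2\|e^{a\nu^{1/3}t}\omega'\|^2_{L^2L^2}\\ &\le C\|\omega_{in}'\|^2_{L^2}+C\nu^{-2/3}|k|^{2/3}\Big(\|\omega_{in}\|^2_{L^2}+(\eta|k|)^{-1}\|e^{a\nu^{1/3}t}\partial_yf_4\|^2_{L^2L^2}+\eta|k|^{-1}\|e^{a\nu^{1/3}t}f_4\|^2_{L^2L^2}\Big)\\ &\quad+C\nu^{-1}\Big(\|e^{a\nu^{1/3}t}(kf_1+\ell f_3)\|^2_{L^2L^2}+\nu^{-2/3}|k|^{2/3}\|e^{a\nu^{1/3}t}f_2\|^2_{L^2L^2}+\|e^{a\nu^{1/3}t}\partial_yf_2\|^2_{L^2L^2}\Big). \end{aligned}$$ -/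

import Mathlib

open MeasureTheory

noncomputable section

namespace Couette

/-- Lebesgue measure on the interval `I = (-1, 1)`. -/
def volI : Measure ℝ := volume.restrict (Set.Ioo (-1) 1)

/-- The time interval `(0, T)`, where `T = ⊤` stands for `(0, +∞)`. -/
def timeInterval (T : EReal) : Set ℝ := {t | 0 < t ∧ (t : EReal) < T}

/-- Lebesgue measure on `(0, T)`. -/
def volT (T : EReal) : Measure ℝ := volume.restrict (timeInterval T)

/-- The norm of `F` in `L^q(0, T; L^p(I))`, with values in `[0, ∞]`. -/
def mixedNorm (q p : ENNReal) (T : EReal) (F : ℝ → ℝ → ℂ) : ENNReal :=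
  eLpNorm (fun t => eLpNorm (F t) p volI) q (volT T)

/-- The norm of `e^{a ν^{1/3} t} F` in `L^q(0, T; L^2(I))`, with values in `[0, ∞]`. -/
def wNorm (a ν : ℝ) (q : ENNReal) (T : EReal) (F : ℝ → ℝ → ℂ) : ENNReal :=
  mixedNorm q 2 T (fun t y => (Real.exp (a * ν ^ (1 / 3 : ℝ) * t) : ℂ) * F t y)

/-- `F ∈ L²_loc([0, T); L²(I))`: square integrable on `(0, τ) × I` for every finite `τ < T`. -/
def L2Loc (T : EReal) (F : ℝ → ℝ → ℂ) : Prop :=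
  ∀ τ : ℝ, 0 < τ → (τ : EReal) < T →
    MemLp (Function.uncurry F) 2 (volume.restrict (Set.Ioo 0 τ ×ˢ Set.Ioo (-1) 1))

/-- `f ∈ H¹(I)` and `g` is its weak derivative. -/
def HasH1Deriv (f g : ℝ → ℂ) : Prop :=
  MemLp f 2 volI ∧ MemLp g 2 volI ∧
    ∀ φ : ℝ → ℂ, ContDiff ℝ (⊤ : ℕ∞) φ → HasCompactSupport φ → tsupport φ ⊆ Set.Ioo (-1) 1 →
      ∫ y, f y * deriv φ y ∂volI = - ∫ y, g y * φ y ∂volI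

/-- `f ∈ H¹₀(I)` with weak derivative `g`; here `f` is the continuous representative on `[-1, 1]`,
so that `f(±1) = 0` is a pointwise statement. -/
def HasH10Deriv (f g : ℝ → ℂ) : Prop :=
  HasH1Deriv f g ∧ ContinuousOn f (Set.Icc (-1) 1) ∧ f (-1) = 0 ∧ f 1 = 0

/-- `η = (k² + ℓ²)^{1/2}`. -/
def eta (k ℓ : ℤ) : ℝ := Real.sqrt ((k : ℝ) ^ 2 + (ℓ : ℝ) ^ 2)

/-- The space-time domain `(0, T) × I`. -/
def domQ (T : EReal) : Set (ℝ × ℝ) := timeInterval T ×ˢ Set.Ioo (-1) 1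

/-- `ω`, with `∂_y ω = ω'`, is a weak solution on `(0, T) × (-1, 1)` of
`∂_t ω - ν (∂_y² - η²) ω + i k y ω = - i k f₁ - ∂_y f₂ - i ℓ f₃ - f₄`,
`ω(t, ±1) = 0`, `ω(0) = ωin`.  The test functions are smooth with compact support in
`(-∞, T) × (-1, 1)`; they need not vanish at `t = 0`, which is how the initial datum enters. -/
structure IsWeakSolution (ν : ℝ) (k ℓ : ℤ) (T : EReal) (f₁ f₂ f₃ f₄ : ℝ → ℝ → ℂ)
    (ωin : ℝ → ℂ) (ω ω' : ℝ → ℝ → ℂ) : Prop where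
  memL2 : L2Loc T ω
  deriv_memL2 : L2Loc T ω'
  boundary : ∀ᵐ t ∂volT T, HasH10Deriv (ω t) (ω' t)
  weak_eq : ∀ φ : ℝ → ℝ → ℂ, ContDiff ℝ (⊤ : ℕ∞) (Function.uncurry φ) →
    HasCompactSupport (Function.uncurry φ) →
    tsupport (Function.uncurry φ) ⊆ {p | (p.1 : EReal) < T ∧ p.2 ∈ Set.Ioo (-1 : ℝ) 1} →
    (∫ p in domQ T,
        (- ω p.1 p.2 * deriv (fun s => φ s p.2) p.1
          + (ν : ℂ) * ω' p.1 p.2 * deriv (φ p.1) p.2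
          + ((ν : ℂ) * (eta k ℓ : ℂ) ^ 2 + Complex.I * (k : ℂ) * (p.2 : ℂ))
              * ω p.1 p.2 * φ p.1 p.2))
      = (∫ y, ωin y * φ 0 y ∂volI)
        + ∫ p in domQ T,
          ((- Complex.I * (k : ℂ) * f₁ p.1 p.2 - Complex.I * (ℓ : ℂ) * f₃ p.1 p.2
              - f₄ p.1 p.2) * φ p.1 p.2
            + f₂ p.1 p.2 * deriv (φ p.1) p.2)

end Couette

end

/-!
The proof is an energy method on `(0, t) × I` and uses no resolvent estimates.  Put `κ = |k|` and
`δ = (ν/κ)^{1/3}`, the width of the critical layers, so that `ν = κδ³` and `(νk²)^{1/3} = κδ`.  The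
weighted solution `v = e^{bt} ω`, `b = aν^{1/3} ≤ aκδ`, solves the same kind of equation with the
extra term `bv`, which the enhanced dissipation absorbs if `a` is small.

*Enhanced dissipation.*  If `δη ≥ 1`, the viscous term `νη²‖v‖²` already dominates `κδ‖v‖²`
(`energyRate_le_of_large_frequency`).  If `δη ≤ 1`, a small multiple of a multiplier energy
`∫ m |F(χv)|²` is added to `‖v‖²`.  Here `χ` is a cut-off that removes boundary layers of width `δ`,
`F` is the Fourier transform on `ℝ`, and
`m(ξ) = sgn(k) (arctan (2πξ/η) + arctan (2πδξ)) / π`.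
The shear `-iky` acts on the Fourier side as `(k/2π) ∂_ξ`, so that transport contributes
`-(κ/π)` times the sum of the `H⁻¹` forms of `χv` at the frequencies `η` and `1/δ`
(`mForm_transport`, `multiplierRate_le`).  The form at frequency `1/δ`, interpolated with the viscous dissipation, gives
`κδ‖χv‖²` (`IsCutoff.nsq_le_lorForm`); the form at frequency `η` pays for `f₄` by duality.  In the
boundary layers Poincaré's inequality for functions that vanish at `±1` suffices
(`IsH10.nsq_layer_le`).  This gives the dissipation inequality `rate_le_of_small_frequency`, and
integration in time gives `exists_energy_estimate`.

*The `H¹` estimate.*  The equations for the sine coefficients of `v`, weighted by the squared wave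
numbers, are summed (`ShearEvolution.mode_le`, `ShearEvolution.h1_energy_le`); finiteness of the sum
is the asserted `H²` regularity.  Of the force, `ig` and `∂_y f₂` are paired with `∂_y² v`, while
`(b - iky)v - f₄` lies in `H¹₀(I)` and is paired after one differentiation: the term `y ∂_y v` drops
out of the real part, and only `b ∂_y v`, the commutator `-ikv` and `∂_y f₄` remain
(`re_inner_shearDeriv_le`).
These terms are controlled by `δ⁻²` times the first estimate (`ShearEvolution.h1_estimate`).

*Rigour.*  A weak solution satisfies the equation integrated in time against every smooth function
of `y` that vanishes at `±1` (`isEvolution_of_weak`, `IsWeakSolution.shearEvolution`).  Its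
coefficients against the sine modes, and those of `χv` against the Fourier kernel, hence solve
scalar equations in time; the square of each is integrated in time, and Parseval with Fubini yields
the energy identities (`energy_identity`, `IsEvolution.energy`, `IsEvolution.multiplier_energy`).
Borel measurable representatives are used throughout, and `t → T` by monotone convergence
(`IsRep.norms_le`).
-/


open MeasureTheory

noncomputable section

namespace Couette

/-! ### Absolutely continuous functions and weak derivatives on an interval -/

theorem mul_primitives_sub_real {p q : ℝ → ℝ} {a b : ℝ} (hp : IntervalIntegrable p volume a b)
    (hq : IntervalIntegrable q volume a b) (P₀ Q₀ : ℝ) :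
    (∫ x in a..b, (p x * (Q₀ + ∫ s in a..x, q s) + (P₀ + ∫ s in a..x, p s) * q x))
      = (P₀ + ∫ s in a..b, p s) * (Q₀ + ∫ s in a..b, q s) - P₀ * Q₀ := by
  have hac : ∀ (r : ℝ → ℝ) (R₀ : ℝ), IntervalIntegrable r volume a b →
      AbsolutelyContinuousOnInterval (fun x => R₀ + ∫ s in a..x, r s) a b := by
    intro r R₀ hr
    exact (LipschitzOnWith.absolutelyContinuousOnInterval (K := 0)
      ((LipschitzWith.const R₀).lipschitzOnWith)).add
      (hr.absolutelyContinuousOnInterval_intervalIntegral (by simp))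
  have key := (hac p P₀ hp).integral_deriv_mul_eq_sub (hac q Q₀ hq)
  simp only [intervalIntegral.integral_same, add_zero] at key
  rw [← key]
  apply intervalIntegral.integral_congr_ae
  filter_upwards [hp.ae_hasDerivAt_integral, hq.ae_hasDerivAt_integral] with x h1 h2 hx
  have hx' := Set.uIoc_subset_uIcc hx
  rw [((h1 hx' a (by simp)).const_add P₀).deriv, ((h2 hx' a (by simp)).const_add Q₀).deriv]

theorem intervalIntegral_re {p : ℝ → ℂ} {a b : ℝ} (hp : IntervalIntegrable p volume a b) :
    (∫ x in a..b, p x).re = ∫ x in a..b, (p x).re := by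
  simpa using (Complex.reCLM.intervalIntegral_comp_comm hp).symm

theorem intervalIntegral_im {p : ℝ → ℂ} {a b : ℝ} (hp : IntervalIntegrable p volume a b) :
    (∫ x in a..b, p x).im = ∫ x in a..b, (p x).im := by
  simpa using (Complex.imCLM.intervalIntegral_comp_comm hp).symm

theorem intervalIntegrable_mul_primitive {p q : ℝ → ℂ} {a b : ℝ}
    (hp : IntervalIntegrable p volume a b) (hq : IntervalIntegrable q volume a b) (Q₀ : ℂ) :
    IntervalIntegrable (fun x => p x * (Q₀ + ∫ s in a..x, q s)) volume a b := by
  apply hp.mul_continuousOn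
  exact continuousOn_const.add (intervalIntegral.continuousOn_primitive_interval' hq (by simp))

theorem intervalIntegrable_re {p : ℝ → ℂ} {a b : ℝ} (hp : IntervalIntegrable p volume a b) :
    IntervalIntegrable (fun x => (p x).re) volume a b :=
  ⟨hp.1.re, hp.2.re⟩

theorem intervalIntegrable_im {p : ℝ → ℂ} {a b : ℝ} (hp : IntervalIntegrable p volume a b) :
    IntervalIntegrable (fun x => (p x).im) volume a b :=
  ⟨hp.1.im, hp.2.im⟩

/-- Product rule for absolutely continuous complex functions, in integrated form. -/
theorem mul_primitives_sub {p q : ℝ → ℂ} {a b : ℝ} (hp : IntervalIntegrable p volume a b)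
    (hq : IntervalIntegrable q volume a b) (P₀ Q₀ : ℂ) :
    (∫ x in a..b, (p x * (Q₀ + ∫ s in a..x, q s) + (P₀ + ∫ s in a..x, p s) * q x))
      = (P₀ + ∫ s in a..b, p s) * (Q₀ + ∫ s in a..b, q s) - P₀ * Q₀ := by
  have hI : IntervalIntegrable
      (fun x => p x * (Q₀ + ∫ s in a..x, q s) + (P₀ + ∫ s in a..x, p s) * q x) volume a b := by
    refine (intervalIntegrable_mul_primitive hp hq Q₀).add ?_
    simpa [mul_comm] using intervalIntegrable_mul_primitive hq hp P₀
  have hpx : ∀ x ∈ Set.uIcc a b, IntervalIntegrable p volume a x := fun x hx =>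
    hp.mono_set (Set.uIcc_subset_uIcc_left hx)
  have hqx : ∀ x ∈ Set.uIcc a b, IntervalIntegrable q volume a x := fun x hx =>
    hq.mono_set (Set.uIcc_subset_uIcc_left hx)
  have pr := intervalIntegrable_re hp
  have pi := intervalIntegrable_im hp
  have qr := intervalIntegrable_re hq
  have qi := intervalIntegrable_im hq
  have hii : ∀ {r s : ℝ → ℝ} (R₀ S₀ : ℝ), IntervalIntegrable r volume a b →
      IntervalIntegrable s volume a b → IntervalIntegrable (fun x =>
        r x * (S₀ + ∫ y in a..x, s y) + (R₀ + ∫ y in a..x, r y) * s x) volume a b := by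
    intro r s R₀ S₀ hr hs
    refine (hr.mul_continuousOn (continuousOn_const.add
      (intervalIntegral.continuousOn_primitive_interval' hs (by simp)))).add ?_
    exact hs.continuousOn_mul (continuousOn_const.add
      (intervalIntegral.continuousOn_primitive_interval' hr (by simp)))
  apply Complex.ext
  · rw [intervalIntegral_re hI]
    have e : ∀ x ∈ Set.uIcc a b,
        (p x * (Q₀ + ∫ s in a..x, q s) + (P₀ + ∫ s in a..x, p s) * q x).re
        = ((p x).re * (Q₀.re + ∫ s in a..x, (q s).re)
            + (P₀.re + ∫ s in a..x, (p s).re) * (q x).re)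
          - ((p x).im * (Q₀.im + ∫ s in a..x, (q s).im)
            + (P₀.im + ∫ s in a..x, (p s).im) * (q x).im) := by
      intro x hx
      simp only [Complex.add_re, Complex.mul_re, Complex.add_im,
        intervalIntegral_re (hpx x hx), intervalIntegral_re (hqx x hx),
        intervalIntegral_im (hpx x hx), intervalIntegral_im (hqx x hx)]
      ring
    rw [intervalIntegral.integral_congr e, intervalIntegral.integral_sub (hii _ _ pr qr)
      (hii _ _ pi qi), mul_primitives_sub_real pr qr, mul_primitives_sub_real pi qi]
    simp only [Complex.sub_re, Complex.add_re, Complex.mul_re, Complex.add_im,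
        intervalIntegral_re hp, intervalIntegral_re hq,
        intervalIntegral_im hp, intervalIntegral_im hq]
    ring
  · rw [intervalIntegral_im hI]
    have e : ∀ x ∈ Set.uIcc a b,
        (p x * (Q₀ + ∫ s in a..x, q s) + (P₀ + ∫ s in a..x, p s) * q x).im
        = ((p x).re * (Q₀.im + ∫ s in a..x, (q s).im)
            + (P₀.re + ∫ s in a..x, (p s).re) * (q x).im)
          + ((p x).im * (Q₀.re + ∫ s in a..x, (q s).re)
            + (P₀.im + ∫ s in a..x, (p s).im) * (q x).re) := by
      intro x hx
      simp only [Complex.add_re, Complex.mul_im, Complex.add_im,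
        intervalIntegral_re (hpx x hx), intervalIntegral_re (hqx x hx),
        intervalIntegral_im (hpx x hx), intervalIntegral_im (hqx x hx)]
      ring
    rw [intervalIntegral.integral_congr e, intervalIntegral.integral_add (hii _ _ pr qi)
      (hii _ _ pi qr), mul_primitives_sub_real pr qi, mul_primitives_sub_real pi qr]
    simp only [Complex.sub_im, Complex.add_re, Complex.mul_im, Complex.add_im,
        intervalIntegral_re hp, intervalIntegral_re hq,
        intervalIntegral_im hp, intervalIntegral_im hq]
    ring

/-- Integration by parts of a primitive against a `C¹` function. -/
theorem integral_primitive_mul_deriv {h g : ℝ → ℂ} {a b : ℝ}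
    (hh : IntervalIntegrable h volume a b) (hg : ContDiff ℝ 1 g) (C : ℂ) :
    (∫ x in a..b, (C + ∫ s in a..x, h s) * deriv g x)
      = (C + ∫ s in a..b, h s) * g b - C * g a - ∫ x in a..b, h x * g x := by
  have hgc : Continuous (deriv g) := hg.continuous_deriv le_rfl
  have hFTC : ∀ x, g a + ∫ s in a..x, deriv g s = g x := by
    intro x
    rw [intervalIntegral.integral_deriv_eq_sub
      (fun y _ => (hg.differentiable one_ne_zero) y) (hgc.intervalIntegrable _ _)]
    ring
  have key := mul_primitives_sub hh (hgc.intervalIntegrable a b) C (g a)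
  simp only [hFTC] at key
  rw [← key, ← intervalIntegral.integral_sub]
  · apply intervalIntegral.integral_congr
    intro x _
    simp
  · refine (hh.mul_continuousOn hg.continuous.continuousOn).add ?_
    exact (hgc.intervalIntegrable a b).continuousOn_mul (continuousOn_const.add
      (intervalIntegral.continuousOn_primitive_interval' hh (by simp)))
  · exact hh.mul_continuousOn hg.continuous.continuousOn

theorem normSq_primitive {h : ℝ → ℂ} {a b : ℝ} (hh : IntervalIntegrable h volume a b) (C : ℂ) :
    ‖C + ∫ s in a..b, h s‖ ^ 2
      = ‖C‖ ^ 2 + ∫ x in a..b, 2 * ((starRingEnd ℂ) (C + ∫ s in a..x, h s) * h x).re := by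
  have hr := intervalIntegrable_re hh
  have hi := intervalIntegrable_im hh
  have hhx : ∀ x ∈ Set.uIcc a b, IntervalIntegrable h volume a x := fun x hx =>
    hh.mono_set (Set.uIcc_subset_uIcc_left hx)
  have hii : ∀ {r : ℝ → ℝ} (R₀ : ℝ), IntervalIntegrable r volume a b →
      IntervalIntegrable (fun x =>
        r x * (R₀ + ∫ y in a..x, r y) + (R₀ + ∫ y in a..x, r y) * r x) volume a b := by
    intro r R₀ hr
    refine (hr.mul_continuousOn (continuousOn_const.add
      (intervalIntegral.continuousOn_primitive_interval' hr (by simp)))).add ?_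
    exact hr.continuousOn_mul (continuousOn_const.add
      (intervalIntegral.continuousOn_primitive_interval' hr (by simp)))
  have e : ∀ x ∈ Set.uIcc a b,
      2 * ((starRingEnd ℂ) (C + ∫ s in a..x, h s) * h x).re
      = ((h x).re * (C.re + ∫ s in a..x, (h s).re) + (C.re + ∫ s in a..x, (h s).re) * (h x).re)
        + ((h x).im * (C.im + ∫ s in a..x, (h s).im)
          + (C.im + ∫ s in a..x, (h s).im) * (h x).im) := by
    intro x hx
    simp only [Complex.mul_re, Complex.conj_re, Complex.conj_im, Complex.add_re, Complex.add_im,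
      intervalIntegral_re (hhx x hx), intervalIntegral_im (hhx x hx)]
    ring
  rw [intervalIntegral.integral_congr e, intervalIntegral.integral_add (hii _ hr) (hii _ hi),
    mul_primitives_sub_real hr hr, mul_primitives_sub_real hi hi]
  simp only [Complex.sq_norm, Complex.normSq_apply, Complex.add_re, Complex.add_im,
    intervalIntegral_re hh, intervalIntegral_im hh]
  ring

theorem integral_Ioo_eq {a b : ℝ} (hab : a ≤ b) (f : ℝ → ℂ) :
    ∫ y in Set.Ioo a b, f y = ∫ y in a..b, f y := by
  rw [intervalIntegral.integral_of_le hab, integral_Ioc_eq_integral_Ioo]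

theorem intervalIntegrable_of_Ioo {E : Type*} [NormedAddCommGroup E] {a b : ℝ} (hab : a ≤ b)
    {f : ℝ → E} (hf : IntegrableOn f (Set.Ioo a b)) : IntervalIntegrable f volume a b := by
  rw [intervalIntegrable_iff_integrableOn_Ioo_of_le hab]
  exact hf

/-- Two-sided compact support: a function supported in an open interval is supported in a
smaller closed one. -/
theorem exists_Icc_of_tsupport_subset {a b : ℝ} (hab : a < b) {K : Set ℝ} (hK : IsCompact K)
    (hKs : K ⊆ Set.Ioo a b) : ∃ a' b', a < a' ∧ a' < b' ∧ b' < b ∧ K ⊆ Set.Icc a' b' := by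
  obtain ⟨m, hm1, hm2⟩ := exists_between hab
  rcases K.eq_empty_or_nonempty with rfl | hne
  · obtain ⟨m', h1, h2⟩ := exists_between hm2
    exact ⟨m, m', hm1, h1, h2, by simp⟩
  · obtain ⟨x, hx, hxm⟩ := hK.exists_isLeast hne
    obtain ⟨y, hy, hym⟩ := hK.exists_isGreatest hne
    obtain ⟨x', h1, h2⟩ := exists_between (hKs hx).1
    exact ⟨x', y, h1, h2.trans_le (hxm hy), (hKs hy).2,
      fun z hz => ⟨h2.le.trans (hxm hz), hym hz⟩⟩

/-- The primitive of a smooth function of mean zero supported in `(a, b)` is an admissible test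
function. -/
theorem primitive_of_mean_zero {a b : ℝ} (hab : a < b) {ψ : ℝ → ℝ}
    (hψ : ContDiff ℝ (⊤ : ℕ∞) ψ) (hc : HasCompactSupport ψ) (hs : tsupport ψ ⊆ Set.Ioo a b)
    (h0 : ∫ y, ψ y = 0) :
    ∃ φ : ℝ → ℝ, ContDiff ℝ (⊤ : ℕ∞) φ ∧ HasCompactSupport φ ∧ tsupport φ ⊆ Set.Ioo a b ∧
      deriv φ = ψ := by
  obtain ⟨a', b', ha, hab', hb, hK⟩ := exists_Icc_of_tsupport_subset hab hc hs
  have hz : ∀ y, y ∉ Set.Icc a' b' → ψ y = 0 := fun y hy =>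
    image_eq_zero_of_notMem_tsupport (fun h => hy (hK h))
  have hd : ∀ y, HasDerivAt (fun y => ∫ s in a'..y, ψ s) (ψ y) y := fun y =>
    intervalIntegral.integral_hasDerivAt_right (hψ.continuous.intervalIntegrable _ _)
      hψ.continuous.stronglyMeasurable.stronglyMeasurableAtFilter hψ.continuous.continuousAt
  have hderiv : deriv (fun y => ∫ s in a'..y, ψ s) = ψ := funext fun y => (hd y).deriv
  have hsupp : Function.support (fun y => ∫ s in a'..y, ψ s) ⊆ Set.Icc a' b' := by
    intro y hy
    by_contra hcon
    apply hy
    rw [Set.mem_Icc, not_and_or, not_le, not_le] at hcon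
    rcases hcon with h | h
    · simp only
      rw [intervalIntegral.integral_symm, neg_eq_zero]
      apply intervalIntegral.integral_zero_ae
      filter_upwards [compl_mem_ae_iff.mpr (measure_singleton a')] with x hx1 hx
      rw [Set.uIoc_of_le h.le] at hx
      apply hz
      intro hx'
      exact hx1 (le_antisymm hx.2 hx'.1)
    · simp only
      rw [intervalIntegral.integral_of_le (hab'.le.trans h.le), ← h0]
      rw [← integral_indicator measurableSet_Ioc, ← sub_eq_zero]
      rw [← integral_sub]
      · have : ∀ᵐ x, (Set.Ioc a' y).indicator ψ x - ψ x = 0 := by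
          filter_upwards [compl_mem_ae_iff.mpr (measure_singleton a')] with x hx1
          by_cases hx : x ∈ Set.Ioc a' y
          · simp [hx]
          · rw [Set.indicator_of_notMem hx, hz x, sub_zero]
            intro hx'
            apply hx
            exact ⟨lt_of_le_of_ne hx'.1 (fun h => hx1 h.symm), hx'.2.trans h.le⟩
        rw [integral_congr_ae this]; simp
      · exact (hψ.continuous.integrable_of_hasCompactSupport hc).indicator measurableSet_Ioc
      · exact hψ.continuous.integrable_of_hasCompactSupport hc
  have hts : tsupport (fun y => ∫ s in a'..y, ψ s) ⊆ Set.Icc a' b' :=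
    closure_minimal hsupp isClosed_Icc
  refine ⟨fun y => ∫ s in a'..y, ψ s, ?_, ?_, ?_, hderiv⟩
  · rw [contDiff_infty_iff_deriv, hderiv]
    exact ⟨fun y => (hd y).differentiableAt, hψ⟩
  · exact HasCompactSupport.of_support_subset_isCompact isCompact_Icc hsupp
  · exact hts.trans (fun y hy => ⟨ha.trans_le hy.1, hy.2.trans_lt hb⟩)

theorem deriv_ofReal_comp {φ : ℝ → ℝ} (hφ : Differentiable ℝ φ) :
    deriv (fun y => (φ y : ℂ)) = fun y => ((deriv φ y : ℝ) : ℂ) :=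
  funext fun y => ((hφ y).hasDerivAt.ofReal_comp).deriv

/-- Du Bois-Reymond: an integrable function with an integrable weak derivative is a primitive. -/
theorem ae_eq_const_add_primitive {a b : ℝ} (hab : a < b) {c h : ℝ → ℂ}
    (hc : IntegrableOn c (Set.Ioo a b)) (hh : IntegrableOn h (Set.Ioo a b))
    (H : ∀ φ : ℝ → ℝ, ContDiff ℝ (⊤ : ℕ∞) φ → HasCompactSupport φ → tsupport φ ⊆ Set.Ioo a b →
      ∫ y in Set.Ioo a b, c y * ((deriv φ y : ℝ) : ℂ) = - ∫ y in Set.Ioo a b, h y * (φ y : ℂ)) :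
    ∃ C : ℂ, ∀ᵐ y ∂volume.restrict (Set.Ioo a b), c y = C + ∫ s in a..y, h s := by
  have hhi := intervalIntegrable_of_Ioo hab.le hh
  set w : ℝ → ℂ := fun y => c y - ∫ s in a..y, h s with hw
  have hPc : ContinuousOn (fun y => ∫ s in a..y, h s) (Set.Icc a b) := by
    have := intervalIntegral.continuousOn_primitive_interval' hhi (Set.left_mem_uIcc)
    rwa [Set.uIcc_of_le hab.le] at this
  have hPi : IntegrableOn (fun y => ∫ s in a..y, h s) (Set.Ioo a b) :=
    (hPc.integrableOn_Icc).mono_set Set.Ioo_subset_Icc_self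
  have hwi : IntegrableOn w (Set.Ioo a b) := hc.sub hPi
  have bdd : ∀ {u : ℝ → ℂ} {ψ : ℝ → ℝ}, IntegrableOn u (Set.Ioo a b) → Continuous ψ →
      HasCompactSupport ψ → IntegrableOn (fun y => u y * (ψ y : ℂ)) (Set.Ioo a b) := by
    intro u ψ hu hψ hψc
    obtain ⟨M, hM⟩ := hψc.exists_bound_of_continuous hψ
    exact Integrable.mul_bdd hu (c := M)
      ((Complex.continuous_ofReal.comp hψ).aestronglyMeasurable)
      (Filter.Eventually.of_forall fun y => by simpa using hM y)
  have hw0 : ∀ φ : ℝ → ℝ, ContDiff ℝ (⊤ : ℕ∞) φ → HasCompactSupport φ →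
      tsupport φ ⊆ Set.Ioo a b → ∫ y in Set.Ioo a b, w y * ((deriv φ y : ℝ) : ℂ) = 0 := by
    intro φ h1 h2 h3
    have h1' : ContDiff ℝ 1 (fun y => (φ y : ℂ)) :=
      Complex.ofRealCLM.contDiff.comp (h1.of_le (by exact_mod_cast le_top))
    have ibp := integral_primitive_mul_deriv hhi h1' 0
    rw [deriv_ofReal_comp (h1.differentiable (by simp))] at ibp
    have hφa : φ a = 0 := image_eq_zero_of_notMem_tsupport (fun h => (h3 h).1.false)
    have hφb : φ b = 0 := image_eq_zero_of_notMem_tsupport (fun h => (h3 h).2.false)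
    simp only [zero_add, hφa, hφb, Complex.ofReal_zero, mul_zero, sub_zero, zero_sub] at ibp
    have hdc : Continuous (deriv φ) := h1.continuous_deriv (by simp)
    simp only [hw, sub_mul]
    rw [integral_sub (bdd hc hdc h2.deriv) (bdd hPi hdc h2.deriv),
      integral_Ioo_eq hab.le (fun y => (∫ s in a..y, h s) * ((deriv φ y : ℝ) : ℂ)),
      ibp, H φ h1 h2 h3, integral_Ioo_eq hab.le, sub_self]
  -- a normalised bump in the interval
  obtain ⟨ρ, hρ1, hρ2, hρ3, hρ4⟩ : ∃ ρ : ℝ → ℝ, ContDiff ℝ (⊤ : ℕ∞) ρ ∧ HasCompactSupport ρ ∧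
      tsupport ρ ⊆ Set.Ioo a b ∧ ∫ y, ρ y = 1 := by
    let f : ContDiffBump ((a + b) / 2) := ⟨(b - a) / 8, (b - a) / 4, by linarith, by linarith⟩
    refine ⟨f.normed volume, f.contDiff_normed, f.hasCompactSupport_normed, ?_, f.integral_normed⟩
    rw [f.tsupport_normed_eq]
    intro x hx
    rw [Metric.mem_closedBall, Real.dist_eq, abs_le] at hx
    simp only [f] at hx
    constructor <;> linarith [hx.1, hx.2]
  set C := ∫ y in Set.Ioo a b, w y * (ρ y : ℂ) with hC
  refine ⟨C, ?_⟩
  have hfin := isOpen_Ioo.ae_eq_zero_of_integral_contDiff_smul_eq_zero (μ := volume)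
    (U := Set.Ioo a b) (f := (Set.Ioo a b).indicator (fun y => w y - C)) ?_ ?_
  · rw [ae_restrict_iff' measurableSet_Ioo]
    filter_upwards [hfin] with y hy hyI
    have := hy hyI
    rw [Set.indicator_of_mem hyI] at this
    have h2 : w y = C := sub_eq_zero.mp this
    rw [← h2]; simp [hw]
  · apply LocallyIntegrable.locallyIntegrableOn
    apply Integrable.locallyIntegrable
    rw [integrable_indicator_iff measurableSet_Ioo]
    exact hwi.sub (by simp)
  · intro ψ h1 h2 h3
    have hmean : ∫ y, (ψ y - (∫ z, ψ z) * ρ y) = 0 := by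
      rw [integral_sub (h1.continuous.integrable_of_hasCompactSupport h2)
        ((hρ1.continuous.integrable_of_hasCompactSupport hρ2).const_mul _),
        integral_const_mul, hρ4]
      ring
    have hcs : HasCompactSupport (fun y => ψ y - (∫ z, ψ z) * ρ y) :=
      h2.sub (hρ2.mul_left (f := fun _ => ∫ z, ψ z))
    have hts : tsupport (fun y => ψ y - (∫ z, ψ z) * ρ y) ⊆ Set.Ioo a b := by
      have hcl : tsupport (fun y => ψ y - (∫ z, ψ z) * ρ y) ⊆ tsupport ψ ∪ tsupport ρ := by
        refine closure_minimal ?_ ((isClosed_tsupport _).union (isClosed_tsupport _))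
        intro y hy
        by_contra hcon
        rw [Set.mem_union, not_or] at hcon
        apply hy
        simp [image_eq_zero_of_notMem_tsupport hcon.1, image_eq_zero_of_notMem_tsupport hcon.2]
      exact hcl.trans (Set.union_subset h3 hρ3)
    obtain ⟨φ, g1, g2, g3, g4⟩ := primitive_of_mean_zero hab
      (h1.sub (contDiff_const.mul hρ1)) hcs hts hmean
    have := hw0 φ g1 g2 g3
    rw [g4] at this
    have e1 : ∫ y, ψ y • (Set.Ioo a b).indicator (fun y => w y - C) y
        = ∫ y in Set.Ioo a b, (w y * (ψ y : ℂ) - C * (ψ y : ℂ)) := by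
      rw [← integral_indicator measurableSet_Ioo]
      congr 1; ext y
      by_cases hy : y ∈ Set.Ioo a b
      · simp [hy]; ring
      · simp [hy]
    have e2 : ∫ y in Set.Ioo a b, (ψ y : ℂ) = ((∫ y, ψ y : ℝ) : ℂ) := by
      rw [integral_complex_ofReal, ← integral_indicator measurableSet_Ioo]
      congr 2; ext y
      by_cases hy : y ∈ Set.Ioo a b
      · simp [hy]
      · simp only [hy, not_false_eq_true, Set.indicator_of_notMem]
        exact (image_eq_zero_of_notMem_tsupport (fun h => hy (h3 h))).symm
    have hψi : IntegrableOn (fun y => (ψ y : ℂ)) (Set.Ioo a b) :=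
      ((h1.continuous.integrable_of_hasCompactSupport h2).ofReal).integrableOn
    rw [e1, integral_sub (bdd hwi h1.continuous h2) (hψi.const_mul C),
      integral_const_mul, e2]
    have e3 : ∫ y in Set.Ioo a b, w y * ((ψ y - (∫ z, ψ z) * ρ y : ℝ) : ℂ)
        = (∫ y in Set.Ioo a b, w y * (ψ y : ℂ)) - ((∫ z, ψ z : ℝ) : ℂ) * C := by
      rw [hC, ← integral_const_mul, ← integral_sub (bdd hwi h1.continuous h2)
        ((bdd hwi hρ1.continuous hρ2).const_mul _)]
      congr 1; ext y; push_cast; ring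
    rw [e3] at this
    rw [← this]; ring

/-! ### Square-integrable functions and Cauchy-Schwarz -/

instance : IsFiniteMeasure volI := by unfold volI; infer_instance

/-- The squared `L²(I)` norm. -/
def nsq (f : ℝ → ℂ) : ℝ := ∫ y, ‖f y‖ ^ 2 ∂volI

theorem nsq_nonneg (f : ℝ → ℂ) : 0 ≤ nsq f := integral_nonneg fun _ => by positivity

theorem nsq_congr {f g : ℝ → ℂ} (h : f =ᵐ[volI] g) : nsq f = nsq g :=
  integral_congr_ae (h.mono fun y hy => by simp only [hy])

section L2
variable {α : Type*} [MeasurableSpace α] {μ : Measure α} {f g : α → ℂ}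

theorem integrable_normSq (hf : MemLp f 2 μ) : Integrable (fun x => ‖f x‖ ^ 2) μ := hf.norm.integrable_sq

theorem memLp_conj (hf : MemLp f 2 μ) : MemLp (fun x => (starRingEnd ℂ) (f x)) 2 μ := by
  refine hf.of_le (Complex.continuous_conj.comp_aestronglyMeasurable hf.1) ?_
  exact Filter.Eventually.of_forall fun x => by simp

theorem integrable_mul_of_memLp (hf : MemLp f 2 μ) (hg : MemLp g 2 μ) :
    Integrable (fun x => f x * g x) μ := hf.integrable_mul hg

theorem integrable_conj_mul (hf : MemLp f 2 μ) (hg : MemLp g 2 μ) :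
    Integrable (fun x => (starRingEnd ℂ) (f x) * g x) μ := (memLp_conj hf).integrable_mul hg

theorem integral_norm_mul_norm_le (hf : MemLp f 2 μ) (hg : MemLp g 2 μ) :
    ∫ x, ‖f x‖ * ‖g x‖ ∂μ ≤ √(∫ x, ‖f x‖ ^ 2 ∂μ) * √(∫ x, ‖g x‖ ^ 2 ∂μ) := by
  have h := integral_mul_norm_le_Lp_mul_Lq (μ := μ) (f := f) (g := g) Real.HolderConjugate.two_two
    (by simpa using hf) (by simpa using hg)
  simpa [Real.sqrt_eq_rpow] using h

theorem norm_integral_mul_le (hf : MemLp f 2 μ) (hg : MemLp g 2 μ) :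
    ‖∫ x, f x * g x ∂μ‖ ≤ √(∫ x, ‖f x‖ ^ 2 ∂μ) * √(∫ x, ‖g x‖ ^ 2 ∂μ) := by
  refine (norm_integral_le_integral_norm _).trans ?_
  simpa only [norm_mul] using integral_norm_mul_norm_le hf hg

theorem memLp_ofReal_mul {m : α → ℝ} {B : ℝ} (hm : Measurable m) (hB : ∀ x, |m x| ≤ B)
    (hf : MemLp f 2 μ) : MemLp (fun x => (m x : ℂ) * f x) 2 μ := by
  refine hf.of_le_mul (c := B)
    ((Complex.measurable_ofReal.comp hm).aestronglyMeasurable.mul hf.1) ?_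
  exact Filter.Eventually.of_forall fun x => by
    simp only [norm_mul, Complex.norm_real, Real.norm_eq_abs]
    gcongr
    exact hB x

theorem integral_normSq_ofReal_mul_le {m : α → ℝ} {B : ℝ} (hB : ∀ x, |m x| ≤ B)
    (hf : MemLp f 2 μ) :
    ∫ x, ‖(m x : ℂ) * f x‖ ^ 2 ∂μ ≤ B ^ 2 * ∫ x, ‖f x‖ ^ 2 ∂μ := by
  rw [← integral_const_mul]
  refine integral_mono_of_nonneg (Filter.Eventually.of_forall fun x => by positivity)
    ((integrable_normSq hf).const_mul _) (Filter.Eventually.of_forall fun x => ?_)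
  simp only [norm_mul, Complex.norm_real, Real.norm_eq_abs, mul_pow]
  gcongr
  exact hB x

theorem integral_normSq_add_le (hf : MemLp f 2 μ) (hg : MemLp g 2 μ) :
    ∫ x, ‖f x + g x‖ ^ 2 ∂μ ≤ 2 * (∫ x, ‖f x‖ ^ 2 ∂μ) + 2 * ∫ x, ‖g x‖ ^ 2 ∂μ := by
  rw [← integral_const_mul, ← integral_const_mul, ← integral_add
    ((integrable_normSq hf).const_mul _) ((integrable_normSq hg).const_mul _)]
  refine integral_mono_of_nonneg (Filter.Eventually.of_forall fun x => by positivity)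
    (((integrable_normSq hf).const_mul _).add ((integrable_normSq hg).const_mul _))
    (Filter.Eventually.of_forall fun x => ?_)
  have h1 := norm_add_le (f x) (g x)
  have h2 := norm_nonneg (f x + g x)
  simp only
  nlinarith [sq_nonneg (‖f x‖ - ‖g x‖)]

end L2

/-! ### The space `H¹₀(I)` -/

theorem integral_volI (f : ℝ → ℂ) : ∫ y, f y ∂volI = ∫ y in (-1 : ℝ)..1, f y :=
  integral_Ioo_eq (by norm_num) f

theorem intervalIntegrable_of_volI {E : Type*} [NormedAddCommGroup E] {f : ℝ → E}
    (hf : Integrable f volI) : IntervalIntegrable f volume (-1) 1 :=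
  intervalIntegrable_of_Ioo (by norm_num) hf

theorem memLp_integrable {f : ℝ → ℂ} (hf : MemLp f 2 volI) : Integrable f volI :=
  hf.integrable (by norm_num)

theorem ae_volI_mem : ∀ᵐ y ∂volI, y ∈ Set.Ioo (-1 : ℝ) 1 := ae_restrict_mem measurableSet_Ioo

theorem HasH1Deriv.exists_primitive {f g : ℝ → ℂ} (h : HasH1Deriv f g) :
    ∃ C : ℂ, ∀ᵐ y ∂volI, f y = C + ∫ s in (-1 : ℝ)..y, g s := by
  refine ae_eq_const_add_primitive (by norm_num) (memLp_integrable h.1) (memLp_integrable h.2.1) ?_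
  intro φ h1 h2 h3
  have := h.2.2 (fun y => (φ y : ℂ)) (Complex.ofRealCLM.contDiff.comp h1)
    (h2.comp_left (g := fun x : ℝ => (x : ℂ)) Complex.ofReal_zero) ?_
  · rw [deriv_ofReal_comp (h1.differentiable (by simp))] at this
    exact this
  · refine (closure_mono ?_).trans h3
    intro y hy
    simpa using hy

/-- Integration by parts in `H¹(I)` against smooth functions that vanish at the end points. -/
theorem HasH1Deriv.integral_mul_deriv {f g ψ : ℝ → ℂ} (h : HasH1Deriv f g)
    (hψ : ContDiff ℝ 1 ψ) (h0 : ψ (-1) = 0) (h1 : ψ 1 = 0) :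
    ∫ y, f y * deriv ψ y ∂volI = - ∫ y, g y * ψ y ∂volI := by
  obtain ⟨C, hC⟩ := h.exists_primitive
  have e : ∫ y, f y * deriv ψ y ∂volI
      = ∫ y, (C + ∫ s in (-1 : ℝ)..y, g s) * deriv ψ y ∂volI :=
    integral_congr_ae (hC.mono fun y hy => by simp only [hy])
  rw [e, integral_volI, integral_primitive_mul_deriv
    (intervalIntegrable_of_volI (memLp_integrable h.2.1)) hψ, h0, h1, integral_volI]
  simp

/-- `u` agrees almost everywhere on `I` with an `H¹₀(I)` function of weak derivative `p`.  Unlike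
`HasH10Deriv`, this only depends on the almost-everywhere classes of `u` and `p`. -/
structure IsH10 (u p : ℝ → ℂ) : Prop where
  memLp_deriv : MemLp p 2 volI
  mean_zero : ∫ y, p y ∂volI = 0
  ae_eq : ∀ᵐ y ∂volI, u y = ∫ s in (-1 : ℝ)..y, p s

theorem HasH10Deriv.isH10 {u p : ℝ → ℂ} (h : HasH10Deriv u p) : IsH10 u p := by
  obtain ⟨C, hC⟩ := h.1.exists_primitive
  have hi := intervalIntegrable_of_volI (memLp_integrable h.1.2.1)
  have hPc : ContinuousOn (fun y => C + ∫ s in (-1 : ℝ)..y, p s) (Set.Icc (-1) 1) := by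
    have := intervalIntegral.continuousOn_primitive_interval' hi (Set.left_mem_uIcc)
    rw [Set.uIcc_of_le (by norm_num : (-1 : ℝ) ≤ 1)] at this
    exact continuousOn_const.add this
  have heq : Set.EqOn u (fun y => C + ∫ s in (-1 : ℝ)..y, p s) (Set.Ioo (-1) 1) :=
    Measure.eqOn_Ioo_of_ae_eq (μ := volume) hC (h.2.1.mono Set.Ioo_subset_Icc_self)
      (hPc.mono Set.Ioo_subset_Icc_self)
  have heq' : Set.EqOn u (fun y => C + ∫ s in (-1 : ℝ)..y, p s) (Set.Icc (-1) 1) := by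
    refine heq.of_subset_closure h.2.1 hPc Set.Ioo_subset_Icc_self ?_
    rw [closure_Ioo (by norm_num)]
  have hC0 : C = 0 := by
    have := heq' (Set.left_mem_Icc.mpr (by norm_num))
    simp only [h.2.2.1, intervalIntegral.integral_same, add_zero] at this
    exact this.symm
  refine ⟨h.1.2.1, ?_, ?_⟩
  · have := heq' (Set.right_mem_Icc.mpr (by norm_num))
    simp only [h.2.2.2, hC0, zero_add] at this
    rw [integral_volI, ← this]
  · filter_upwards [hC] with y hy
    rw [hy, hC0, zero_add]

theorem IsH10.congr {u p u' p' : ℝ → ℂ} (h : IsH10 u p) (hu : u =ᵐ[volI] u') (hp : p =ᵐ[volI] p') :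
    IsH10 u' p' := by
  refine ⟨(memLp_congr_ae hp).mp h.1, by rw [← integral_congr_ae hp]; exact h.2, ?_⟩
  have hp' : ∀ᵐ y, y ∈ Set.Ioo (-1 : ℝ) 1 → p y = p' y := (ae_restrict_iff' measurableSet_Ioo).mp hp
  filter_upwards [h.3, hu, ae_volI_mem] with y h1 h2 h3
  rw [← h2, h1]
  apply intervalIntegral.integral_congr_ae
  filter_upwards [hp'] with s hs hs'
  rw [Set.uIoc_of_le h3.1.le] at hs'
  exact hs ⟨hs'.1, hs'.2.trans_lt h3.2⟩

/-- Pointwise bound near the boundary: `|u(y)|² ≤ (1 - |y|) ‖u'‖²`. -/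
theorem IsH10.norm_sq_le {u p : ℝ → ℂ} (h : IsH10 u p) :
    ∀ᵐ y ∂volI, ‖u y‖ ^ 2 ≤ (1 - |y|) * nsq p := by
  have hi := intervalIntegrable_of_volI (memLp_integrable h.1)
  have key : ∀ a b : ℝ, -1 ≤ a → a ≤ b → b ≤ 1 → ‖∫ s in a..b, p s‖ ^ 2 ≤ (b - a) * nsq p := by
    intro a b ha hab hb
    have hsub : Set.Ioo a b ⊆ Set.Ioo (-1 : ℝ) 1 := Set.Ioo_subset_Ioo ha hb
    have hp : MemLp p 2 (volume.restrict (Set.Ioo a b)) :=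
      h.1.mono_measure (Measure.restrict_mono hsub le_rfl)
    have h1 : MemLp (fun _ : ℝ => (1 : ℂ)) 2 (volume.restrict (Set.Ioo a b)) := memLp_const 1
    have h2 := norm_integral_mul_le h1 hp
    simp only [one_mul, norm_one, one_pow, integral_const] at h2
    rw [integral_Ioo_eq hab] at h2
    have h3 : ∫ x in Set.Ioo a b, ‖p x‖ ^ 2 ≤ nsq p :=
      setIntegral_mono_set (integrable_normSq h.1)
        (Filter.Eventually.of_forall fun x => by positivity) hsub.eventuallyLE
    have h4 : (volume.restrict (Set.Ioo a b)).real Set.univ = b - a := by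
      simp [Measure.real, hab]
    rw [h4, smul_eq_mul, mul_one] at h2
    calc ‖∫ s in a..b, p s‖ ^ 2 ≤ (√(b - a) * √(∫ x in Set.Ioo a b, ‖p x‖ ^ 2)) ^ 2 := by
          gcongr
      _ = (b - a) * ∫ x in Set.Ioo a b, ‖p x‖ ^ 2 := by
          rw [mul_pow, Real.sq_sqrt (by linarith), Real.sq_sqrt (integral_nonneg fun _ => by positivity)]
      _ ≤ _ := by gcongr
  filter_upwards [h.3, ae_volI_mem] with y h1 h2
  rcases le_total 0 y with h0 | h0
  · rw [abs_of_nonneg h0, h1]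
    have hsplit : (∫ s in (-1 : ℝ)..y, p s) = - ∫ s in y..1, p s := by
      have h3 := h.2
      rw [integral_volI, ← intervalIntegral.integral_add_adjacent_intervals (b := y)
        (hi.mono_set (Set.uIcc_subset_uIcc_left (by rw [Set.uIcc_of_le] <;> [exact ⟨h2.1.le, h2.2.le⟩; norm_num])))
        (hi.mono_set (Set.uIcc_subset_uIcc_right (by rw [Set.uIcc_of_le] <;> [exact ⟨h2.1.le, h2.2.le⟩; norm_num])))] at h3
      exact eq_neg_of_add_eq_zero_left h3
    rw [hsplit, norm_neg]
    exact key y 1 h2.1.le h2.2.le le_rfl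
  · rw [abs_of_nonpos h0, h1]
    have := key (-1) y le_rfl h2.1.le h2.2.le
    convert this using 2; ring

theorem IsH10.memLp {u p : ℝ → ℂ} (h : IsH10 u p) : MemLp u 2 volI := by
  have hi := intervalIntegrable_of_volI (memLp_integrable h.1)
  have hPc : ContinuousOn (fun y => ∫ s in (-1 : ℝ)..y, p s) (Set.Icc (-1) 1) := by
    have := intervalIntegral.continuousOn_primitive_interval' hi (Set.left_mem_uIcc)
    rwa [Set.uIcc_of_le (by norm_num : (-1 : ℝ) ≤ 1)] at this
  have hm : AEStronglyMeasurable u volI := by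
    refine AEStronglyMeasurable.congr ?_ (Filter.EventuallyEq.symm h.3)
    exact (hPc.mono Set.Ioo_subset_Icc_self).aestronglyMeasurable measurableSet_Ioo
  refine MemLp.of_bound hm (√(nsq p)) ?_
  filter_upwards [h.norm_sq_le] with y hy
  apply Real.le_sqrt_of_sq_le
  have := nsq_nonneg p
  nlinarith [abs_nonneg y]

/-- Integration by parts in `H¹₀(I)` against arbitrary `C¹` functions. -/
theorem IsH10.integral_mul_deriv {u p g : ℝ → ℂ} (h : IsH10 u p) (hg : ContDiff ℝ 1 g) :
    ∫ y, u y * deriv g y ∂volI = - ∫ y, p y * g y ∂volI := by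
  have hi := intervalIntegrable_of_volI (memLp_integrable h.1)
  have e : ∫ y, u y * deriv g y ∂volI
      = ∫ y, (0 + ∫ s in (-1 : ℝ)..y, p s) * deriv g y ∂volI :=
    integral_congr_ae (h.3.mono fun y hy => by simp only [hy, zero_add])
  have h0 := h.2
  rw [integral_volI] at h0
  rw [e, integral_volI, integral_primitive_mul_deriv hi hg, h0, integral_volI]
  simp

/-- Poincaré's inequality in a boundary layer of width `δ`. -/
theorem IsH10.nsq_layer_le {u p : ℝ → ℂ} (h : IsH10 u p) {κ : ℝ → ℝ} {B δ : ℝ}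
    (hδ : 0 < δ) (hB : ∀ y, |κ y| ≤ B) (hκ : ∀ y, |y| < 1 - δ → κ y = 0) :
    nsq (fun y => (κ y : ℂ) * u y) ≤ 2 * B ^ 2 * δ ^ 2 * nsq p := by
  have hB0 : 0 ≤ B := (abs_nonneg _).trans (hB 0)
  set S : Set ℝ := Set.Ioc (-1) (-1 + δ) ∪ Set.Ico (1 - δ) 1 with hS
  have hSm : MeasurableSet S := measurableSet_Ioc.union measurableSet_Ico
  have hle : ∀ᵐ y ∂volI, ‖(κ y : ℂ) * u y‖ ^ 2
      ≤ S.indicator (fun _ => B ^ 2 * (δ * nsq p)) y := by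
    filter_upwards [h.norm_sq_le, ae_volI_mem] with y h1 h2
    by_cases hy : |y| < 1 - δ
    · rw [hκ y hy]
      simp only [Complex.ofReal_zero, zero_mul, norm_zero, ne_eq, OfNat.ofNat_ne_zero,
        not_false_eq_true, zero_pow]
      exact Set.indicator_nonneg (fun _ _ => by have := nsq_nonneg p; positivity) _
    · have hyS : y ∈ S := by
        push Not at hy
        rcases le_total 0 y with h0 | h0
        · rw [abs_of_nonneg h0] at hy
          exact Or.inr ⟨hy, h2.2⟩
        · rw [abs_of_nonpos h0] at hy
          exact Or.inl ⟨h2.1, by linarith⟩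
      rw [Set.indicator_of_mem hyS, norm_mul, mul_pow, Complex.norm_real, Real.norm_eq_abs]
      have := nsq_nonneg p
      push Not at hy
      have h3 : ‖u y‖ ^ 2 ≤ δ * nsq p := h1.trans (by gcongr; linarith)
      gcongr
      exact hB y
  have hmeas : volI.real S ≤ 2 * δ := by
    have h1 : volI S ≤ ENNReal.ofReal δ + ENNReal.ofReal δ := by
      refine (measure_union_le _ _).trans ?_
      refine add_le_add ((Measure.restrict_apply_le _ _).trans ?_)
        ((Measure.restrict_apply_le _ _).trans ?_)
      · rw [Real.volume_Ioc]; apply le_of_eq; congr 1; ring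
      · rw [Real.volume_Ico]; apply le_of_eq; congr 1; ring
    rw [← ENNReal.ofReal_add hδ.le hδ.le] at h1
    have := ENNReal.toReal_mono ENNReal.ofReal_ne_top h1
    rw [ENNReal.toReal_ofReal (by positivity)] at this
    exact this.trans (by linarith)
  calc nsq (fun y => (κ y : ℂ) * u y)
      ≤ ∫ y, S.indicator (fun _ => B ^ 2 * (δ * nsq p)) y ∂volI :=
        integral_mono_of_nonneg (Filter.Eventually.of_forall fun x => by positivity)
          ((integrable_const _).indicator hSm) hle
    _ = volI.real S * (B ^ 2 * (δ * nsq p)) := by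
        rw [integral_indicator_const _ hSm, smul_eq_mul]
    _ ≤ (2 * δ) * (B ^ 2 * (δ * nsq p)) := by
        have := nsq_nonneg p
        gcongr
    _ = _ := by ring

/-! ### Cut-off functions -/

/-- A smooth cut-off of `I` that equals `1` outside the boundary layers of width `δ`, with the
natural bound on its derivative. -/
structure IsCutoff (K δ : ℝ) (χ : ℝ → ℝ) : Prop where
  contDiff : ContDiff ℝ (⊤ : ℕ∞) χ
  supp : tsupport χ ⊆ Set.Ioo (-1) 1
  nonneg : ∀ y, 0 ≤ χ y
  le_one : ∀ y, χ y ≤ 1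
  eq_one : ∀ y, |y| < 1 - δ → χ y = 1
  deriv_le : ∀ y, |deriv χ y| ≤ K / δ
  deriv_zero : ∀ y, |y| < 1 - δ → deriv χ y = 0

theorem exists_cutoff : ∃ K : ℝ, 1 ≤ K ∧ ∀ δ : ℝ, 0 < δ → δ ≤ 1 → ∃ χ, IsCutoff K δ χ := by
  have hst : ContDiff ℝ (⊤ : ℕ∞) Real.smoothTransition := Real.smoothTransition.contDiff
  have hdc : Continuous (deriv Real.smoothTransition) := hst.continuous_deriv (by simp)
  obtain ⟨M, hM⟩ := isCompact_Icc.exists_bound_of_continuousOn (s := Set.Icc (0 : ℝ) 1)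
    hdc.continuousOn
  have hM0 : 0 ≤ M := (norm_nonneg _).trans (hM 0 (by simp))
  have hM' : ∀ x, |deriv Real.smoothTransition x| ≤ M := by
    intro x
    by_cases hx : x ∈ Set.Icc (0 : ℝ) 1
    · exact hM x hx
    · rw [Set.mem_Icc, not_and_or, not_le, not_le] at hx
      have : deriv Real.smoothTransition x = 0 := by
        rcases hx with hx | hx
        · have : Real.smoothTransition =ᶠ[nhds x] fun _ => 0 := by
            filter_upwards [Iio_mem_nhds hx] with z hz
            exact Real.smoothTransition.zero_of_nonpos (le_of_lt hz)
          rw [this.deriv_eq]; simp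
        · have : Real.smoothTransition =ᶠ[nhds x] fun _ => 1 := by
            filter_upwards [Ioi_mem_nhds hx] with z hz
            exact Real.smoothTransition.one_of_one_le (le_of_lt hz)
          rw [this.deriv_eq]; simp
      rw [this]; simpa using hM0
  refine ⟨4 * M + 1, by linarith, fun δ hδ hδ1 => ?_⟩
  set χ : ℝ → ℝ := fun y => Real.smoothTransition (2 * (1 - y) / δ - 1)
    * Real.smoothTransition (2 * (1 + y) / δ - 1) with hχ
  have hsm : ContDiff ℝ (⊤ : ℕ∞) χ := by
    refine (hst.comp ?_).mul (hst.comp ?_) <;> fun_prop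
  have hsupp : Function.support χ ⊆ Set.Icc (-1 + δ / 2) (1 - δ / 2) := by
    intro y hy
    by_contra hcon
    rw [Set.mem_Icc, not_and_or, not_le, not_le] at hcon
    apply hy
    simp only [hχ]
    rcases hcon with h | h
    · rw [Real.smoothTransition.zero_of_nonpos (x := 2 * (1 + y) / δ - 1), mul_zero]
      rw [sub_nonpos, div_le_one hδ]; linarith
    · rw [Real.smoothTransition.zero_of_nonpos (x := 2 * (1 - y) / δ - 1), zero_mul]
      rw [sub_nonpos, div_le_one hδ]; linarith
  have hone : ∀ y, |y| < 1 - δ → χ y = 1 := by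
    intro y hy
    rw [abs_lt] at hy
    simp only [hχ]
    rw [Real.smoothTransition.one_of_one_le, Real.smoothTransition.one_of_one_le, mul_one]
    · rw [le_sub_iff_add_le, le_div_iff₀ hδ]; linarith
    · rw [le_sub_iff_add_le, le_div_iff₀ hδ]; linarith
  refine ⟨χ, hsm, (closure_minimal hsupp isClosed_Icc).trans
      (fun y hy => ⟨by linarith [hy.1], by linarith [hy.2]⟩),
    fun y => mul_nonneg (Real.smoothTransition.nonneg _) (Real.smoothTransition.nonneg _),
    fun y => mul_le_one₀ (Real.smoothTransition.le_one _) (Real.smoothTransition.nonneg _)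
      (Real.smoothTransition.le_one _), hone, fun y => ?_, fun y hy => ?_⟩
  · have hdiff : Differentiable ℝ Real.smoothTransition := hst.differentiable (by simp)
    have d1 : HasDerivAt (fun y : ℝ => 2 * (1 - y) / δ - 1) (-2 / δ) y := by
      have := (((hasDerivAt_id' y).const_sub 1).const_mul 2).div_const δ |>.sub_const 1
      exact this.congr_deriv (by ring)
    have d2 : HasDerivAt (fun y : ℝ => 2 * (1 + y) / δ - 1) (2 / δ) y := by
      have := (((hasDerivAt_id' y).const_add 1).const_mul 2).div_const δ |>.sub_const 1
      exact this.congr_deriv (by ring)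
    have d := ((hdiff _).hasDerivAt.comp y d1).mul ((hdiff _).hasDerivAt.comp y d2)
    have hd : deriv χ y = _ := d.deriv
    rw [hd]
    simp only [Function.comp]
    have a1 := hM' (2 * (1 - y) / δ - 1)
    have a2 := hM' (2 * (1 + y) / δ - 1)
    have b1 := Real.smoothTransition.nonneg (2 * (1 - y) / δ - 1)
    have b2 := Real.smoothTransition.nonneg (2 * (1 + y) / δ - 1)
    have c1 := Real.smoothTransition.le_one (2 * (1 - y) / δ - 1)
    have c2 := Real.smoothTransition.le_one (2 * (1 + y) / δ - 1)
    refine (abs_add_le _ _).trans ?_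
    simp only [abs_mul, abs_div, abs_neg, abs_two, abs_of_pos hδ, abs_of_nonneg b1,
      abs_of_nonneg b2]
    have e1 : |deriv Real.smoothTransition (2 * (1 - y) / δ - 1)| * (2 / δ)
        * Real.smoothTransition (2 * (1 + y) / δ - 1) ≤ M * (2 / δ) * 1 := by gcongr
    have e2 : Real.smoothTransition (2 * (1 - y) / δ - 1)
        * (|deriv Real.smoothTransition (2 * (1 + y) / δ - 1)| * (2 / δ))
        ≤ 1 * (M * (2 / δ)) := by gcongr
    have e3 : (4 * M + 1) / δ = M * (2 / δ) * 1 + 1 * (M * (2 / δ)) + 1 / δ := by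
      field_simp; ring
    have : 0 < 1 / δ := by positivity
    linarith
  · have : χ =ᶠ[nhds y] fun _ => 1 := by
      filter_upwards [(isOpen_lt continuous_abs continuous_const).mem_nhds hy] with z hz
      exact hone z hz
    rw [this.deriv_eq]; simp

/-! ### Parseval frames: the Fourier transform and the sine and cosine series -/

/-- The coefficients `∫_I g ψ_x` of `g` with respect to a family `ψ`. -/
def coef {X : Type*} (ψ : X → ℝ → ℂ) (g : ℝ → ℂ) (x : X) : ℂ := ∫ y, g y * ψ x y ∂volI

/-- A jointly measurable family of functions bounded by `1` whose coefficient map is `√κ` times an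
isometry from `L²(I)` to `L²(X, μ)`.  The Fourier transform and the (doubly indexed) sine and
cosine series are instances. -/
structure IsParsevalFrame {X : Type*} [MeasurableSpace X] (μ : Measure X) (ψ : X → ℝ → ℂ)
    (κ : ℝ) : Prop where
  measurable : Measurable (Function.uncurry ψ)
  norm_le_one : ∀ x y, ‖ψ x y‖ ≤ 1
  memLp : ∀ g, MemLp g 2 volI → MemLp (coef ψ g) 2 μ
  parseval : ∀ g, MemLp g 2 volI → ∫ x, ‖coef ψ g x‖ ^ 2 ∂μ = κ * nsq g

theorem integral_normSq_add_smul {α : Type*} [MeasurableSpace α] {μ : Measure α} {f g : α → ℂ}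
    (hf : MemLp f 2 μ) (hg : MemLp g 2 μ) (c : ℂ) :
    ∫ x, ‖f x + c * g x‖ ^ 2 ∂μ = (∫ x, ‖f x‖ ^ 2 ∂μ) + ‖c‖ ^ 2 * (∫ x, ‖g x‖ ^ 2 ∂μ)
      + 2 * (c * ∫ x, (starRingEnd ℂ) (f x) * g x ∂μ).re := by
  have hi := integrable_conj_mul hf hg
  have h1 : ∀ x, ‖f x + c * g x‖ ^ 2 = ‖f x‖ ^ 2 + ‖c‖ ^ 2 * ‖g x‖ ^ 2
      + 2 * (c * ((starRingEnd ℂ) (f x) * g x)).re := by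
    intro x
    simp only [Complex.sq_norm, Complex.normSq_apply, Complex.add_re, Complex.add_im,
      Complex.mul_re, Complex.mul_im, Complex.conj_re, Complex.conj_im]
    ring
  have hre : (c * ∫ x, (starRingEnd ℂ) (f x) * g x ∂μ).re
      = ∫ x, (c * ((starRingEnd ℂ) (f x) * g x)).re ∂μ := by
    rw [← integral_const_mul]
    simpa using (Complex.reCLM.integral_comp_comm (hi.const_mul c)).symm
  simp_rw [h1]
  rw [hre, ← integral_const_mul, ← integral_const_mul, ← integral_add, ← integral_add]
  · exact (integrable_normSq hf).add ((integrable_normSq hg).const_mul _)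
  · exact ((hi.const_mul c).re).const_mul 2
  · exact integrable_normSq hf
  · exact (integrable_normSq hg).const_mul _

section coef
variable {X : Type*} {ψ : X → ℝ → ℂ}

theorem coef_congr {f g : ℝ → ℂ} (h : f =ᵐ[volI] g) (x : X) : coef ψ f x = coef ψ g x :=
  integral_congr_ae (h.mono fun y hy => by simp only [hy])

variable [MeasurableSpace X] {μ : Measure X} {κ : ℝ} (hψ : IsParsevalFrame μ ψ κ)
include hψ

theorem IsParsevalFrame.aestronglyMeasurable (x : X) : AEStronglyMeasurable (ψ x) volI :=
  (hψ.measurable.comp measurable_prodMk_left).aestronglyMeasurable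

theorem IsParsevalFrame.memLp_kernel (x : X) : MemLp (ψ x) 2 volI :=
  MemLp.of_bound (hψ.aestronglyMeasurable x) 1 (Filter.Eventually.of_forall fun y =>
    hψ.norm_le_one x y)

theorem IsParsevalFrame.integrable {g : ℝ → ℂ} (hg : MemLp g 2 volI) (x : X) :
    Integrable (fun y => g y * ψ x y) volI :=
  integrable_mul_of_memLp hg (hψ.memLp_kernel x)

theorem IsParsevalFrame.coef_add {f g : ℝ → ℂ} (hf : MemLp f 2 volI) (hg : MemLp g 2 volI) (x : X) :
    coef ψ (fun y => f y + g y) x = coef ψ f x + coef ψ g x := by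
  simp only [coef, add_mul]
  exact integral_add (hψ.integrable hf x) (hψ.integrable hg x)

omit hψ [MeasurableSpace X] in
theorem coef_const_mul (c : ℂ) (g : ℝ → ℂ) (x : X) :
    coef ψ (fun y => c * g y) x = c * coef ψ g x := by
  simp only [coef, mul_assoc, integral_const_mul]

/-- Polarised Parseval identity. -/
theorem IsParsevalFrame.inner {f g : ℝ → ℂ} (hf : MemLp f 2 volI) (hg : MemLp g 2 volI) :
    ∫ x, (starRingEnd ℂ) (coef ψ f x) * coef ψ g x ∂μ
      = κ * ∫ y, (starRingEnd ℂ) (f y) * g y ∂volI := by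
  have key : ∀ c : ℂ, (c * ∫ x, (starRingEnd ℂ) (coef ψ f x) * coef ψ g x ∂μ).re
      = (c * (κ * ∫ y, (starRingEnd ℂ) (f y) * g y ∂volI)).re := by
    intro c
    have h1 := integral_normSq_add_smul (hψ.memLp f hf) (hψ.memLp g hg) c
    have h2 := integral_normSq_add_smul hf hg c
    have hs : MemLp (fun y => f y + c * g y) 2 volI := hf.add (hg.const_mul c)
    have h3 := hψ.parseval _ hs
    have h4 : ∀ x, coef ψ (fun y => f y + c * g y) x = coef ψ f x + c * coef ψ g x := by
      intro x
      rw [hψ.coef_add hf (hg.const_mul c), coef_const_mul]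
    simp only [h4] at h3
    rw [nsq, h2, h1, hψ.parseval f hf, hψ.parseval g hg, nsq, nsq] at h3
    have h5 : (c * (κ * ∫ y, (starRingEnd ℂ) (f y) * g y ∂volI)).re
        = κ * (c * ∫ y, (starRingEnd ℂ) (f y) * g y ∂volI).re := by
      rw [← mul_assoc, mul_comm c, mul_assoc, Complex.re_ofReal_mul]
    rw [h5]
    linarith
  apply Complex.ext
  · simpa using key 1
  · simpa using key (-Complex.I)

end coef

open FourierTransform in
/-- On `L¹ ∩ L²` the Fourier integral represents the `L²` Fourier transform. -/
theorem fourier_ae_eq_fourier_toLp {g : ℝ → ℂ} (h1 : Integrable g) (h2 : MemLp g 2 volume) :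
    𝓕 g =ᵐ[volume] (𝓕 h2.toLp : Lp ℂ 2 (volume : Measure ℝ)) := by
  have hcont : Continuous (𝓕 g) :=
    VectorFourier.fourierIntegral_continuous Real.continuous_fourierChar (by fun_prop) h1
  have := ae_eq_of_integral_contDiff_smul_eq (μ := (volume : Measure ℝ))
    (f := 𝓕 g) (f' := (𝓕 h2.toLp : Lp ℂ 2 (volume : Measure ℝ))) hcont.locallyIntegrable
    ((Lp.memLp _).locallyIntegrable (by norm_num)) ?_
  · exact this
  intro φ hφ hφc
  have hφc' : HasCompactSupport (Complex.ofRealCLM ∘ φ) := hφc.comp_left rfl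
  have hφ' : ContDiff ℝ (⊤ : ℕ∞) (Complex.ofRealCLM ∘ φ) := by fun_prop
  set Φ : SchwartzMap ℝ ℂ := hφc'.toSchwartzMap hφ' with hΦ
  have hΦe : ∀ x, Φ x = (φ x : ℂ) := fun x => rfl
  have e1 : ∫ x, φ x • 𝓕 g x = ∫ x, (𝓕 (Φ : ℝ → ℂ)) x • g x := by
    have := VectorFourier.integral_fourierIntegral_smul_eq_flip (μ := (volume : Measure ℝ))
      (ν := (volume : Measure ℝ)) (L := innerₗ ℝ) (f := (Φ : ℝ → ℂ)) (g := g)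
      Real.continuous_fourierChar (by simp only [innerₗ_apply_apply]; fun_prop) Φ.integrable h1
    rw [flip_innerₗ] at this
    exact this.symm
  have e2 : ∫ x, φ x • (𝓕 h2.toLp : Lp ℂ 2 (volume : Measure ℝ)) x = ∫ x, (𝓕 (Φ : ℝ → ℂ)) x • g x := by
    have h3 := congrArg (fun T => T Φ) (Lp.fourier_toTemperedDistribution_eq (h2.toLp))
    simp only [TemperedDistribution.fourier_apply, Lp.toTemperedDistribution_apply] at h3
    calc ∫ x, φ x • (𝓕 h2.toLp : Lp ℂ 2 (volume : Measure ℝ)) x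
        = ∫ x, Φ x • (𝓕 h2.toLp : Lp ℂ 2 (volume : Measure ℝ)) x := rfl
      _ = _ := h3.symm
      _ = _ := by
        apply integral_congr_ae
        filter_upwards [h2.coeFn_toLp] with x hx
        rw [hx, SchwartzMap.fourier_coe]
  rw [e1, e2]

theorem norm_toLp_sq {α : Type*} [MeasurableSpace α] {μ : Measure α} {g : α → ℂ}
    (h2 : MemLp g 2 μ) : ‖h2.toLp‖ ^ 2 = ∫ x, ‖g x‖ ^ 2 ∂μ := by
  rw [Lp.norm_toLp, h2.eLpNorm_eq_integral_rpow_norm (by norm_num) (by norm_num),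
    ENNReal.toReal_ofReal (by positivity)]
  simp only [ENNReal.toReal_ofNat, Real.rpow_two]
  rw [← Real.rpow_natCast, ← Real.rpow_mul (integral_nonneg fun _ => by positivity)]
  norm_num

/-- The kernel `e^{-2π i ξ y}` of the Fourier transform. -/
def fourierKer (ξ y : ℝ) : ℂ := Complex.exp (((-2 * Real.pi * ξ * y : ℝ) : ℂ) * Complex.I)

theorem continuous_fourierKer : Continuous (Function.uncurry fourierKer) := by
  unfold fourierKer Function.uncurry; fun_prop

open FourierTransform in
theorem coef_fourierKer_eq (g : ℝ → ℂ) (ξ : ℝ) :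
    coef fourierKer g ξ = 𝓕 ((Set.Ioo (-1 : ℝ) 1).indicator g) ξ := by
  rw [Real.fourier_real_eq_integral_exp_smul, coef, volI, ← integral_indicator measurableSet_Ioo]
  congr 1; ext y
  by_cases hy : y ∈ Set.Ioo (-1 : ℝ) 1
  · simp only [Set.indicator_of_mem hy, fourierKer, smul_eq_mul]
    rw [mul_comm]; congr 4; ring
  · simp [Set.indicator_of_notMem hy]

open FourierTransform in
theorem isParsevalFrame_fourierKer : IsParsevalFrame (volume : Measure ℝ) fourierKer 1 := by
  have aux : ∀ g, MemLp g 2 volI → MemLp (coef fourierKer g) 2 volume ∧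
      ∫ x, ‖coef fourierKer g x‖ ^ 2 = 1 * nsq g := by
    intro g hg
    have hG2 : MemLp ((Set.Ioo (-1 : ℝ) 1).indicator g) 2 volume :=
      (memLp_indicator_iff_restrict measurableSet_Ioo).mpr hg
    have hG1 : Integrable ((Set.Ioo (-1 : ℝ) 1).indicator g) volume :=
      (integrable_indicator_iff measurableSet_Ioo).mpr (memLp_integrable hg)
    have hae := fourier_ae_eq_fourier_toLp hG1 hG2
    have hco : coef fourierKer g = 𝓕 ((Set.Ioo (-1 : ℝ) 1).indicator g) :=
      funext (coef_fourierKer_eq g)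
    rw [hco]
    have hm : MemLp (𝓕 ((Set.Ioo (-1 : ℝ) 1).indicator g)) 2 volume :=
      (memLp_congr_ae hae).mpr (Lp.memLp _)
    refine ⟨hm, ?_⟩
    have h1 : hm.toLp = (𝓕 hG2.toLp : Lp ℂ 2 (volume : Measure ℝ)) := by
      apply Lp.ext
      exact hm.coeFn_toLp.trans hae
    rw [← norm_toLp_sq hm, h1, Lp.norm_fourier_eq, norm_toLp_sq hG2, one_mul, nsq, volI,
      ← integral_indicator measurableSet_Ioo]
    congr 1; ext y
    by_cases hy : y ∈ Set.Ioo (-1 : ℝ) 1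
    · simp [hy]
    · simp [hy]
  refine ⟨continuous_fourierKer.measurable, fun x y => ?_, fun g hg => (aux g hg).1,
    fun g hg => (aux g hg).2⟩
  rw [fourierKer, Complex.norm_exp_ofReal_mul_I]

/-- Multiplication by `-2π i y` becomes differentiation of the Fourier transform. -/
theorem hasDerivAt_coef_fourierKer {g : ℝ → ℂ} (hg : MemLp g 2 volI) (ξ : ℝ) :
    HasDerivAt (coef fourierKer g)
      (coef fourierKer (fun y => (-2 * Real.pi * Complex.I * y) * g y) ξ) ξ := by
  have hG1 : Integrable ((Set.Ioo (-1 : ℝ) 1).indicator g) volume :=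
    (integrable_indicator_iff measurableSet_Ioo).mpr (memLp_integrable hg)
  have hG2 : Integrable (fun y : ℝ => y • (Set.Ioo (-1 : ℝ) 1).indicator g y) volume := by
    refine hG1.norm.mono' (by fun_prop) (Filter.Eventually.of_forall fun y => ?_)
    by_cases hy : y ∈ Set.Ioo (-1 : ℝ) 1
    · rw [norm_smul]
      have : ‖y‖ ≤ 1 := by rw [Real.norm_eq_abs, abs_le]; exact ⟨hy.1.le, hy.2.le⟩
      nlinarith [norm_nonneg ((Set.Ioo (-1 : ℝ) 1).indicator g y)]
    · simp [hy]
  have := Real.hasDerivAt_fourier hG1 hG2 ξ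
  rw [show coef fourierKer g = _ from funext (coef_fourierKer_eq g), coef_fourierKer_eq]
  have e : (Set.Ioo (-1 : ℝ) 1).indicator (fun y => (-2 * Real.pi * Complex.I * y) * g y)
      = fun x : ℝ => (-2 * Real.pi * Complex.I * x) • (Set.Ioo (-1 : ℝ) 1).indicator g x := by
    ext y
    by_cases hy : y ∈ Set.Ioo (-1 : ℝ) 1
    · simp [hy]
    · simp [hy]
  rw [e]
  exact this

theorem hasSum_of_eq {f g : ℤ → ℝ} {a : ℝ} (h : HasSum g a) (e : ∀ n, f n = g n) :
    HasSum f a := by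
  rwa [funext e]

/-- Parseval's identity on `(-2, 2)` for the even (`σ = 1`) or odd (`σ = -1`) reflection of a
function on `I`. -/
theorem hasSum_reflection {g : ℝ → ℂ} (hg : MemLp g 2 volI) {σ : ℂ} (hσ : ‖σ‖ = 1) :
    HasSum (fun n : ℤ => ‖∫ y, g y * (Complex.exp (((-(n * Real.pi * (y + 1) / 2) : ℝ) : ℂ) * Complex.I)
      + σ * Complex.exp (((n * Real.pi * (y + 1) / 2 : ℝ) : ℂ) * Complex.I)) ∂volI‖ ^ 2)
      (8 * nsq g) := by
  set G : ℝ → ℂ := (Set.Ioo (-1 : ℝ) 1).indicator g with hG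
  have hG2 : MemLp G 2 volume := (memLp_indicator_iff_restrict measurableSet_Ioo).mpr hg
  have hG1 : Integrable G volume :=
    (integrable_indicator_iff measurableSet_Ioo).mpr (memLp_integrable hg)
  have hGz : ∀ y, y ∉ Set.Ioo (-1 : ℝ) 1 → G y = 0 := fun y hy => by simp [hG, hy]
  set f : ℝ → ℂ := fun x => G (x - 1) + σ * G (-1 - x) with hf
  have hm1 : MemLp (fun x => G (x - 1)) 2 volume :=
    hG2.comp_measurePreserving (measurePreserving_sub_right volume 1)
  have hm2 : MemLp (fun x => G (-1 - x)) 2 volume :=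
    hG2.comp_measurePreserving (Measure.measurePreserving_sub_left volume (-1))
  have hf2 : MemLp f 2 volume := hm1.add (hm2.const_mul σ)
  have hfs : ∀ x, x ∉ Set.Ioc (-2 : ℝ) 2 → f x = 0 := by
    intro x hx
    simp only [hf]
    rw [hGz (x - 1), hGz (-1 - x)]
    · simp
    · intro h; exact hx ⟨by linarith [h.2], by linarith [h.1]⟩
    · intro h; exact hx ⟨by linarith [h.1], by linarith [h.2]⟩
  have H := hasSum_sq_fourierCoeffOn (show (-2 : ℝ) < 2 by norm_num) (hf2.restrict (Set.Ioc (-2) 2))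
  have hnorm : ∫ x in (-2 : ℝ)..2, ‖f x‖ ^ 2 = 2 * nsq g := by
    rw [intervalIntegral.integral_eq_integral_of_support_subset]
    · have h1 : ∀ x, ‖f x‖ ^ 2 = ‖G (x - 1)‖ ^ 2 + ‖G (-1 - x)‖ ^ 2 := by
        intro x
        simp only [hf]
        by_cases hx : 0 < x
        · rw [hGz (-1 - x)]
          · simp
          · intro h; linarith [h.1]
        · rw [hGz (x - 1)]
          · simp [hσ]
          · intro h; linarith [h.1]
      simp_rw [h1]
      rw [integral_add (integrable_normSq hm1) (integrable_normSq hm2),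
        integral_sub_right_eq_self (fun x => ‖G x‖ ^ 2),
        integral_sub_left_eq_self (fun x => ‖G x‖ ^ 2)]
      have h2 : ∫ x, ‖G x‖ ^ 2 = nsq g := by
        rw [nsq, volI, ← integral_indicator measurableSet_Ioo]
        congr 1; ext y
        by_cases hy : y ∈ Set.Ioo (-1 : ℝ) 1
        · simp [hG, hy]
        · simp [hG, hy]
      rw [h2]; ring
    · intro x hx
      by_contra hcon
      exact hx (by simp [hfs x hcon])
  rw [hnorm] at H
  have H2 := H.mul_left 16
  have hval : (16 : ℝ) * ((2 - -2 : ℝ)⁻¹ • (2 * nsq g)) = 8 * nsq g := by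
    rw [smul_eq_mul]; norm_num; ring
  rw [hval] at H2
  refine hasSum_of_eq H2 fun n => ?_
  have hexp : ∀ x : ℝ, (fourier (-n) (x : AddCircle (2 - -2 : ℝ)) : ℂ)
      = Complex.exp (((-(n * Real.pi * x / 2) : ℝ) : ℂ) * Complex.I) := by
    intro x
    rw [fourier_coe_apply]
    congr 1
    push_cast
    ring
  have hE : ∀ h : ℝ → ℝ, Continuous h → ∀ u : ℝ → ℂ, Integrable u →
      Integrable (fun x => Complex.exp ((h x : ℂ) * Complex.I) * u x) := by
    intro h hh u hu
    refine hu.bdd_mul (c := 1) (by fun_prop) (Filter.Eventually.of_forall fun x => ?_)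
    rw [Complex.norm_exp_ofReal_mul_I]
  have hc : fourierCoeffOn (show (-2 : ℝ) < 2 by norm_num) f n = (1 / 4 : ℝ) •
      ∫ y, g y * (Complex.exp (((-(n * Real.pi * (y + 1) / 2) : ℝ) : ℂ) * Complex.I)
      + σ * Complex.exp (((n * Real.pi * (y + 1) / 2 : ℝ) : ℂ) * Complex.I)) ∂volI := by
    rw [fourierCoeffOn_eq_integral]
    congr 1
    · norm_num
    simp only [hexp, smul_eq_mul]
    rw [intervalIntegral.integral_eq_integral_of_support_subset]
    · have h1 : ∀ x : ℝ, Complex.exp (((-(n * Real.pi * x / 2) : ℝ) : ℂ) * Complex.I) * f x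
          = Complex.exp (((-(n * Real.pi * ((x - 1) + 1) / 2) : ℝ) : ℂ) * Complex.I) * G (x - 1)
            + σ * (Complex.exp (((n * Real.pi * ((-1 - x) + 1) / 2 : ℝ) : ℂ) * Complex.I)
              * G (-1 - x)) := by
        intro x
        have e1 : x - 1 + 1 = x := by ring
        have e2 : n * Real.pi * ((-1 - x) + 1) / 2 = -(n * Real.pi * x / 2) := by ring
        rw [e1, e2]
        simp only [hf]; ring
      simp_rw [h1]
      have i1 := hE (fun y => -(n * Real.pi * (y + 1) / 2)) (by fun_prop) G hG1
      have i2 := hE (fun y => n * Real.pi * (y + 1) / 2) (by fun_prop) G hG1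
      rw [integral_add (i1.comp_sub_right 1) ((i2.comp_sub_left (-1)).const_mul σ),
        integral_const_mul,
        integral_sub_right_eq_self (fun y => Complex.exp (((-(n * Real.pi * (y + 1) / 2) : ℝ) : ℂ)
          * Complex.I) * G y),
        integral_sub_left_eq_self (fun y => Complex.exp (((n * Real.pi * (y + 1) / 2 : ℝ) : ℂ)
          * Complex.I) * G y), ← integral_const_mul, ← integral_add i1 (i2.const_mul σ),
        volI, ← integral_indicator measurableSet_Ioo]
      congr 1; ext y
      by_cases hy : y ∈ Set.Ioo (-1 : ℝ) 1
      · simp only [hG, hy, Set.indicator_of_mem]; ring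
      · simp [hG, hy]
    · intro x hx
      by_contra hcon
      exact hx (by simp [hfs x hcon])
  rw [hc, norm_smul, mul_pow]
  norm_num
  ring

/-- The wave numbers `nπ/2` of `I`. -/
def wave (n : ℤ) : ℝ := n * Real.pi / 2

/-- The Dirichlet eigenfunctions `sin(nπ(y+1)/2)` of `I`, indexed by all of `ℤ`. -/
def sinKer (n : ℤ) (y : ℝ) : ℂ := ((Real.sin (wave n * (y + 1)) : ℝ) : ℂ)

/-- The Neumann eigenfunctions `cos(nπ(y+1)/2)` of `I`, indexed by all of `ℤ`. -/
def cosKer (n : ℤ) (y : ℝ) : ℂ := ((Real.cos (wave n * (y + 1)) : ℝ) : ℂ)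

theorem isParsevalFrame_of_hasSum {ψ : ℤ → ℝ → ℂ} {κ : ℝ} (hc : ∀ n, Continuous (ψ n))
    (hb : ∀ n y, ‖ψ n y‖ ≤ 1)
    (H : ∀ g, MemLp g 2 volI → HasSum (fun n => ‖coef ψ g n‖ ^ 2) (κ * nsq g)) :
    IsParsevalFrame Measure.count ψ κ := by
  have hint : ∀ g, MemLp g 2 volI → Integrable (fun n => ‖coef ψ g n‖ ^ 2) Measure.count := by
    intro g hg
    rw [integrable_count_iff]
    exact (H g hg).summable.norm
  refine ⟨measurable_from_prod_countable_right fun n => (hc n).measurable, hb, fun g hg => ?_,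
    fun g hg => ?_⟩
  · rw [← memLp_norm_iff (by fun_prop), memLp_two_iff_integrable_sq (by fun_prop)]
    exact hint g hg
  · rw [integral_countable (hint g hg)]
    simp only [Measure.real, Measure.count_singleton, ENNReal.toReal_one, one_smul]
    exact (H g hg).tsum_eq

/-- Each sine mode occurs twice, for `n` and `-n`; hence the constant `2`. -/
theorem isParsevalFrame_sinKer : IsParsevalFrame Measure.count sinKer 2 := by
  refine isParsevalFrame_of_hasSum (fun n => by unfold sinKer; fun_prop) (fun n y => ?_)
    (fun g hg => ?_)
  · rw [sinKer, Complex.norm_real]; exact Real.abs_sin_le_one _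
  have h := (hasSum_reflection hg (σ := -1) (by simp)).mul_left (1 / 4)
  rw [show 2 * nsq g = 1 / 4 * (8 * nsq g) by ring]
  refine hasSum_of_eq h fun n => ?_
  · have e : ∀ y : ℝ, g y * (Complex.exp (((-(n * Real.pi * (y + 1) / 2) : ℝ) : ℂ) * Complex.I)
        + -1 * Complex.exp (((n * Real.pi * (y + 1) / 2 : ℝ) : ℂ) * Complex.I))
        = (-2 * Complex.I) * (g y * sinKer n y) := by
      intro y
      rw [Complex.ofReal_neg, Complex.exp_mul_I, Complex.exp_mul_I, Complex.cos_neg, Complex.sin_neg,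
        sinKer, wave, Complex.ofReal_sin]
      rw [show n * Real.pi / 2 * (y + 1) = n * Real.pi * (y + 1) / 2 by ring]
      ring
    simp_rw [e]
    rw [integral_const_mul, norm_mul, mul_pow, coef]
    norm_num; ring

theorem isParsevalFrame_cosKer : IsParsevalFrame Measure.count cosKer 2 := by
  refine isParsevalFrame_of_hasSum (fun n => by unfold cosKer; fun_prop) (fun n y => ?_)
    (fun g hg => ?_)
  · rw [cosKer, Complex.norm_real]; exact Real.abs_cos_le_one _
  have h := (hasSum_reflection hg (σ := 1) (by simp)).mul_left (1 / 4)
  rw [show 2 * nsq g = 1 / 4 * (8 * nsq g) by ring]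
  refine hasSum_of_eq h fun n => ?_
  · have e : ∀ y : ℝ, g y * (Complex.exp (((-(n * Real.pi * (y + 1) / 2) : ℝ) : ℂ) * Complex.I)
        + 1 * Complex.exp (((n * Real.pi * (y + 1) / 2 : ℝ) : ℂ) * Complex.I))
        = 2 * (g y * cosKer n y) := by
      intro y
      rw [Complex.ofReal_neg, Complex.exp_mul_I, Complex.exp_mul_I, Complex.cos_neg, Complex.sin_neg,
        cosKer, wave, Complex.ofReal_cos]
      rw [show n * Real.pi / 2 * (y + 1) = n * Real.pi * (y + 1) / 2 by ring]
      ring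
    simp_rw [e]
    rw [integral_const_mul, norm_mul, mul_pow, coef]
    norm_num; ring

theorem hasDerivAt_sinKer (n : ℤ) (y : ℝ) :
    HasDerivAt (sinKer n) (wave n * cosKer n y) y := by
  have h1 : HasDerivAt (fun y : ℝ => wave n * (y + 1)) (wave n) y := by
    simpa using ((hasDerivAt_id' y).add_const 1).const_mul (wave n)
  exact (h1.sin.ofReal_comp).congr_deriv (by rw [cosKer]; push_cast; ring)

theorem hasDerivAt_cosKer (n : ℤ) (y : ℝ) :
    HasDerivAt (cosKer n) (-(wave n * sinKer n y)) y := by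
  have h1 : HasDerivAt (fun y : ℝ => wave n * (y + 1)) (wave n) y := by
    simpa using ((hasDerivAt_id' y).add_const 1).const_mul (wave n)
  exact (h1.cos.ofReal_comp).congr_deriv (by rw [sinKer]; push_cast; ring)

theorem contDiff_sinKer (n : ℤ) : ContDiff ℝ (⊤ : ℕ∞) (sinKer n) := by
  unfold sinKer
  exact Complex.ofRealCLM.contDiff.comp (Real.contDiff_sin.comp (by fun_prop))

theorem contDiff_cosKer (n : ℤ) : ContDiff ℝ (⊤ : ℕ∞) (cosKer n) := by
  unfold cosKer
  exact Complex.ofRealCLM.contDiff.comp (Real.contDiff_cos.comp (by fun_prop))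

theorem sinKer_neg_one (n : ℤ) : sinKer n (-1) = 0 := by simp [sinKer]

theorem sinKer_one (n : ℤ) : sinKer n 1 = 0 := by
  rw [sinKer, wave, show (n : ℝ) * Real.pi / 2 * (1 + 1) = n * Real.pi by ring, Real.sin_int_mul_pi]
  simp

/-- On `H¹₀(I)` the cosine coefficients of the derivative are the wave numbers times the sine
coefficients. -/
theorem IsH10.coef_cosKer {u p : ℝ → ℂ} (h : IsH10 u p) (n : ℤ) :
    coef cosKer p n = wave n * coef sinKer u n := by
  have := h.integral_mul_deriv ((contDiff_cosKer n).of_le (by exact_mod_cast le_top))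
  rw [show deriv (cosKer n) = fun y => -(wave n * sinKer n y) from
    funext fun y => (hasDerivAt_cosKer n y).deriv] at this
  rw [coef, coef, ← neg_eq_iff_eq_neg.mpr this, ← integral_neg, ← integral_const_mul]
  congr 1; ext y; ring

/-! ### Space-time functions -/

/-- Lebesgue measure on the time interval `(0, τ)`. -/
def muT (τ : ℝ) : Measure ℝ := volume.restrict (Set.Ioo 0 τ)

instance (τ : ℝ) : IsFiniteMeasure (muT τ) := by unfold muT; infer_instance

theorem ae_muT_mem (τ : ℝ) : ∀ᵐ t ∂muT τ, t ∈ Set.Ioo (0 : ℝ) τ := ae_restrict_mem measurableSet_Ioo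

theorem muT_mono {t τ : ℝ} (h : t ≤ τ) : muT t ≤ muT τ :=
  Measure.restrict_mono (Set.Ioo_subset_Ioo_right h) le_rfl

theorem intervalIntegral_eq_muT {E : Type*} [NormedAddCommGroup E] [NormedSpace ℝ E] {t : ℝ}
    (ht : 0 ≤ t) (f : ℝ → E) : ∫ s in (0 : ℝ)..t, f s = ∫ s, f s ∂muT t := by
  rw [intervalIntegral.integral_of_le ht, integral_Ioc_eq_integral_Ioo, muT]

theorem muT_eq_indicator {E : Type*} [NormedAddCommGroup E] [NormedSpace ℝ E] {t τ : ℝ}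
    (ht : t ≤ τ) (f : ℝ → E) : ∫ s, f s ∂muT t = ∫ s, (if s < t then f s else 0) ∂muT τ := by
  have h : (fun s => if s < t then f s else 0) = (Set.Iio t).indicator f := by
    ext s; simp [Set.indicator_apply]
  rw [h, integral_indicator measurableSet_Iio, muT, muT,
    Measure.restrict_restrict measurableSet_Iio]
  congr 2
  ext s
  simp only [Set.mem_Ioo, Set.mem_inter_iff, Set.mem_Iio]
  constructor
  · rintro ⟨h1, h2⟩; exact ⟨h2, h1, h2.trans_le ht⟩
  · rintro ⟨h1, h2, h3⟩; exact ⟨h2, h1⟩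

theorem intervalIntegrable_of_muT {E : Type*} [NormedAddCommGroup E] {t τ : ℝ} (h0 : 0 ≤ t)
    (h : t ≤ τ) {f : ℝ → E} (hf : Integrable f (muT τ)) : IntervalIntegrable f volume 0 t :=
  intervalIntegrable_of_Ioo h0 (hf.mono_measure (muT_mono h))

/-- A Borel function that is square integrable on `(0, τ) × I`. -/
structure L2Q (τ : ℝ) (F : ℝ → ℝ → ℂ) : Prop where
  measurable : Measurable (Function.uncurry F)
  memLp : MemLp (Function.uncurry F) 2 ((muT τ).prod volI)

namespace L2Q
variable {τ : ℝ} {F G : ℝ → ℝ → ℂ}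

theorem slice_measurable (hF : L2Q τ F) (t : ℝ) : Measurable (F t) :=
  hF.measurable.comp measurable_prodMk_left

theorem slice (hF : L2Q τ F) : ∀ᵐ t ∂muT τ, MemLp (F t) 2 volI := by
  have := (integrable_normSq hF.memLp).prod_right_ae
  filter_upwards [this] with t ht
  rw [← memLp_norm_iff (hF.slice_measurable t).aestronglyMeasurable,
    memLp_two_iff_integrable_sq (hF.slice_measurable t).norm.aestronglyMeasurable]
  exact ht

theorem integrable_nsq (hF : L2Q τ F) : Integrable (fun t => nsq (F t)) (muT τ) :=
  (integrable_normSq hF.memLp).integral_prod_left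

theorem add (hF : L2Q τ F) (hG : L2Q τ G) : L2Q τ (fun t y => F t y + G t y) :=
  ⟨hF.measurable.add hG.measurable, hF.memLp.add hG.memLp⟩

theorem sub (hF : L2Q τ F) (hG : L2Q τ G) : L2Q τ (fun t y => F t y - G t y) :=
  ⟨hF.measurable.sub hG.measurable, hF.memLp.sub hG.memLp⟩

theorem const_mul (hF : L2Q τ F) (c : ℂ) : L2Q τ (fun t y => c * F t y) :=
  ⟨hF.measurable.const_mul c, hF.memLp.const_mul c⟩

/-- Multiplication by a function of space that is bounded on `I`. -/
theorem mul_space (hF : L2Q τ F) {κ : ℝ → ℂ} (hκ : Measurable κ) {B : ℝ}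
    (hB : ∀ y ∈ Set.Ioo (-1 : ℝ) 1, ‖κ y‖ ≤ B) : L2Q τ (fun t y => κ y * F t y) := by
  refine ⟨(hκ.comp measurable_snd).mul hF.measurable, ?_⟩
  refine hF.memLp.of_le_mul (c := B)
    ((hκ.comp measurable_snd).mul hF.measurable).aestronglyMeasurable ?_
  have h : ∀ᵐ p ∂(muT τ).prod volI, p.2 ∈ Set.Ioo (-1 : ℝ) 1 :=
    Measure.quasiMeasurePreserving_snd.ae ae_volI_mem
  filter_upwards [h] with p hp
  simp only [Function.uncurry, norm_mul]
  gcongr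
  exact hB _ hp

theorem mono {t : ℝ} (hF : L2Q τ F) (h : t ≤ τ) : L2Q t F :=
  ⟨hF.measurable, hF.memLp.mono_measure (Measure.prod_mono (muT_mono h) le_rfl)⟩

/-- The pairing of two space-time functions is integrable in time. -/
theorem integrable_pairing (hF : L2Q τ F) (hG : L2Q τ G) :
    Integrable (fun t => ∫ y, (starRingEnd ℂ) (F t y) * G t y ∂volI) (muT τ) :=
  (integrable_conj_mul hF.memLp hG.memLp).integral_prod_left

section coef
variable {X : Type*} [MeasurableSpace X] {μ : Measure X} {ψ : X → ℝ → ℂ} {κ : ℝ}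

theorem measurable_coef (hF : L2Q τ F) (hψ : IsParsevalFrame μ ψ κ) :
    Measurable (Function.uncurry fun t x => coef ψ (F t) x) := by
  refine StronglyMeasurable.measurable ?_
  refine StronglyMeasurable.integral_prod_right
    (f := fun (p : ℝ × X) (y : ℝ) => F p.1 y * ψ p.2 y) ?_
  refine Measurable.stronglyMeasurable ?_
  refine Measurable.mul ?_ ?_
  · exact hF.measurable.comp (f := fun q : (ℝ × X) × ℝ => (q.1.1, q.2)) (by fun_prop)
  · exact hψ.measurable.comp (f := fun q : (ℝ × X) × ℝ => (q.1.2, q.2)) (by fun_prop)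

theorem memLp_coef [SFinite μ] (hF : L2Q τ F) (hψ : IsParsevalFrame μ ψ κ) :
    MemLp (Function.uncurry fun t x => coef ψ (F t) x) 2 ((muT τ).prod μ) := by
  have hm := hF.measurable_coef hψ
  rw [← memLp_norm_iff hm.aestronglyMeasurable,
    memLp_two_iff_integrable_sq hm.norm.aestronglyMeasurable,
    integrable_prod_iff (hm.norm.pow_const 2).aestronglyMeasurable]
  constructor
  · filter_upwards [hF.slice] with t ht
    exact integrable_normSq (hψ.memLp _ ht)
  · have : Integrable (fun t => κ * nsq (F t)) (muT τ) := hF.integrable_nsq.const_mul κ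
    refine this.congr ?_
    filter_upwards [hF.slice] with t ht
    rw [← hψ.parseval _ ht]
    congr 1; ext x
    simp [Function.uncurry]

end coef
end L2Q

/-! ### The abstract energy identity -/

/-- A primitive `u = u₀ + ∫ h` satisfies `|u|² = |u₀|² + ∫ 2 Re(ū h)`, also when `u` is only known
almost everywhere. -/
theorem ae_normSq_eq {τ : ℝ} {u h : ℝ → ℂ} {u₀ : ℂ} (hh : Integrable h (muT τ))
    (heq : ∀ᵐ t ∂muT τ, u t = u₀ + ∫ s in (0 : ℝ)..t, h s) :
    ∀ᵐ t ∂muT τ, ‖u t‖ ^ 2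
      = ‖u₀‖ ^ 2 + ∫ s in (0 : ℝ)..t, 2 * ((starRingEnd ℂ) (u s) * h s).re := by
  filter_upwards [heq, ae_muT_mem τ] with t ht htτ
  rw [ht, normSq_primitive (intervalIntegrable_of_muT htτ.1.le htτ.2.le hh)]
  congr 1
  rw [intervalIntegral_eq_muT htτ.1.le, intervalIntegral_eq_muT htτ.1.le]
  apply integral_congr_ae
  filter_upwards [ae_mono (muT_mono htτ.2.le) heq] with s hs
  rw [hs]

/-- Energy identity for a family of scalar equations `∂ₜu(·, x) = h(·, x)`, weighted by `m`. -/
theorem energy_identity {X : Type*} [MeasurableSpace X] {μ : Measure X} [SFinite μ] {τ : ℝ}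
    {u h : ℝ → X → ℂ} {u₀ : X → ℂ} {m : X → ℝ}
    (hu : Measurable (Function.uncurry u)) (hh : Measurable (Function.uncurry h))
    (hu₀ : Measurable u₀) (hint : ∀ x, Integrable (fun s => h s x) (muT τ))
    (heq : ∀ x, ∀ᵐ t ∂muT τ, u t x = u₀ x + ∫ s in (0 : ℝ)..t, h s x)
    (hI : Integrable (fun p : ℝ × X => m p.2 * ((starRingEnd ℂ) (u p.1 p.2) * h p.1 p.2).re)
      ((muT τ).prod μ))
    (h0 : Integrable (fun x => m x * ‖u₀ x‖ ^ 2) μ) :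
    ∀ᵐ t ∂muT τ, ∫ x, m x * ‖u t x‖ ^ 2 ∂μ = (∫ x, m x * ‖u₀ x‖ ^ 2 ∂μ)
      + ∫ s in (0 : ℝ)..t, 2 * ∫ x, m x * ((starRingEnd ℂ) (u s x) * h s x).re ∂μ := by
  set w : ℝ → X → ℝ := fun s x => 2 * ((starRingEnd ℂ) (u s x) * h s x).re with hw
  have hwm : Measurable (Function.uncurry w) :=
    (Complex.measurable_re.comp ((Complex.continuous_conj.measurable.comp hu).mul hh)).const_mul 2
  have hset : MeasurableSet {q : X × ℝ | ‖u q.2 q.1‖ ^ 2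
      = ‖u₀ q.1‖ ^ 2 + ∫ s, (if s < q.2 then w s q.1 else 0) ∂muT τ} := by
    refine measurableSet_eq_fun ?_ ?_
    · exact ((hu.comp measurable_swap).norm).pow_const 2
    · refine (((hu₀.comp measurable_fst).norm).pow_const 2).add ?_
      refine StronglyMeasurable.measurable ?_
      refine StronglyMeasurable.integral_prod_right
        (f := fun (q : X × ℝ) (s : ℝ) => if s < q.2 then w s q.1 else 0) ?_
      refine Measurable.stronglyMeasurable ?_
      refine Measurable.ite (measurableSet_lt measurable_snd
        (measurable_snd.comp measurable_fst)) ?_ measurable_const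
      exact hwm.comp (f := fun z : (X × ℝ) × ℝ => (z.2, z.1.1)) (by fun_prop)
  have hpt : ∀ᵐ x ∂μ, ∀ᵐ t ∂muT τ, ‖u t x‖ ^ 2
      = ‖u₀ x‖ ^ 2 + ∫ s, (if s < t then w s x else 0) ∂muT τ := by
    refine Filter.Eventually.of_forall fun x => ?_
    filter_upwards [ae_normSq_eq (hint x) (heq x), ae_muT_mem τ] with t ht htτ
    rw [ht, intervalIntegral_eq_muT htτ.1.le, muT_eq_indicator htτ.2.le]
  have hpt' := (Measure.ae_ae_comm hset).mp hpt
  filter_upwards [hpt', ae_muT_mem τ] with t ht htτ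
  have hI2 : Integrable (fun p : ℝ × X => if p.1 < t then m p.2 * w p.1 p.2 else 0)
      ((muT τ).prod μ) := by
    have h1 : Integrable (fun p : ℝ × X => m p.2 * w p.1 p.2) ((muT τ).prod μ) := by
      refine (hI.const_mul 2).congr (Filter.Eventually.of_forall fun p => ?_)
      simp only [hw]; ring
    have := h1.indicator (s := {p : ℝ × X | p.1 < t}) (measurableSet_lt measurable_fst measurable_const)
    refine this.congr (Filter.Eventually.of_forall fun p => ?_)
    simp [Set.indicator_apply]
  have e1 : ∫ x, m x * ‖u t x‖ ^ 2 ∂μ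
      = ∫ x, (m x * ‖u₀ x‖ ^ 2 + ∫ s, (if s < t then m x * w s x else 0) ∂muT τ) ∂μ := by
    refine integral_congr_ae (ht.mono fun x hx => ?_)
    simp only [hx, mul_add, ← integral_const_mul, mul_ite, mul_zero]
  rw [e1, integral_add h0 hI2.integral_prod_right, ← integral_integral_swap hI2,
    intervalIntegral_eq_muT htτ.1.le, muT_eq_indicator htτ.2.le]
  congr 1
  apply integral_congr_ae
  refine Filter.Eventually.of_forall fun s => ?_
  by_cases hs : s < t
  · simp only [hs, if_true, hw]
    rw [← integral_const_mul]
    congr 1; ext x; ring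
  · simp [hs]

/-! ### Weak solutions in divergence form -/

/-- `v` solves `∂ₜv = G₀ - ∂_y G₁` weakly on `(0, τ) × I`, with values in `H¹₀(I)` (`∂_y v = p`)
and initial datum `v₀`; the equation is integrated in time and tested with functions of space that
vanish at `±1`. -/
structure IsEvolution (τ : ℝ) (v₀ : ℝ → ℂ) (v p G₀ G₁ : ℝ → ℝ → ℂ) : Prop where
  v_mem : L2Q τ v
  p_mem : L2Q τ p
  G₀_mem : L2Q τ G₀
  G₁_mem : L2Q τ G₁
  v₀_mem : MemLp v₀ 2 volI
  isH10 : ∀ᵐ t ∂muT τ, IsH10 (v t) (p t)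
  eq : ∀ ψ : ℝ → ℂ, ContDiff ℝ (⊤ : ℕ∞) ψ → ψ (-1) = 0 → ψ 1 = 0 → ∀ᵐ t ∂muT τ,
    ∫ y, v t y * ψ y ∂volI = (∫ y, v₀ y * ψ y ∂volI)
      + ∫ s in (0 : ℝ)..t, ∫ y, (G₀ s y * ψ y + G₁ s y * deriv ψ y) ∂volI

theorem integrable_muT_coef {X : Type*} [MeasurableSpace X] {μ : Measure X} {ψ : X → ℝ → ℂ}
    {κ τ : ℝ} {F : ℝ → ℝ → ℂ} (hF : L2Q τ F) (hψ : IsParsevalFrame μ ψ κ) (x : X) :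
    Integrable (fun s => coef ψ (F s) x) (muT τ) := by
  have h1 : MemLp (fun q : ℝ × ℝ => ψ x q.2) 2 ((muT τ).prod volI) := by
    refine MemLp.of_bound (Measurable.aestronglyMeasurable ?_) 1
      (Filter.Eventually.of_forall fun q => hψ.norm_le_one x q.2)
    exact hψ.measurable.comp (measurable_const.prodMk measurable_snd)
  exact (integrable_mul_of_memLp hF.memLp h1).integral_prod_left

theorem measurable_coef_of_memLp {X : Type*} [MeasurableSpace X] {μ : Measure X} {ψ : X → ℝ → ℂ}
    {κ : ℝ} {g : ℝ → ℂ} (hg : Measurable g) (hψ : IsParsevalFrame μ ψ κ) :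
    Measurable (coef ψ g) := by
  refine StronglyMeasurable.measurable ?_
  refine StronglyMeasurable.integral_prod_right (f := fun (x : X) (y : ℝ) => g y * ψ x y) ?_
  exact ((hg.comp measurable_snd).mul hψ.measurable).stronglyMeasurable

/-- The sine coefficients of an evolution solve scalar equations in time; no boundary term appears
because the sine modes vanish at `±1`. -/
theorem IsEvolution.coef_sinKer {τ : ℝ} {v₀ : ℝ → ℂ} {v p G₀ G₁ : ℝ → ℝ → ℂ}
    (h : IsEvolution τ v₀ v p G₀ G₁) (n : ℤ) :
    ∀ᵐ t ∂muT τ, coef sinKer (v t) n = coef sinKer v₀ n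
      + ∫ s in (0 : ℝ)..t, (coef sinKer (G₀ s) n + wave n * coef cosKer (G₁ s) n) := by
  filter_upwards [h.eq (sinKer n) (contDiff_sinKer n) (sinKer_neg_one n) (sinKer_one n),
    ae_muT_mem τ] with t ht htτ
  rw [coef, ht, coef]
  congr 1
  rw [intervalIntegral_eq_muT htτ.1.le, intervalIntegral_eq_muT htτ.1.le]
  apply integral_congr_ae
  filter_upwards [ae_mono (muT_mono htτ.2.le) h.G₀_mem.slice,
    ae_mono (muT_mono htτ.2.le) h.G₁_mem.slice] with s h0 h1
  have e : ∀ y, G₁ s y * deriv (sinKer n) y = wave n * (G₁ s y * cosKer n y) := fun y => by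
    rw [(hasDerivAt_sinKer n y).deriv]; ring
  simp only [e]
  rw [integral_add (isParsevalFrame_sinKer.integrable h0 n)
    ((isParsevalFrame_cosKer.integrable h1 n).const_mul _), integral_const_mul, coef, coef]

/-- The `L²` energy identity. -/
theorem IsEvolution.energy {τ : ℝ} {v₀ : ℝ → ℂ} {v p G₀ G₁ : ℝ → ℝ → ℂ}
    (h : IsEvolution τ v₀ v p G₀ G₁) :
    ∀ᵐ t ∂muT τ, nsq (v t) = nsq v₀ + ∫ s in (0 : ℝ)..t,
      2 * ((∫ y, (starRingEnd ℂ) (v s y) * G₀ s y ∂volI)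
        + ∫ y, (starRingEnd ℂ) (p s y) * G₁ s y ∂volI).re := by
  have hS := isParsevalFrame_sinKer
  have hC := isParsevalFrame_cosKer
  have key : ∀ s n, IsH10 (v s) (p s) →
      (starRingEnd ℂ) (coef sinKer (v s) n)
        * (coef sinKer (G₀ s) n + wave n * coef cosKer (G₁ s) n)
      = (starRingEnd ℂ) (coef sinKer (v s) n) * coef sinKer (G₀ s) n
        + (starRingEnd ℂ) (coef cosKer (p s) n) * coef cosKer (G₁ s) n := by
    intro s n hs
    rw [hs.coef_cosKer, map_mul, Complex.conj_ofReal]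
    ring
  have hprod : Integrable (fun q : ℝ × ℤ =>
      (starRingEnd ℂ) (coef sinKer (v q.1) q.2) * coef sinKer (G₀ q.1) q.2
        + (starRingEnd ℂ) (coef cosKer (p q.1) q.2) * coef cosKer (G₁ q.1) q.2)
      ((muT τ).prod Measure.count) :=
    (integrable_conj_mul (h.v_mem.memLp_coef hS) (h.G₀_mem.memLp_coef hS)).add
      (integrable_conj_mul (h.p_mem.memLp_coef hC) (h.G₁_mem.memLp_coef hC))
  have hae : ∀ᵐ q ∂(muT τ).prod (Measure.count : Measure ℤ), IsH10 (v q.1) (p q.1) :=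
    Measure.quasiMeasurePreserving_fst.ae h.isH10
  have hE := energy_identity (μ := (Measure.count : Measure ℤ)) (τ := τ) (m := fun _ => 1)
    (u := fun t n => coef sinKer (v t) n)
    (h := fun s n => coef sinKer (G₀ s) n + wave n * coef cosKer (G₁ s) n)
    (u₀ := coef sinKer v₀) (h.v_mem.measurable_coef hS)
    ((h.G₀_mem.measurable_coef hS).add
      ((Complex.measurable_ofReal.comp ((measurable_of_countable wave).comp measurable_snd)).mul
        (h.G₁_mem.measurable_coef hC)))
    (measurable_of_countable _)
    (fun n => (integrable_muT_coef h.G₀_mem hS n).add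
      ((integrable_muT_coef h.G₁_mem hC n).const_mul _))
    h.coef_sinKer ?_ ?_
  · filter_upwards [hE, h.v_mem.slice, ae_muT_mem τ] with t ht hvt htτ
    simp only [one_mul] at ht
    rw [hS.parseval _ hvt, hS.parseval _ h.v₀_mem] at ht
    have e : ∫ s in (0 : ℝ)..t, 2 * ∫ n, ((starRingEnd ℂ) (coef sinKer (v s) n)
          * (coef sinKer (G₀ s) n + wave n * coef cosKer (G₁ s) n)).re ∂Measure.count
        = 2 * ∫ s in (0 : ℝ)..t, 2 * ((∫ y, (starRingEnd ℂ) (v s y) * G₀ s y ∂volI)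
        + ∫ y, (starRingEnd ℂ) (p s y) * G₁ s y ∂volI).re := by
      rw [intervalIntegral_eq_muT htτ.1.le, intervalIntegral_eq_muT htτ.1.le,
        ← integral_const_mul]
      apply integral_congr_ae
      have hm := muT_mono htτ.2.le
      filter_upwards [ae_mono hm h.isH10, ae_mono hm h.v_mem.slice, ae_mono hm h.p_mem.slice,
        ae_mono hm h.G₀_mem.slice, ae_mono hm h.G₁_mem.slice] with s h1 h2 h3 h4 h5
      simp only [key s _ h1]
      have i1 := integrable_conj_mul (hS.memLp _ h2) (hS.memLp _ h4)
      have i2 := integrable_conj_mul (hC.memLp _ h3) (hC.memLp _ h5)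
      have hre := (Complex.reCLM.integral_comp_comm (i1.add i2))
      simp only [Complex.reCLM_apply, Pi.add_apply] at hre
      rw [hre, integral_add i1 i2, hS.inner h2 h4, hC.inner h3 h5, ← mul_add]
      congr 1
      rw [Complex.re_ofReal_mul]
    rw [e] at ht
    linarith
  · refine (hprod.re).congr ?_
    filter_upwards [hae] with q hq
    simp only [one_mul]
    rw [key _ _ hq]
    rfl
  · simpa using integrable_normSq (hS.memLp _ h.v₀_mem)

/-! ### Fourier multipliers applied to localised solutions -/

theorem hasDerivAt_fourierKer (ξ y : ℝ) :
    HasDerivAt (fourierKer ξ) ((-2 * Real.pi * Complex.I * ξ) * fourierKer ξ y) y := by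
  have h1 : HasDerivAt (fun y : ℝ => -2 * Real.pi * ξ * y) (-2 * Real.pi * ξ) y := by
    simpa using (hasDerivAt_id' y).const_mul (-2 * Real.pi * ξ)
  exact ((h1.ofReal_comp.mul_const Complex.I).cexp).congr_deriv (by
    rw [fourierKer]; push_cast; ring)

theorem contDiff_fourierKer (ξ : ℝ) : ContDiff ℝ (⊤ : ℕ∞) (fourierKer ξ) := by
  have h : ContDiff ℝ (⊤ : ℕ∞) (fun y : ℝ => ((-2 * Real.pi * ξ * y : ℝ) : ℂ)) :=
    Complex.ofRealCLM.contDiff.comp (contDiff_const.mul contDiff_id)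
  exact (h.mul contDiff_const).cexp

section cutoff
variable {K δ : ℝ} {χ : ℝ → ℝ} (hχ : IsCutoff K δ χ)
include hχ

theorem IsCutoff.abs_le_one (y : ℝ) : |χ y| ≤ 1 := abs_le.mpr ⟨by linarith [hχ.nonneg y], hχ.le_one y⟩

theorem IsCutoff.measurable : Measurable χ := hχ.contDiff.continuous.measurable

theorem IsCutoff.measurable_deriv : Measurable (deriv χ) :=
  (hχ.contDiff.continuous_deriv (by simp)).measurable

theorem IsCutoff.memLp_mul {g : ℝ → ℂ} (hg : MemLp g 2 volI) :
    MemLp (fun y => (χ y : ℂ) * g y) 2 volI := memLp_ofReal_mul hχ.measurable hχ.abs_le_one hg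

theorem IsCutoff.memLp_deriv_mul {g : ℝ → ℂ} (hg : MemLp g 2 volI) :
    MemLp (fun y => ((deriv χ y : ℝ) : ℂ) * g y) 2 volI :=
  memLp_ofReal_mul hχ.measurable_deriv hχ.deriv_le hg

theorem IsCutoff.l2q_mul {τ : ℝ} {F : ℝ → ℝ → ℂ} (hF : L2Q τ F) :
    L2Q τ (fun t y => (χ y : ℂ) * F t y) :=
  hF.mul_space (B := 1) (Complex.measurable_ofReal.comp hχ.measurable) fun y _ => by
    rw [Complex.norm_real]; exact hχ.abs_le_one y

theorem IsCutoff.l2q_deriv_mul {τ : ℝ} {F : ℝ → ℝ → ℂ} (hF : L2Q τ F) :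
    L2Q τ (fun t y => ((deriv χ y : ℝ) : ℂ) * F t y) :=
  hF.mul_space (B := K / δ) (Complex.measurable_ofReal.comp hχ.measurable_deriv) fun y _ => by
    rw [Complex.norm_real]; exact hχ.deriv_le y

theorem IsCutoff.at_ends : χ (-1) = 0 ∧ χ 1 = 0 :=
  ⟨image_eq_zero_of_notMem_tsupport fun h => (hχ.supp h).1.false,
    image_eq_zero_of_notMem_tsupport fun h => (hχ.supp h).2.false⟩

/-- The derivative of a localised plane wave. -/
theorem IsCutoff.deriv_mul_fourierKer (ξ y : ℝ) :
    deriv (fun y => (χ y : ℂ) * fourierKer ξ y) y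
      = ((deriv χ y : ℝ) : ℂ) * fourierKer ξ y
        + (-2 * Real.pi * Complex.I * ξ) * ((χ y : ℂ) * fourierKer ξ y) := by
  have h1 : HasDerivAt (fun y => (χ y : ℂ)) ((deriv χ y : ℝ) : ℂ) y :=
    ((hχ.contDiff.differentiable (by simp)) y).hasDerivAt.ofReal_comp
  refine (h1.mul (hasDerivAt_fourierKer ξ y)).deriv.trans ?_
  ring

theorem IsCutoff.contDiff_mul_fourierKer (ξ : ℝ) :
    ContDiff ℝ (⊤ : ℕ∞) (fun y => (χ y : ℂ) * fourierKer ξ y) :=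
  (Complex.ofRealCLM.contDiff.comp hχ.contDiff).mul (contDiff_fourierKer ξ)

/-- The Fourier transform of the derivative `χ'u + χu'` of a localised `H¹` function. -/
theorem IsCutoff.coef_deriv {u p : ℝ → ℂ} (h : IsH10 u p) (ξ : ℝ) :
    coef fourierKer (fun y => ((deriv χ y : ℝ) : ℂ) * u y + (χ y : ℂ) * p y) ξ
      = (2 * Real.pi * Complex.I * ξ) * coef fourierKer (fun y => (χ y : ℂ) * u y) ξ := by
  have hF := isParsevalFrame_fourierKer
  have key := h.integral_mul_deriv (g := fun y => (χ y : ℂ) * fourierKer ξ y)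
    ((hχ.contDiff_mul_fourierKer ξ).of_le (by exact_mod_cast le_top))
  simp only [hχ.deriv_mul_fourierKer] at key
  have i1 := hF.integrable (hχ.memLp_deriv_mul h.memLp) ξ
  have i2 := hF.integrable (hχ.memLp_mul h.memLp) ξ
  rw [hF.coef_add (hχ.memLp_deriv_mul h.memLp) (hχ.memLp_mul h.memLp_deriv)]
  have e1 : ∫ y, u y * (((deriv χ y : ℝ) : ℂ) * fourierKer ξ y
      + (-2 * Real.pi * Complex.I * ξ) * ((χ y : ℂ) * fourierKer ξ y)) ∂volI
      = coef fourierKer (fun y => ((deriv χ y : ℝ) : ℂ) * u y) ξ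
        + (-2 * Real.pi * Complex.I * ξ) * coef fourierKer (fun y => (χ y : ℂ) * u y) ξ := by
    rw [coef, coef, ← integral_const_mul, ← integral_add i1 (i2.const_mul _)]
    congr 1; ext y; ring
  have e2 : ∫ y, p y * ((χ y : ℂ) * fourierKer ξ y) ∂volI
      = coef fourierKer (fun y => (χ y : ℂ) * p y) ξ := by
    rw [coef]; congr 1; ext y; ring
  rw [e1, e2] at key
  linear_combination key

/-- The Fourier coefficients of the localised solution `χv` solve scalar equations in time. -/
theorem IsEvolution.coef_localised {τ : ℝ} {v₀ : ℝ → ℂ} {v p G₀ G₁ : ℝ → ℝ → ℂ}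
    (h : IsEvolution τ v₀ v p G₀ G₁) (ξ : ℝ) :
    ∀ᵐ t ∂muT τ, coef fourierKer (fun y => (χ y : ℂ) * v t y) ξ
      = coef fourierKer (fun y => (χ y : ℂ) * v₀ y) ξ
      + ∫ s in (0 : ℝ)..t,
        (coef fourierKer (fun y => (χ y : ℂ) * G₀ s y + ((deriv χ y : ℝ) : ℂ) * G₁ s y) ξ
        + (-2 * Real.pi * Complex.I * ξ) * coef fourierKer (fun y => (χ y : ℂ) * G₁ s y) ξ) := by
  have hF := isParsevalFrame_fourierKer
  filter_upwards [h.eq (fun y => (χ y : ℂ) * fourierKer ξ y) (hχ.contDiff_mul_fourierKer ξ)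
    (by simp [hχ.at_ends.1]) (by simp [hχ.at_ends.2]), ae_muT_mem τ] with t ht htτ
  have e : ∀ g : ℝ → ℂ, coef fourierKer (fun y => (χ y : ℂ) * g y) ξ
      = ∫ y, g y * ((χ y : ℂ) * fourierKer ξ y) ∂volI := fun g => by
    rw [coef]; congr 1; ext y; ring
  rw [e, ht, e]
  congr 1
  rw [intervalIntegral_eq_muT htτ.1.le, intervalIntegral_eq_muT htτ.1.le]
  apply integral_congr_ae
  filter_upwards [ae_mono (muT_mono htτ.2.le) h.G₀_mem.slice,
    ae_mono (muT_mono htτ.2.le) h.G₁_mem.slice] with s h0 h1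
  rw [coef, coef, ← integral_const_mul, ← integral_add]
  · congr 1; ext y
    rw [hχ.deriv_mul_fourierKer]; ring
  · exact hF.integrable ((hχ.memLp_mul h0).add (hχ.memLp_deriv_mul h1)) ξ
  · exact (hF.integrable (hχ.memLp_mul h1) ξ).const_mul _

/-- The energy identity for `∫ m |F(χv)|²` with a bounded Fourier multiplier `m`. -/
theorem IsEvolution.multiplier_energy {τ : ℝ} {v₀ : ℝ → ℂ} {v p G₀ G₁ : ℝ → ℝ → ℂ}
    (h : IsEvolution τ v₀ v p G₀ G₁) (hv₀ : Measurable v₀) {m : ℝ → ℝ} (hm : Measurable m)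
    (hm1 : ∀ ξ, |m ξ| ≤ 1) :
    Integrable (fun s => 2 * ∫ ξ, m ξ *
      ((starRingEnd ℂ) (coef fourierKer (fun y => (χ y : ℂ) * v s y) ξ)
        * coef fourierKer (fun y => (χ y : ℂ) * G₀ s y + ((deriv χ y : ℝ) : ℂ) * G₁ s y) ξ
      + (starRingEnd ℂ)
          (coef fourierKer (fun y => ((deriv χ y : ℝ) : ℂ) * v s y + (χ y : ℂ) * p s y) ξ)
        * coef fourierKer (fun y => (χ y : ℂ) * G₁ s y) ξ).re) (muT τ) ∧
    ∀ᵐ t ∂muT τ, ∫ ξ, m ξ * ‖coef fourierKer (fun y => (χ y : ℂ) * v t y) ξ‖ ^ 2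
      = (∫ ξ, m ξ * ‖coef fourierKer (fun y => (χ y : ℂ) * v₀ y) ξ‖ ^ 2)
      + ∫ s in (0 : ℝ)..t, 2 * ∫ ξ, m ξ *
      ((starRingEnd ℂ) (coef fourierKer (fun y => (χ y : ℂ) * v s y) ξ)
        * coef fourierKer (fun y => (χ y : ℂ) * G₀ s y + ((deriv χ y : ℝ) : ℂ) * G₁ s y) ξ
      + (starRingEnd ℂ)
          (coef fourierKer (fun y => ((deriv χ y : ℝ) : ℂ) * v s y + (χ y : ℂ) * p s y) ξ)
        * coef fourierKer (fun y => (χ y : ℂ) * G₁ s y) ξ).re := by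
  have hF := isParsevalFrame_fourierKer
  set f : ℝ → ℝ → ℂ := fun s y => (χ y : ℂ) * v s y with hf
  set f' : ℝ → ℝ → ℂ := fun s y => ((deriv χ y : ℝ) : ℂ) * v s y + (χ y : ℂ) * p s y with hf'
  set A : ℝ → ℝ → ℂ := fun s y => (χ y : ℂ) * G₀ s y + ((deriv χ y : ℝ) : ℂ) * G₁ s y with hA
  set B : ℝ → ℝ → ℂ := fun s y => (χ y : ℂ) * G₁ s y with hB
  have Lf : L2Q τ f := hχ.l2q_mul h.v_mem
  have Lf' : L2Q τ f' := (hχ.l2q_deriv_mul h.v_mem).add (hχ.l2q_mul h.p_mem)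
  have LA : L2Q τ A := (hχ.l2q_mul h.G₀_mem).add (hχ.l2q_deriv_mul h.G₁_mem)
  have LB : L2Q τ B := hχ.l2q_mul h.G₁_mem
  have key : ∀ s ξ, IsH10 (v s) (p s) →
      (starRingEnd ℂ) (coef fourierKer (f s) ξ)
        * (coef fourierKer (A s) ξ + (-2 * Real.pi * Complex.I * ξ) * coef fourierKer (B s) ξ)
      = (starRingEnd ℂ) (coef fourierKer (f s) ξ) * coef fourierKer (A s) ξ
        + (starRingEnd ℂ) (coef fourierKer (f' s) ξ) * coef fourierKer (B s) ξ := by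
    intro s ξ hs
    rw [hf', hχ.coef_deriv hs]
    simp only [map_mul, Complex.conj_ofReal, Complex.conj_I, map_ofNat]
    ring
  have hprod : Integrable (fun q : ℝ × ℝ =>
      (starRingEnd ℂ) (coef fourierKer (f q.1) q.2) * coef fourierKer (A q.1) q.2
        + (starRingEnd ℂ) (coef fourierKer (f' q.1) q.2) * coef fourierKer (B q.1) q.2)
      ((muT τ).prod volume) :=
    (integrable_conj_mul (Lf.memLp_coef hF) (LA.memLp_coef hF)).add
      (integrable_conj_mul (Lf'.memLp_coef hF) (LB.memLp_coef hF))
  have hprodm : Integrable (fun q : ℝ × ℝ => m q.2 *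
      ((starRingEnd ℂ) (coef fourierKer (f q.1) q.2) * coef fourierKer (A q.1) q.2
        + (starRingEnd ℂ) (coef fourierKer (f' q.1) q.2) * coef fourierKer (B q.1) q.2).re)
      ((muT τ).prod volume) :=
    hprod.re.bdd_mul (c := 1) (hm.comp measurable_snd).aestronglyMeasurable
      (Filter.Eventually.of_forall fun q => hm1 q.2)
  have hae : ∀ᵐ q ∂(muT τ).prod (volume : Measure ℝ), IsH10 (v q.1) (p q.1) :=
    Measure.quasiMeasurePreserving_fst.ae h.isH10
  refine ⟨hprodm.integral_prod_left.const_mul 2, ?_⟩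
  have hE := energy_identity (μ := (volume : Measure ℝ)) (τ := τ) (m := m)
    (u := fun t ξ => coef fourierKer (f t) ξ)
    (h := fun s ξ => coef fourierKer (A s) ξ
      + (-2 * Real.pi * Complex.I * ξ) * coef fourierKer (B s) ξ)
    (u₀ := coef fourierKer (fun y => (χ y : ℂ) * v₀ y)) (Lf.measurable_coef hF)
    ((LA.measurable_coef hF).add (Measurable.mul (by fun_prop) (LB.measurable_coef hF)))
    (measurable_coef_of_memLp ((Complex.measurable_ofReal.comp hχ.measurable).mul hv₀) hF)
    (fun ξ => (integrable_muT_coef LA hF ξ).add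
      ((integrable_muT_coef LB hF ξ).const_mul _))
    (fun ξ => h.coef_localised hχ ξ) ?_ ?_
  · filter_upwards [hE, ae_muT_mem τ] with t ht htτ
    rw [ht]
    congr 1
    rw [intervalIntegral_eq_muT htτ.1.le, intervalIntegral_eq_muT htτ.1.le]
    apply integral_congr_ae
    filter_upwards [ae_mono (muT_mono htτ.2.le) h.isH10] with s h1
    simp only [key s _ h1]
    rfl
  · refine hprodm.congr ?_
    filter_upwards [hae] with q hq
    rw [key _ _ hq]
  · exact (integrable_normSq (hF.memLp _ (hχ.memLp_mul h.v₀_mem))).bdd_mul (c := 1)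
      hm.aestronglyMeasurable (Filter.Eventually.of_forall hm1)

end cutoff

/-! ### Rates of change at a fixed time -/

theorem memLp_add {f h : ℝ → ℂ} (hf : MemLp f 2 volI) (hh : MemLp h 2 volI) :
    MemLp (fun y => f y + h y) 2 volI := hf.add hh

theorem abs_re_inner_le {f h : ℝ → ℂ} (hf : MemLp f 2 volI) (hh : MemLp h 2 volI) {ε : ℝ}
    (hε : 0 < ε) :
    |(∫ y, (starRingEnd ℂ) (f y) * h y ∂volI).re| ≤ (ε * nsq f + ε⁻¹ * nsq h) / 2 := by
  have h1 := norm_integral_mul_le (memLp_conj hf) hh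
  have h2 : (∫ y, ‖(starRingEnd ℂ) (f y)‖ ^ 2 ∂volI) = nsq f := by simp [nsq]
  rw [h2] at h1
  refine ((Complex.abs_re_le_norm _).trans h1).trans ?_
  change √(nsq f) * √(nsq h) ≤ _
  set a := √(nsq f)
  set b := √(nsq h)
  have ha : nsq f = a ^ 2 := (Real.sq_sqrt (nsq_nonneg f)).symm
  have hb : nsq h = b ^ 2 := (Real.sq_sqrt (nsq_nonneg h)).symm
  rw [ha, hb]
  have : 0 ≤ ε⁻¹ * (ε * a - b) ^ 2 := by positivity
  have e : ε⁻¹ * (ε * a - b) ^ 2 = ε * a ^ 2 + ε⁻¹ * b ^ 2 - 2 * (a * b) := by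
    field_simp; ring
  linarith

/-- The quadratic form `∫ m Re(conj(Ff) Fh)` of the Fourier multiplier `m`. -/
def mForm (m : ℝ → ℝ) (f h : ℝ → ℂ) : ℝ :=
  ∫ ξ, m ξ * ((starRingEnd ℂ) (coef fourierKer f ξ) * coef fourierKer h ξ).re

section mForm
variable {m : ℝ → ℝ} (hm : Measurable m) (hm1 : ∀ ξ, |m ξ| ≤ 1)
include hm hm1

theorem mForm_integrable {f h : ℝ → ℂ} (hf : MemLp f 2 volI) (hh : MemLp h 2 volI) :
    Integrable (fun ξ => m ξ *
      ((starRingEnd ℂ) (coef fourierKer f ξ) * coef fourierKer h ξ).re) volume :=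
  ((integrable_conj_mul (isParsevalFrame_fourierKer.memLp _ hf)
    (isParsevalFrame_fourierKer.memLp _ hh)).re).bdd_mul (c := 1) hm.aestronglyMeasurable
    (Filter.Eventually.of_forall hm1)

theorem mForm_add {f h₁ h₂ : ℝ → ℂ} (hf : MemLp f 2 volI) (hh₁ : MemLp h₁ 2 volI)
    (hh₂ : MemLp h₂ 2 volI) :
    mForm m f (fun y => h₁ y + h₂ y) = mForm m f h₁ + mForm m f h₂ := by
  rw [mForm, mForm, mForm, ← integral_add (mForm_integrable hm hm1 hf hh₁)
    (mForm_integrable hm hm1 hf hh₂)]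
  congr 1; ext ξ
  rw [isParsevalFrame_fourierKer.coef_add hh₁ hh₂, mul_add, Complex.add_re]
  ring

omit hm hm1 in
theorem mForm_real_mul (f h : ℝ → ℂ) (c : ℝ) :
    mForm m f (fun y => (c : ℂ) * h y) = c * mForm m f h := by
  rw [mForm, mForm, ← integral_const_mul]
  congr 1; ext ξ
  rw [coef_const_mul, mul_left_comm, Complex.re_ofReal_mul]
  ring

omit hm in
/-- Weighted Young inequality for a multiplier form. -/
theorem abs_mForm_le_weight {f h : ℝ → ℂ} {w : ℝ → ℝ} (hw : ∀ ξ, 0 < w ξ)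
    (hf : Integrable (fun ξ => w ξ * ‖coef fourierKer f ξ‖ ^ 2))
    (hh : Integrable (fun ξ => (w ξ)⁻¹ * ‖coef fourierKer h ξ‖ ^ 2)) {ε : ℝ} (hε : 0 < ε) :
    |mForm m f h| ≤ (ε * (∫ ξ, w ξ * ‖coef fourierKer f ξ‖ ^ 2)
      + ε⁻¹ * ∫ ξ, (w ξ)⁻¹ * ‖coef fourierKer h ξ‖ ^ 2) / 2 := by
  rw [← integral_const_mul, ← integral_const_mul, ← integral_add (hf.const_mul _)
    (hh.const_mul _), ← integral_div]
  refine (abs_integral_le_integral_abs).trans ?_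
  refine integral_mono_of_nonneg (Filter.Eventually.of_forall fun ξ => abs_nonneg _)
    (((hf.const_mul _).add (hh.const_mul _)).div_const 2)
    (Filter.Eventually.of_forall fun ξ => ?_)
  simp only
  set a := ‖coef fourierKer f ξ‖ with ha
  set b := ‖coef fourierKer h ξ‖ with hb
  have h1 : |m ξ * ((starRingEnd ℂ) (coef fourierKer f ξ) * coef fourierKer h ξ).re|
      ≤ 1 * (a * b) := by
    rw [abs_mul]
    refine mul_le_mul (hm1 ξ) ((Complex.abs_re_le_norm _).trans ?_) (abs_nonneg _) zero_le_one
    rw [norm_mul, Complex.norm_conj]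
  refine h1.trans ?_
  have hp : 0 < ε * w ξ := mul_pos hε (hw ξ)
  have : 0 ≤ (ε * w ξ)⁻¹ * (ε * w ξ * a - b) ^ 2 := by positivity
  have hwξ := (hw ξ).ne'
  have e : (ε * w ξ)⁻¹ * (ε * w ξ * a - b) ^ 2
      = ε * (w ξ * a ^ 2) + ε⁻¹ * ((w ξ)⁻¹ * b ^ 2) - 2 * (a * b) := by
    field_simp
    ring
  linarith

omit hm in
theorem abs_mForm_le {f h : ℝ → ℂ} (hf : MemLp f 2 volI) (hh : MemLp h 2 volI) {ε : ℝ}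
    (hε : 0 < ε) : |mForm m f h| ≤ (ε * nsq f + ε⁻¹ * nsq h) / 2 := by
  have hF := isParsevalFrame_fourierKer
  have h1 := abs_mForm_le_weight (f := f) (h := h) (w := fun _ => 1) hm1 (fun _ => one_pos)
    (by simpa using integrable_normSq (hF.memLp _ hf))
    (by simpa using integrable_normSq (hF.memLp _ hh)) hε
  simpa only [one_mul, inv_one, hF.parseval _ hf, hF.parseval _ hh] using h1

end mForm

/-- The part of the energy rate that does not involve the data is `-2ν‖v'‖² - 2a‖v‖²`; transport
contributes nothing since it is skew-adjoint. -/
theorem energy_rate_eq {ν a k : ℝ} {v p g f₂ f₄ : ℝ → ℂ} (hv : MemLp v 2 volI)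
    (hp : MemLp p 2 volI) (hg : MemLp g 2 volI) (hf₂ : MemLp f₂ 2 volI) (hf₄ : MemLp f₄ 2 volI) :
    2 * ((∫ y, (starRingEnd ℂ) (v y) *
        (-Complex.I * g y - f₄ y - ((a : ℂ) + Complex.I * k * y) * v y) ∂volI)
      + ∫ y, (starRingEnd ℂ) (p y) * (f₂ y - ν * p y) ∂volI).re
    = -2 * ν * nsq p - 2 * a * nsq v
      + 2 * (∫ y, (starRingEnd ℂ) (v y) * (-Complex.I * g y) ∂volI).re
      - 2 * (∫ y, (starRingEnd ℂ) (v y) * f₄ y ∂volI).re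
      + 2 * (∫ y, (starRingEnd ℂ) (p y) * f₂ y ∂volI).re := by
  have hw : MemLp (fun y : ℝ => ((a : ℂ) + Complex.I * k * y) * v y) 2 volI := by
    refine hv.of_le_mul (c := |a| + |k|) ?_ ?_
    · exact (Measurable.aestronglyMeasurable (by fun_prop)).mul hv.1
    · filter_upwards [ae_volI_mem] with y hy
      rw [norm_mul]
      gcongr
      refine (norm_add_le _ _).trans ?_
      simp only [norm_mul, Complex.norm_I, one_mul, Complex.norm_real, Real.norm_eq_abs]
      have : |y| ≤ 1 := abs_le.mpr ⟨hy.1.le, hy.2.le⟩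
      nlinarith [abs_nonneg k]
  have i1 := integrable_conj_mul hv (hg.const_mul (-Complex.I))
  have i2 := integrable_conj_mul hv hf₄
  have i3 := integrable_conj_mul hv hw
  have i4 := integrable_conj_mul hp hf₂
  have i5 := integrable_conj_mul hp (hp.const_mul (ν : ℂ))
  have e1 : ∫ y, (starRingEnd ℂ) (v y) *
        (-Complex.I * g y - f₄ y - ((a : ℂ) + Complex.I * k * y) * v y) ∂volI
      = (∫ y, (starRingEnd ℂ) (v y) * (-Complex.I * g y) ∂volI)
        - (∫ y, (starRingEnd ℂ) (v y) * f₄ y ∂volI)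
        - ∫ y, (starRingEnd ℂ) (v y) * (((a : ℂ) + Complex.I * k * y) * v y) ∂volI := by
    have i12 : Integrable (fun y => (starRingEnd ℂ) (v y) * (-Complex.I * g y)
        - (starRingEnd ℂ) (v y) * f₄ y) volI := i1.sub i2
    rw [← integral_sub i1 i2, ← integral_sub i12 i3]
    congr 1; ext y; ring
  have e2 : ∫ y, (starRingEnd ℂ) (p y) * (f₂ y - ν * p y) ∂volI
      = (∫ y, (starRingEnd ℂ) (p y) * f₂ y ∂volI)
        - ∫ y, (starRingEnd ℂ) (p y) * (ν * p y) ∂volI := by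
    rw [← integral_sub i4 i5]
    congr 1; ext y; ring
  have r1 : (∫ y, (starRingEnd ℂ) (v y) * (((a : ℂ) + Complex.I * k * y) * v y) ∂volI).re
      = a * nsq v := by
    have := Complex.reCLM.integral_comp_comm i3
    simp only [Complex.reCLM_apply] at this
    rw [← this, nsq, ← integral_const_mul]
    congr 1; ext y
    rw [Complex.sq_norm, Complex.normSq_apply]
    simp
    ring
  have r2 : (∫ y, (starRingEnd ℂ) (p y) * (ν * p y) ∂volI).re = ν * nsq p := by
    have := Complex.reCLM.integral_comp_comm i5
    simp only [Complex.reCLM_apply] at this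
    rw [← this, nsq, ← integral_const_mul]
    congr 1; ext y
    rw [Complex.sq_norm, Complex.normSq_apply]
    simp
    ring
  rw [e1, e2]
  simp only [Complex.add_re, Complex.sub_re, r1, r2]
  ring

/-- Transport by the shear differentiates the Fourier transform, hence its contribution to the rate
of a multiplier energy is `-(k/2π) ∫ m' |Ff|²`. -/
theorem mForm_transport {m m' : ℝ → ℝ} (hd : ∀ ξ, HasDerivAt m (m' ξ) ξ) (hm1 : ∀ ξ, |m ξ| ≤ 1)
    {B : ℝ} (hm'm : Measurable m') (hm' : ∀ ξ, |m' ξ| ≤ B) {f : ℝ → ℂ} (hf : MemLp f 2 volI)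
    (k : ℝ) :
    2 * mForm m f (fun y => -(Complex.I * k * y * f y))
      = -(k / (2 * Real.pi)) * ∫ ξ, m' ξ * ‖coef fourierKer f ξ‖ ^ 2 := by
  have hF := isParsevalFrame_fourierKer
  have hm : Measurable m := (continuous_iff_continuousAt.mpr fun ξ => (hd ξ).continuousAt).measurable
  have hyf : MemLp (fun y : ℝ => (-2 * Real.pi * Complex.I * y) * f y) 2 volI := by
    refine hf.of_le_mul (c := 2 * Real.pi) ?_ ?_
    · exact (Measurable.aestronglyMeasurable (by fun_prop)).mul hf.1
    · filter_upwards [ae_volI_mem] with y hy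
      have : |y| ≤ 1 := abs_le.mpr ⟨hy.1.le, hy.2.le⟩
      simp only [norm_mul, norm_neg, Complex.norm_I, Complex.norm_real, Real.norm_eq_abs,
        Complex.norm_ofNat, abs_of_pos Real.pi_pos, mul_one]
      refine mul_le_mul_of_nonneg_right ?_ (norm_nonneg _)
      nlinarith [Real.pi_pos]
  set D := coef fourierKer (fun y : ℝ => (-2 * Real.pi * Complex.I * y) * f y) with hD
  have hder : ∀ ξ, HasDerivAt (fun ξ => ‖coef fourierKer f ξ‖ ^ 2)
      (2 * ((starRingEnd ℂ) (coef fourierKer f ξ) * D ξ).re) ξ := by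
    intro ξ
    have h1 := (hasDerivAt_coef_fourierKer hf ξ).norm_sq
    refine h1.congr_deriv ?_
    rw [Complex.inner]
    simp only [Complex.mul_re, Complex.conj_re, Complex.conj_im, hD]
    ring
  have i1 : Integrable (fun ξ => m ξ * (2 * ((starRingEnd ℂ) (coef fourierKer f ξ) * D ξ).re)) := by
    refine ((mForm_integrable hm hm1 hf hyf).const_mul 2).congr
      (Filter.Eventually.of_forall fun ξ => ?_)
    simp only [hD]; ring
  have hsq := integrable_normSq (hF.memLp _ hf)
  have ibp := integral_mul_deriv_eq_deriv_mul_of_integrable (u := m) (u' := m')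
    (v := fun ξ => ‖coef fourierKer f ξ‖ ^ 2)
    (fun ξ _ => hd ξ) (fun ξ _ => hder ξ) i1
    (hsq.bdd_mul (c := B) hm'm.aestronglyMeasurable (Filter.Eventually.of_forall hm'))
    (hsq.bdd_mul (c := 1) hm.aestronglyMeasurable (Filter.Eventually.of_forall hm1))
  have e : ∀ y : ℝ, -(Complex.I * k * y * f y)
      = ((k / (2 * Real.pi) : ℝ) : ℂ) * ((-2 * Real.pi * Complex.I * y) * f y) := by
    intro y
    have hpi : (Real.pi : ℂ) ≠ 0 := by exact_mod_cast Real.pi_ne_zero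
    push_cast
    field_simp
  have e2 : 2 * mForm m f (fun y : ℝ => (-2 * Real.pi * Complex.I * y) * f y)
      = -∫ ξ, m' ξ * ‖coef fourierKer f ξ‖ ^ 2 := by
    rw [← ibp, mForm, ← integral_const_mul]
    congr 1; ext ξ; ring
  rw [funext e, mForm_real_mul]
  linear_combination (k / (2 * Real.pi)) * e2

/-- The rate of a multiplier energy, split into transport, damping and data. -/
theorem multiplier_rate_eq {K δ : ℝ} {χ : ℝ → ℝ} (hχ : IsCutoff K δ χ) {m m' : ℝ → ℝ}
    (hd : ∀ ξ, HasDerivAt m (m' ξ) ξ) (hm1 : ∀ ξ, |m ξ| ≤ 1) {B : ℝ} (hm'm : Measurable m')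
    (hm' : ∀ ξ, |m' ξ| ≤ B) {a k : ℝ} {v p g f₄ G₁ : ℝ → ℂ} (hv : MemLp v 2 volI)
    (hp : MemLp p 2 volI) (hg : MemLp g 2 volI) (hf₄ : MemLp f₄ 2 volI) (hG₁ : MemLp G₁ 2 volI) :
    2 * ∫ ξ, m ξ *
      ((starRingEnd ℂ) (coef fourierKer (fun y => (χ y : ℂ) * v y) ξ)
        * coef fourierKer (fun y => (χ y : ℂ) *
          (-Complex.I * g y - f₄ y - ((a : ℂ) + Complex.I * k * y) * v y)
          + ((deriv χ y : ℝ) : ℂ) * G₁ y) ξ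
      + (starRingEnd ℂ)
          (coef fourierKer (fun y => ((deriv χ y : ℝ) : ℂ) * v y + (χ y : ℂ) * p y) ξ)
        * coef fourierKer (fun y => (χ y : ℂ) * G₁ y) ξ).re
    = -(k / (2 * Real.pi)) * (∫ ξ, m' ξ * ‖coef fourierKer (fun y => (χ y : ℂ) * v y) ξ‖ ^ 2)
      + 2 * mForm m (fun y => (χ y : ℂ) * v y) (fun y => (χ y : ℂ) * (-Complex.I * g y))
      - 2 * mForm m (fun y => (χ y : ℂ) * v y) (fun y => (χ y : ℂ) * f₄ y)
      - 2 * a * mForm m (fun y => (χ y : ℂ) * v y) (fun y => (χ y : ℂ) * v y)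
      + 2 * mForm m (fun y => (χ y : ℂ) * v y) (fun y => ((deriv χ y : ℝ) : ℂ) * G₁ y)
      + 2 * mForm m (fun y => ((deriv χ y : ℝ) : ℂ) * v y + (χ y : ℂ) * p y)
          (fun y => (χ y : ℂ) * G₁ y) := by
  have hm : Measurable m := (continuous_iff_continuousAt.mpr fun ξ => (hd ξ).continuousAt).measurable
  have Lf := hχ.memLp_mul hv
  have Lg := hχ.memLp_mul (hg.const_mul (-Complex.I))
  have L4 := hχ.memLp_mul hf₄
  have LG := hχ.memLp_mul hG₁
  have LG' := hχ.memLp_deriv_mul hG₁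
  have Lf' := memLp_add (hχ.memLp_deriv_mul hv) (hχ.memLp_mul hp)
  have Ly : MemLp (fun y : ℝ => -(Complex.I * k * y * ((χ y : ℂ) * v y))) 2 volI := by
    refine Lf.of_le_mul (c := |k|) ?_ ?_
    · exact ((Measurable.aestronglyMeasurable (by fun_prop)).mul Lf.1).neg
    · filter_upwards [ae_volI_mem] with y hy
      have : |y| ≤ 1 := abs_le.mpr ⟨hy.1.le, hy.2.le⟩
      rw [norm_neg, norm_mul, norm_mul, norm_mul, Complex.norm_I, one_mul, Complex.norm_real,
        Complex.norm_real, Real.norm_eq_abs, Real.norm_eq_abs]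
      gcongr
      nlinarith [abs_nonneg k]
  have hA : (fun y : ℝ => (χ y : ℂ) *
          (-Complex.I * g y - f₄ y - ((a : ℂ) + Complex.I * k * y) * v y)
          + ((deriv χ y : ℝ) : ℂ) * G₁ y)
      = fun y : ℝ => -(Complex.I * k * y * ((χ y : ℂ) * v y))
        + ((χ y : ℂ) * (-Complex.I * g y) + (((-1 : ℝ) : ℂ) * ((χ y : ℂ) * f₄ y)
        + (((-a : ℝ) : ℂ) * ((χ y : ℂ) * v y) + ((deriv χ y : ℝ) : ℂ) * G₁ y))) := by
    ext y; push_cast; ring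
  have M3 := memLp_add (Lf.const_mul ((-a : ℝ) : ℂ)) LG'
  have M2 := memLp_add (L4.const_mul ((-1 : ℝ) : ℂ)) M3
  have M1 := memLp_add Lg M2
  have M0 := memLp_add Ly M1
  have split : ∀ {f h f' h' : ℝ → ℂ}, MemLp f 2 volI → MemLp h 2 volI → MemLp f' 2 volI →
      MemLp h' 2 volI → ∫ ξ, m ξ * ((starRingEnd ℂ) (coef fourierKer f ξ) * coef fourierKer h ξ
        + (starRingEnd ℂ) (coef fourierKer f' ξ) * coef fourierKer h' ξ).re
        = mForm m f h + mForm m f' h' := by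
    intro f h f' h' q1 q2 q3 q4
    rw [mForm, mForm, ← integral_add (mForm_integrable hm hm1 q1 q2) (mForm_integrable hm hm1 q3 q4)]
    congr 1; ext ξ; rw [Complex.add_re]; ring
  rw [hA, split Lf M0 Lf' LG, mForm_add hm hm1 Lf Ly M1, mul_add, mul_add,
    mForm_transport hd hm1 hm'm hm' Lf k, mForm_add hm hm1 Lf Lg M2,
    mForm_add hm hm1 Lf (L4.const_mul ((-1 : ℝ) : ℂ)) M3,
    mForm_add hm hm1 Lf (Lf.const_mul ((-a : ℝ) : ℂ)) LG', mForm_real_mul, mForm_real_mul]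
  ring

/-! ### The arctangent multiplier -/

/-- The Poisson-type weight `l / (l² + (2πξ)²)`, the symbol of `l (l² - ∂_y²)⁻¹`. -/
def lor (l ξ : ℝ) : ℝ := l / (l ^ 2 + (2 * Real.pi * ξ) ^ 2)

theorem lor_pos {l : ℝ} (hl : 0 < l) (ξ : ℝ) : 0 < lor l ξ := by unfold lor; positivity

theorem continuous_lor {l : ℝ} (hl : 0 < l) : Continuous (lor l) := by
  unfold lor
  exact continuous_const.div (by fun_prop) fun ξ => by positivity

theorem abs_lor_le {l : ℝ} (hl : 0 < l) (ξ : ℝ) : |lor l ξ| ≤ l⁻¹ := by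
  rw [abs_of_pos (lor_pos hl ξ), lor, div_le_iff₀ (by positivity), pow_two l, mul_add,
    inv_mul_cancel_left₀ hl.ne']
  have : 0 ≤ l⁻¹ * (2 * Real.pi * ξ) ^ 2 := by positivity
  linarith

/-- The multiplier `±(arctan(2πξ/η) + arctan(2πξ/l))/π`: a bounded monotone function whose
derivative detects negative Sobolev norms at the two length scales `1/η` and `1/l`. -/
def arctanMult (σ η l ξ : ℝ) : ℝ :=
  σ * (Real.pi⁻¹ * (Real.arctan (2 * Real.pi * ξ / η) + Real.arctan (2 * Real.pi * ξ / l)))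

theorem hasDerivAt_arctan_div {l : ℝ} (hl : 0 < l) (ξ : ℝ) :
    HasDerivAt (fun ξ => Real.arctan (2 * Real.pi * ξ / l)) (2 * Real.pi * lor l ξ) ξ := by
  have h1 : HasDerivAt (fun ξ : ℝ => 2 * Real.pi * ξ / l) (2 * Real.pi / l) ξ := by
    simpa using ((hasDerivAt_id' ξ).const_mul (2 * Real.pi)).div_const l
  refine h1.arctan.congr_deriv ?_
  have : 0 < l ^ 2 + (2 * Real.pi * ξ) ^ 2 := by positivity
  have h2 : 0 < 1 + (2 * Real.pi * ξ / l) ^ 2 := by positivity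
  rw [lor]
  field_simp

theorem hasDerivAt_arctanMult (σ : ℝ) {η l : ℝ} (hη : 0 < η) (hl : 0 < l) (ξ : ℝ) :
    HasDerivAt (arctanMult σ η l) (σ * (2 * (lor η ξ + lor l ξ))) ξ := by
  refine ((((hasDerivAt_arctan_div hη ξ).add (hasDerivAt_arctan_div hl ξ)).const_mul
    Real.pi⁻¹).const_mul σ).congr_deriv ?_
  have := Real.pi_ne_zero
  field_simp

theorem abs_arctanMult_le {σ : ℝ} (hσ : |σ| = 1) (η l ξ : ℝ) : |arctanMult σ η l ξ| ≤ 1 := by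
  have hb : ∀ x, |Real.arctan x| ≤ Real.pi / 2 := fun x =>
    abs_le.mpr ⟨(Real.neg_pi_div_two_lt_arctan x).le, (Real.arctan_lt_pi_div_two x).le⟩
  rw [arctanMult, abs_mul, hσ, one_mul, abs_mul, abs_of_pos (inv_pos.mpr Real.pi_pos),
    inv_mul_le_iff₀ Real.pi_pos]
  have := abs_add_le (Real.arctan (2 * Real.pi * ξ / η)) (Real.arctan (2 * Real.pi * ξ / l))
  linarith [hb (2 * Real.pi * ξ / η), hb (2 * Real.pi * ξ / l)]

theorem continuous_arctanMult (σ η l : ℝ) : Continuous (arctanMult σ η l) := by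
  unfold arctanMult; fun_prop

/-- The quadratic form `∫ l/(l² + (2πξ)²) |Ff|²`, that is `l` times the squared `H⁻¹` norm at frequency `l`. -/
def lorForm (l : ℝ) (f : ℝ → ℂ) : ℝ := ∫ ξ, lor l ξ * ‖coef fourierKer f ξ‖ ^ 2

theorem integrable_lor {l : ℝ} (hl : 0 < l) {f : ℝ → ℂ} (hf : MemLp f 2 volI) :
    Integrable (fun ξ => lor l ξ * ‖coef fourierKer f ξ‖ ^ 2) :=
  (integrable_normSq (isParsevalFrame_fourierKer.memLp _ hf)).bdd_mul (c := l⁻¹)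
    (continuous_lor hl).aestronglyMeasurable (Filter.Eventually.of_forall (abs_lor_le hl))

section localised
variable {K δ : ℝ} {χ : ℝ → ℝ} (hχ : IsCutoff K δ χ) {u p : ℝ → ℂ} (hu : IsH10 u p)
include hχ hu

theorem IsCutoff.normSq_coef_deriv (ξ : ℝ) :
    ‖coef fourierKer (fun y => ((deriv χ y : ℝ) : ℂ) * u y + (χ y : ℂ) * p y) ξ‖ ^ 2
      = (2 * Real.pi * ξ) ^ 2 * ‖coef fourierKer (fun y => (χ y : ℂ) * u y) ξ‖ ^ 2 := by
  rw [hχ.coef_deriv hu, norm_mul, mul_pow]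
  congr 1
  simp only [norm_mul, Complex.norm_I, Complex.norm_real, Complex.norm_ofNat, mul_one,
    Real.norm_eq_abs, mul_pow, sq_abs]

/-- The dual weight gives the `H¹` norm at scale `1/l`. -/
theorem IsCutoff.inv_lor {l : ℝ} (hl : 0 < l) :
    Integrable (fun ξ => (lor l ξ)⁻¹ * ‖coef fourierKer (fun y => (χ y : ℂ) * u y) ξ‖ ^ 2) ∧
    ∫ ξ, (lor l ξ)⁻¹ * ‖coef fourierKer (fun y => (χ y : ℂ) * u y) ξ‖ ^ 2
      = l * nsq (fun y => (χ y : ℂ) * u y)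
        + l⁻¹ * nsq (fun y => ((deriv χ y : ℝ) : ℂ) * u y + (χ y : ℂ) * p y) := by
  have hF := isParsevalFrame_fourierKer
  have L1 := hχ.memLp_mul hu.memLp
  have L2 := memLp_add (hχ.memLp_deriv_mul hu.memLp) (hχ.memLp_mul hu.memLp_deriv)
  have i1 := (integrable_normSq (hF.memLp _ L1)).const_mul l
  have i2 := (integrable_normSq (hF.memLp _ L2)).const_mul l⁻¹
  have e : ∀ ξ, (lor l ξ)⁻¹ * ‖coef fourierKer (fun y => (χ y : ℂ) * u y) ξ‖ ^ 2
      = l * ‖coef fourierKer (fun y => (χ y : ℂ) * u y) ξ‖ ^ 2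
      + l⁻¹ * ‖coef fourierKer (fun y => ((deriv χ y : ℝ) : ℂ) * u y + (χ y : ℂ) * p y) ξ‖ ^ 2 := by
    intro ξ
    rw [hχ.normSq_coef_deriv hu, lor, inv_div]
    field_simp
  simp only [e]
  refine ⟨i1.add i2, ?_⟩
  rw [integral_add i1 i2, integral_const_mul, integral_const_mul, hF.parseval _ L1,
    hF.parseval _ L2, one_mul, one_mul]

/-- Interpolation between the `H⁻¹` form at scale `1/l` and the derivative. -/
theorem IsCutoff.nsq_le_lorForm {l : ℝ} (hl : 0 < l) :
    nsq (fun y => (χ y : ℂ) * u y) ≤ l * lorForm l (fun y => (χ y : ℂ) * u y)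
      + (l ^ 2)⁻¹ * nsq (fun y => ((deriv χ y : ℝ) : ℂ) * u y + (χ y : ℂ) * p y) := by
  have hF := isParsevalFrame_fourierKer
  have L1 := hχ.memLp_mul hu.memLp
  have L2 := memLp_add (hχ.memLp_deriv_mul hu.memLp) (hχ.memLp_mul hu.memLp_deriv)
  have p1 := hF.parseval _ L1
  have p2 := hF.parseval _ L2
  rw [one_mul] at p1 p2
  rw [← p1, ← p2, lorForm, ← integral_const_mul, ← integral_const_mul,
    ← integral_add ((integrable_lor hl L1).const_mul l)
      ((integrable_normSq (hF.memLp _ L2)).const_mul _)]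
  refine integral_mono (integrable_normSq (hF.memLp _ L1))
    (((integrable_lor hl L1).const_mul l).add
      ((integrable_normSq (hF.memLp _ L2)).const_mul _)) fun ξ => ?_
  simp only
  rw [hχ.normSq_coef_deriv hu, lor]
  set A := ‖coef fourierKer (fun y => (χ y : ℂ) * u y) ξ‖ ^ 2
  set x := (2 * Real.pi * ξ) ^ 2 with hx
  have hx0 : 0 ≤ x := by positivity
  have hA : 0 ≤ A := by positivity
  have h1 : 1 ≤ l * (l / (l ^ 2 + x)) + (l ^ 2)⁻¹ * x := by
    rw [← sub_nonneg]
    have : l * (l / (l ^ 2 + x)) + (l ^ 2)⁻¹ * x - 1 = x ^ 2 / (l ^ 2 * (l ^ 2 + x)) := by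
      field_simp
      ring
    rw [this]; positivity
  nlinarith

theorem IsCutoff.nsq_mul_le : nsq (fun y => (χ y : ℂ) * u y) ≤ nsq u := by
  have := integral_normSq_ofReal_mul_le hχ.abs_le_one hu.memLp
  simpa [nsq] using this

/-- Localisation costs only a constant in `H¹₀`, by Poincaré's inequality in the layers. -/
theorem IsCutoff.nsq_deriv_le (hK : 1 ≤ K) (hδ : 0 < δ) :
    nsq (fun y => ((deriv χ y : ℝ) : ℂ) * u y + (χ y : ℂ) * p y) ≤ 6 * K ^ 2 * nsq p := by
  have h1 := integral_normSq_add_le (hχ.memLp_deriv_mul hu.memLp) (hχ.memLp_mul hu.memLp_deriv)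
  have h2 := hu.nsq_layer_le hδ hχ.deriv_le hχ.deriv_zero
  have h3 := integral_normSq_ofReal_mul_le hχ.abs_le_one hu.memLp_deriv
  have e : 2 * (K / δ) ^ 2 * δ ^ 2 * nsq p = 2 * K ^ 2 * nsq p := by field_simp
  rw [e] at h2
  have h4 : nsq (fun y => ((deriv χ y : ℝ) : ℂ) * u y + (χ y : ℂ) * p y)
      ≤ 2 * nsq (fun y => ((deriv χ y : ℝ) : ℂ) * u y) + 2 * nsq (fun y => (χ y : ℂ) * p y) := h1
  have h5 : nsq (fun y => (χ y : ℂ) * p y) ≤ 1 ^ 2 * nsq p := h3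
  have h6 : 0 ≤ (K ^ 2 - 1) * nsq p := mul_nonneg (by nlinarith) (nsq_nonneg p)
  linarith

theorem IsCutoff.nsq_le_localised (hδ : 0 < δ) :
    nsq u ≤ 2 * nsq (fun y => (χ y : ℂ) * u y) + 4 * δ ^ 2 * nsq p := by
  have hb : ∀ y, |1 - χ y| ≤ 1 := fun y =>
    abs_le.mpr ⟨by linarith [hχ.le_one y], by linarith [hχ.nonneg y]⟩
  have h2 := hu.nsq_layer_le (κ := fun y => 1 - χ y) hδ hb (fun y hy => by
    rw [hχ.eq_one y hy, sub_self])
  have L : MemLp (fun y => ((1 - χ y : ℝ) : ℂ) * u y) 2 volI :=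
    memLp_ofReal_mul (measurable_const.sub hχ.measurable) hb hu.memLp
  have h1 : nsq (fun y => (χ y : ℂ) * u y + ((1 - χ y : ℝ) : ℂ) * u y)
      ≤ 2 * nsq (fun y => (χ y : ℂ) * u y) + 2 * nsq (fun y => ((1 - χ y : ℝ) : ℂ) * u y) :=
    integral_normSq_add_le (hχ.memLp_mul hu.memLp) L
  have e : (fun y => (χ y : ℂ) * u y + ((1 - χ y : ℝ) : ℂ) * u y) = u := by
    ext y; push_cast; ring
  rw [e] at h1
  linarith

end localised

/-- The pairing with a force in `H¹₀(I)`: the localised part is controlled by the `H⁻¹` form, the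
boundary layers by Poincaré's inequality. -/
theorem IsCutoff.abs_re_pairing_le {K δ : ℝ} {χ : ℝ → ℝ} (hχ : IsCutoff K δ χ) (hK : 1 ≤ K)
    (hδ : 0 < δ) {v p f f' : ℝ → ℂ} (hv : IsH10 v p) (hf : IsH10 f f') {η ε α : ℝ}
    (hη : 0 < η) (hε : 0 < ε) (hα : 0 < α) :
    |(∫ y, (starRingEnd ℂ) (v y) * f y ∂volI).re|
      ≤ (ε * lorForm η (fun y => (χ y : ℂ) * v y)
          + ε⁻¹ * (6 * K ^ 2 * (η * nsq f + η⁻¹ * nsq f'))) / 2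
        + (α * (2 * δ ^ 2 * nsq p) + α⁻¹ * (2 * δ ^ 2 * nsq f')) / 2 := by
  have hF := isParsevalFrame_fourierKer
  set κ : ℝ → ℝ := fun y => √(1 - χ y ^ 2) with hκ
  have hχ2 : ∀ y, 0 ≤ 1 - χ y ^ 2 := fun y => by nlinarith [hχ.nonneg y, hχ.le_one y]
  have hκ2 : ∀ y, κ y ^ 2 = 1 - χ y ^ 2 := fun y => Real.sq_sqrt (hχ2 y)
  have hκ1 : ∀ y, |κ y| ≤ 1 := fun y => by
    rw [abs_of_nonneg (Real.sqrt_nonneg _)]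
    exact Real.sqrt_le_iff.mpr ⟨zero_le_one, by nlinarith [sq_nonneg (χ y)]⟩
  have hκ0 : ∀ y, |y| < 1 - δ → κ y = 0 := fun y hy => by simp [hκ, hχ.eq_one y hy]
  have hκm : Measurable κ := (measurable_const.sub (hχ.measurable.pow_const 2)).sqrt
  have Lv := hχ.memLp_mul hv.memLp
  have Lf := hχ.memLp_mul hf.memLp
  have Kv := memLp_ofReal_mul hκm hκ1 hv.memLp
  have Kf := memLp_ofReal_mul hκm hκ1 hf.memLp
  have e : ∀ y, (starRingEnd ℂ) (v y) * f y
      = (starRingEnd ℂ) ((χ y : ℂ) * v y) * ((χ y : ℂ) * f y)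
        + (starRingEnd ℂ) ((κ y : ℂ) * v y) * ((κ y : ℂ) * f y) := by
    intro y
    have : ((κ y : ℝ) : ℂ) ^ 2 = 1 - (χ y : ℂ) ^ 2 := by exact_mod_cast congrArg Complex.ofReal (hκ2 y)
    simp only [map_mul, Complex.conj_ofReal]
    linear_combination (-(starRingEnd ℂ) (v y) * f y) * this
  have hsplit : (∫ y, (starRingEnd ℂ) (v y) * f y ∂volI).re
      = mForm (fun _ => 1) (fun y => (χ y : ℂ) * v y) (fun y => (χ y : ℂ) * f y)
        + (∫ y, (starRingEnd ℂ) ((κ y : ℂ) * v y) * ((κ y : ℂ) * f y) ∂volI).re := by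
    rw [funext e, integral_add (integrable_conj_mul Lv Lf) (integrable_conj_mul Kv Kf),
      Complex.add_re]
    congr 1
    have h1 := hF.inner Lv Lf
    rw [Complex.ofReal_one, one_mul] at h1
    rw [← h1, mForm]
    have := Complex.reCLM.integral_comp_comm (integrable_conj_mul (hF.memLp _ Lv) (hF.memLp _ Lf))
    simp only [Complex.reCLM_apply] at this
    simp only [one_mul, this]
  have b1 := abs_mForm_le_weight (m := fun _ => 1) (fun _ => by simp) (w := lor η)
    (lor_pos hη) (integrable_lor hη Lv) (hχ.inv_lor hf hη).1 hε
  rw [(hχ.inv_lor hf hη).2] at b1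
  have b2 := abs_re_inner_le Kv Kf hα
  have b3 := hv.nsq_layer_le hδ hκ1 hκ0
  have b4 := hf.nsq_layer_le hδ hκ1 hκ0
  have b5 := hχ.nsq_mul_le hf
  have b6 := hχ.nsq_deriv_le hf hK hδ
  have b7 : η * nsq (fun y => (χ y : ℂ) * f y)
      + η⁻¹ * nsq (fun y => ((deriv χ y : ℝ) : ℂ) * f y + (χ y : ℂ) * f' y)
      ≤ 6 * K ^ 2 * (η * nsq f + η⁻¹ * nsq f') := by
    have c1 : η * nsq (fun y => (χ y : ℂ) * f y) ≤ η * nsq f := by gcongr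
    have c2 : η⁻¹ * nsq (fun y => ((deriv χ y : ℝ) : ℂ) * f y + (χ y : ℂ) * f' y)
      ≤ η⁻¹ * (6 * K ^ 2 * nsq f') := by gcongr
    have c3 : 0 ≤ η * nsq f := mul_nonneg hη.le (nsq_nonneg f)
    have c4 : 0 ≤ (6 * K ^ 2 - 1) * (η * nsq f) := mul_nonneg (by nlinarith) c3
    linarith
  rw [hsplit]
  refine (abs_add_le _ _).trans (add_le_add (b1.trans ?_) (b2.trans ?_))
  · have : ε⁻¹ * (η * nsq (fun y => (χ y : ℂ) * f y)
      + η⁻¹ * nsq (fun y => ((deriv χ y : ℝ) : ℂ) * f y + (χ y : ℂ) * f' y))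
      ≤ ε⁻¹ * (6 * K ^ 2 * (η * nsq f + η⁻¹ * nsq f')) := by gcongr
    unfold lorForm
    linarith
  · have c1 : α * nsq (fun y => (κ y : ℂ) * v y) ≤ α * (2 * δ ^ 2 * nsq p) := by
      refine mul_le_mul_of_nonneg_left ?_ hα.le; linarith
    have c2 : α⁻¹ * nsq (fun y => (κ y : ℂ) * f y) ≤ α⁻¹ * (2 * δ ^ 2 * nsq f') := by
      refine mul_le_mul_of_nonneg_left ?_ (by positivity); linarith
    linarith

/-! ### The dissipation inequality at a fixed time -/

/-- The force `-ig - f₄ - (a + iky)v`. -/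
def shearForce (a k : ℝ) (g f₄ v : ℝ → ℂ) (y : ℝ) : ℂ :=
  -Complex.I * g y - f₄ y - ((a : ℂ) + Complex.I * k * y) * v y

/-- Rate of change of `‖v‖²` under `∂_t v = G₀ - ∂_y G₁`, where `p = ∂_y v`. -/
def energyRate (v p G₀ G₁ : ℝ → ℂ) : ℝ :=
  2 * ((∫ y, (starRingEnd ℂ) (v y) * G₀ y ∂volI) + ∫ y, (starRingEnd ℂ) (p y) * G₁ y ∂volI).re

/-- Rate of change of `∫ m |F(χv)|²` under `∂_t v = G₀ - ∂_y G₁`, where `p = ∂_y v`. -/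
def multiplierRate (χ m : ℝ → ℝ) (v p G₀ G₁ : ℝ → ℂ) : ℝ :=
  2 * ∫ ξ, m ξ *
      ((starRingEnd ℂ) (coef fourierKer (fun y => (χ y : ℂ) * v y) ξ)
        * coef fourierKer (fun y => (χ y : ℂ) * G₀ y + ((deriv χ y : ℝ) : ℂ) * G₁ y) ξ
      + (starRingEnd ℂ)
          (coef fourierKer (fun y => ((deriv χ y : ℝ) : ℂ) * v y + (χ y : ℂ) * p y) ξ)
        * coef fourierKer (fun y => (χ y : ℂ) * G₁ y) ξ).re

theorem nsq_neg_I_mul (g : ℝ → ℂ) : nsq (fun y => -Complex.I * g y) = nsq g := by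
  simp [nsq]

theorem nsq_flux_le {ν : ℝ} {f₂ p : ℝ → ℂ} (hf₂ : MemLp f₂ 2 volI) (hp : MemLp p 2 volI) :
    nsq (fun y => f₂ y - ν * p y) ≤ 2 * nsq f₂ + 2 * ν ^ 2 * nsq p := by
  have h := integral_normSq_add_le hf₂ (hp.const_mul (-(ν : ℂ)))
  have e : nsq (fun y => f₂ y - ν * p y) = ∫ y, ‖f₂ y + -(ν : ℂ) * p y‖ ^ 2 ∂volI := by
    simp only [nsq]; congr 1; ext y; congr 2; ring
  have e2 : ∫ y, ‖-(ν : ℂ) * p y‖ ^ 2 ∂volI = ν ^ 2 * nsq p := by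
    rw [nsq, ← integral_const_mul]; congr 1; ext y
    rw [norm_mul, norm_neg, Complex.norm_real, mul_pow, Real.norm_eq_abs, sq_abs]
  rw [e2] at h
  change _ ≤ 2 * nsq f₂ + _ at h
  rw [e]
  linarith

/-- The squared size of the data at one time, in the norm dual to the dissipation. -/
def dataSize (ν κ η μ : ℝ) (g f₂ f₄ f₄' : ℝ → ℂ) : ℝ :=
  ν⁻¹ * nsq f₂ + κ⁻¹ * (η * nsq f₄ + η⁻¹ * nsq f₄') + μ⁻¹ * nsq g

section rates
variable {K δ κ σ ν η b μ c : ℝ} {χ : ℝ → ℝ} {v p g f₂ f₄ f₄' : ℝ → ℂ}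

/-- If `δη ≤ 1`, the energy dissipates `ν‖∂_y v‖²` at the cost of the data and of small multiples of
`μ‖v‖²` and of the `H⁻¹` form at frequency `η`, which the multiplier energy controls. -/
theorem energyRate_le_of_small_frequency (hχ : IsCutoff K δ χ) (hK : 1 ≤ K) (hδ : 0 < δ)
    (hκ : 0 < κ) (hν : ν = κ * δ ^ 3) (hη : 0 < η) (hδη : δ * η ≤ 1) (hμ : 0 < μ) (hc : 0 < c)
    (hv : IsH10 v p) (hg : MemLp g 2 volI) (hf₂ : MemLp f₂ 2 volI) (hf₄ : IsH10 f₄ f₄') {k : ℝ} :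
    energyRate v p (shearForce (ν * η ^ 2 - b) k g f₄ v) (fun y => f₂ y - ν * p y)
      ≤ -(ν * nsq p) - 2 * (ν * η ^ 2 - b) * nsq v + c / 64 * (μ * nsq v)
        + c / 8 * (κ * lorForm η (fun y => (χ y : ℂ) * v y))
        + 64 / c * (μ⁻¹ * nsq g) + 2 * (ν⁻¹ * nsq f₂)
        + (48 * K ^ 2 / c + 8) * (κ⁻¹ * (η * nsq f₄ + η⁻¹ * nsq f₄')) := by
  have hν0 : 0 < ν := by rw [hν]; positivity
  have h0 := energy_rate_eq (a := ν * η ^ 2 - b) (k := k) hv.memLp hv.memLp_deriv hg hf₂ hf₄.memLp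
    (ν := ν)
  have t1 := abs_re_inner_le hv.memLp (hg.const_mul (-Complex.I)) (ε := c / 64 * μ) (by positivity)
  rw [nsq_neg_I_mul] at t1
  have t2 := hχ.abs_re_pairing_le hK hδ hv hf₄ hη (ε := c / 8 * κ) (α := ν / (4 * δ ^ 2))
    (by positivity) (by positivity)
  have t3 := abs_re_inner_le hv.memLp_deriv hf₂ (ε := ν / 2) (by positivity)
  have e1 : c / 64 * μ * nsq v = c / 64 * (μ * nsq v) := by ring
  have e2 : (c / 64 * μ)⁻¹ * nsq g = 64 / c * (μ⁻¹ * nsq g) := by field_simp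
  have e3 : c / 8 * κ * lorForm η (fun y => (χ y : ℂ) * v y)
    = c / 8 * (κ * lorForm η (fun y => (χ y : ℂ) * v y)) := by ring
  have e4 : (c / 8 * κ)⁻¹ * (6 * K ^ 2 * (η * nsq f₄ + η⁻¹ * nsq f₄'))
    = 48 * K ^ 2 / c * (κ⁻¹ * (η * nsq f₄ + η⁻¹ * nsq f₄')) := by field_simp; ring
  have e5 : ν / (4 * δ ^ 2) * (2 * δ ^ 2 * nsq p) = ν * nsq p / 2 := by field_simp; ring
  -- here `δη ≤ 1` makes the layer contribution `δ f₄'²/κ` admissible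
  have e6 : (ν / (4 * δ ^ 2))⁻¹ * (2 * δ ^ 2 * nsq f₄')
      ≤ 8 * (κ⁻¹ * (η * nsq f₄ + η⁻¹ * nsq f₄')) := by
    have : (ν / (4 * δ ^ 2))⁻¹ * (2 * δ ^ 2 * nsq f₄') = 8 * (κ⁻¹ * (δ * nsq f₄')) := by
      rw [hν]; field_simp; ring
    rw [this]
    have h1 : δ ≤ η⁻¹ := by rw [← one_div, le_div_iff₀ hη]; exact hδη
    have h2 := mul_le_mul_of_nonneg_right h1 (nsq_nonneg f₄')
    have h3 := mul_nonneg hη.le (nsq_nonneg f₄)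
    gcongr
    linarith
  have e7 : (ν / 2)⁻¹ * nsq f₂ = 2 * (ν⁻¹ * nsq f₂) := by field_simp
  rw [e1, e2] at t1
  rw [e3, e4, e5] at t2
  rw [e7] at t3
  have s1 := (abs_le.mp t1).2
  have s2 := (abs_le.mp t2).1
  have s3 := (abs_le.mp t3).2
  have h0' : energyRate v p (shearForce (ν * η ^ 2 - b) k g f₄ v) (fun y => f₂ y - ν * p y) = _ := h0
  rw [h0']
  linarith

/-- The multiplier energy dissipates the `H⁻¹` form at frequency `η` and the enhanced dissipation
`κδ‖v‖²`, at the cost of a large multiple of the viscous dissipation. -/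
theorem multiplierRate_le (hχ : IsCutoff K δ χ) (hK : 1 ≤ K) (hδ : 0 < δ)
    (hκ : 0 < κ) (hσ : |σ| = 1) (hν : ν = κ * δ ^ 3) (hη : 0 < η) (hμ : 0 < μ) (hc : 0 < c)
    (hb : 0 ≤ b) (hv : IsH10 v p) (hg : MemLp g 2 volI) (hf₂ : MemLp f₂ 2 volI)
    (hf₄ : IsH10 f₄ f₄') :
    multiplierRate χ (arctanMult σ η δ⁻¹) v p (shearForce (ν * η ^ 2 - b) (σ * κ) g f₄ v)
        (fun y => f₂ y - ν * p y)
      ≤ -(κ * (lorForm η (fun y => (χ y : ℂ) * v y))) / 8 - κ * δ * nsq v / 8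
        + 74 * K ^ 2 * (ν * nsq p) + 2 * (ν * η ^ 2 + b) * nsq v + κ * δ * nsq v / 32
        + c / 64 * (μ * nsq v) + 64 / c * (μ⁻¹ * nsq g) + 66 * K ^ 2 * (ν⁻¹ * nsq f₂)
        + 48 * K ^ 2 * (κ⁻¹ * (η * nsq f₄ + η⁻¹ * nsq f₄')) := by
  have hν0 : 0 < ν := by rw [hν]; positivity
  have hl : 0 < δ⁻¹ := by positivity
  have hK2 : 1 ≤ K ^ 2 := by nlinarith
  set f : ℝ → ℂ := fun y => (χ y : ℂ) * v y with hf
  set G₁ : ℝ → ℂ := fun y => f₂ y - ν * p y with hG₁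
  have LG : MemLp G₁ 2 volI := hf₂.sub (hv.memLp_deriv.const_mul (ν : ℂ))
  have hm1 := abs_arctanMult_le hσ η δ⁻¹
  have hb' : ∀ ξ, |σ * (2 * (lor η ξ + lor δ⁻¹ ξ))| ≤ 2 * (η⁻¹ + δ⁻¹⁻¹) := fun ξ => by
    rw [abs_mul, hσ, one_mul, abs_mul, abs_two]
    have := abs_add_le (lor η ξ) (lor δ⁻¹ ξ)
    linarith [abs_lor_le hη ξ, abs_lor_le hl ξ]
  have h0 := multiplier_rate_eq hχ (hasDerivAt_arctanMult σ hη hl) hm1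
    (measurable_const.mul (measurable_const.mul
      ((continuous_lor hη).measurable.add (continuous_lor hl).measurable))) hb'
    (a := ν * η ^ 2 - b) (k := σ * κ) hv.memLp hv.memLp_deriv hg hf₄.memLp LG
  have h0' : multiplierRate χ (arctanMult σ η δ⁻¹) v p
    (shearForce (ν * η ^ 2 - b) (σ * κ) g f₄ v) G₁ = _ := h0
  have Lf := hχ.memLp_mul hv.memLp
  -- transport produces minus the `H⁻¹` forms at the frequencies `η` and `1 / δ`
  have σ2 : σ * σ = 1 := by rw [← abs_mul_abs_self, hσ, one_mul]
  have tr : -(σ * κ / (2 * Real.pi)) * (∫ ξ, σ * (2 * (lor η ξ + lor δ⁻¹ ξ))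
      * ‖coef fourierKer f ξ‖ ^ 2) = -(κ / Real.pi) * (lorForm η f + lorForm δ⁻¹ f) := by
    rw [lorForm, lorForm, ← integral_add (integrable_lor hη Lf) (integrable_lor hl Lf)]
    have : ∀ ξ, σ * (2 * (lor η ξ + lor δ⁻¹ ξ)) * ‖coef fourierKer f ξ‖ ^ 2
      = 2 * σ * (lor η ξ * ‖coef fourierKer f ξ‖ ^ 2 + lor δ⁻¹ ξ * ‖coef fourierKer f ξ‖ ^ 2) :=
      fun ξ => by ring
    simp only [this]
    rw [integral_const_mul]
    generalize (∫ ξ, (lor η ξ * ‖coef fourierKer f ξ‖ ^ 2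
      + lor δ⁻¹ ξ * ‖coef fourierKer f ξ‖ ^ 2)) = J
    have := Real.pi_ne_zero
    field_simp
    linear_combination -J * σ2
  have lnn : ∀ {l : ℝ}, 0 < l → 0 ≤ lorForm l f := fun hl =>
    integral_nonneg fun ξ => mul_nonneg (lor_pos hl ξ).le (by positivity)
  have Y0 := lnn hη
  have Z0 := lnn hl
  have tr' : -(κ / Real.pi) * (lorForm η f + lorForm δ⁻¹ f)
      ≤ -(κ * lorForm η f) / 4 - κ * lorForm δ⁻¹ f / 4 := by
    have h4 : κ / 4 ≤ κ / Real.pi := by gcongr; exact Real.pi_le_four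
    have := mul_le_mul_of_nonneg_right h4 (add_nonneg Y0 Z0)
    linarith
  have W : κ * δ * nsq v ≤ 2 * (κ * lorForm δ⁻¹ f) + 16 * K ^ 2 * (ν * nsq p) := by
    have w1 := hχ.nsq_le_localised hv hδ
    have w2 := hχ.nsq_le_lorForm hv hl
    have w3 := hχ.nsq_deriv_le hv hK hδ
    have w4 : κ * δ * nsq v ≤ κ * δ * (2 * (δ⁻¹ * lorForm δ⁻¹ f
        + (δ⁻¹ ^ 2)⁻¹ * (6 * K ^ 2 * nsq p)) + 4 * δ ^ 2 * nsq p) := by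
      refine mul_le_mul_of_nonneg_left (w1.trans ?_) (by positivity)
      have : (δ⁻¹ ^ 2)⁻¹ * nsq (fun y => ((deriv χ y : ℝ) : ℂ) * v y + (χ y : ℂ) * p y)
        ≤ (δ⁻¹ ^ 2)⁻¹ * (6 * K ^ 2 * nsq p) := by gcongr
      linarith
    have w5 : κ * δ * (2 * (δ⁻¹ * lorForm δ⁻¹ f
        + (δ⁻¹ ^ 2)⁻¹ * (6 * K ^ 2 * nsq p)) + 4 * δ ^ 2 * nsq p)
        = 2 * (κ * lorForm δ⁻¹ f) + (12 * K ^ 2 + 4) * (ν * nsq p) := by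
      rw [hν]; field_simp; ring
    have w6 : 0 ≤ (K ^ 2 - 1) * (ν * nsq p) :=
      mul_nonneg (by linarith) (mul_nonneg hν0.le (nsq_nonneg p))
    linarith
  -- each remaining term is bounded by a weighted Young inequality
  have t1 := abs_mForm_le hm1 Lf (hχ.memLp_mul (hg.const_mul (-Complex.I))) (ε := c / 64 * μ)
    (by positivity)
  have nv := hχ.nsq_mul_le hv
  have nle : ∀ {u : ℝ → ℂ}, MemLp u 2 volI → nsq (fun y => (χ y : ℂ) * u y) ≤ nsq u := by
    intro u hu
    have := integral_normSq_ofReal_mul_le hχ.abs_le_one hu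
    simpa [nsq] using this
  have ng := (nle (hg.const_mul (-Complex.I))).trans_eq (nsq_neg_I_mul g)
  have t2 := abs_mForm_le_weight hm1 (lor_pos hη) (integrable_lor hη Lf) (hχ.inv_lor hf₄ hη).1
    (ε := κ / 8) (by positivity)
  rw [(hχ.inv_lor hf₄ hη).2] at t2
  have t3 := abs_mForm_le hm1 Lf Lf (ε := 1) one_pos
  have t4 := abs_mForm_le hm1 Lf (hχ.memLp_deriv_mul LG) (ε := κ * δ / 32) (by positivity)
  have t5 := abs_mForm_le hm1 (memLp_add (hχ.memLp_deriv_mul hv.memLp)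
    (hχ.memLp_mul hv.memLp_deriv)) (hχ.memLp_mul LG) (ε := ν) hν0
  have nG := nsq_flux_le (ν := ν) hf₂ hv.memLp_deriv
  have nG2 := nle LG
  have nG3 : nsq (fun y => ((deriv χ y : ℝ) : ℂ) * G₁ y) ≤ (K / δ) ^ 2 * nsq G₁ :=
    integral_normSq_ofReal_mul_le hχ.deriv_le LG
  have nd := hχ.nsq_deriv_le hv hK hδ
  have P0 := nsq_nonneg p
  have V0 := nsq_nonneg v
  have N20 := nsq_nonneg f₂
  have s1 : c / 64 * μ * nsq f + (c / 64 * μ)⁻¹ * nsq (fun y => (χ y : ℂ) * (-Complex.I * g y))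
      ≤ c / 64 * (μ * nsq v) + 64 / c * (μ⁻¹ * nsq g) := by
    have : c / 64 * (μ * nsq v) + 64 / c * (μ⁻¹ * nsq g)
      = c / 64 * μ * nsq v + (c / 64 * μ)⁻¹ * nsq g := by field_simp
    rw [this]
    gcongr
  have s2 : κ / 8 * lorForm η f + (κ / 8)⁻¹ * (η * nsq (fun y => (χ y : ℂ) * f₄ y)
      + η⁻¹ * nsq (fun y => ((deriv χ y : ℝ) : ℂ) * f₄ y + (χ y : ℂ) * f₄' y))
      ≤ κ * lorForm η f / 8 + 48 * K ^ 2 * (κ⁻¹ * (η * nsq f₄ + η⁻¹ * nsq f₄')) := by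
    have : 48 * K ^ 2 * (κ⁻¹ * (η * nsq f₄ + η⁻¹ * nsq f₄'))
      = (κ / 8)⁻¹ * (η * (6 * K ^ 2 * nsq f₄) + η⁻¹ * (6 * K ^ 2 * nsq f₄')) := by
      field_simp; ring
    rw [this]
    have h1 := hχ.nsq_mul_le hf₄
    have h2 := hχ.nsq_deriv_le hf₄ hK hδ
    have h3 : nsq (fun y => (χ y : ℂ) * f₄ y) ≤ 6 * K ^ 2 * nsq f₄ :=
      h1.trans (le_mul_of_one_le_left (nsq_nonneg _) (by linarith))
    have : (κ / 8)⁻¹ * (η * nsq (fun y => (χ y : ℂ) * f₄ y)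
      + η⁻¹ * nsq (fun y => ((deriv χ y : ℝ) : ℂ) * f₄ y + (χ y : ℂ) * f₄' y))
      ≤ (κ / 8)⁻¹ * (η * (6 * K ^ 2 * nsq f₄) + η⁻¹ * (6 * K ^ 2 * nsq f₄')) := by gcongr
    linarith
  have s3 : |ν * η ^ 2 - b| * |mForm (arctanMult σ η δ⁻¹) f f| ≤ (ν * η ^ 2 + b) * nsq v := by
    have h1 : |ν * η ^ 2 - b| ≤ ν * η ^ 2 + b := by
      have : 0 ≤ ν * η ^ 2 := by positivity
      rw [abs_le]; constructor <;> linarith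
    refine mul_le_mul h1 ?_ (abs_nonneg _) (by positivity)
    rw [inv_one] at t3
    linarith
  have s4 : κ * δ / 32 * nsq f + (κ * δ / 32)⁻¹ * nsq (fun y => ((deriv χ y : ℝ) : ℂ) * G₁ y)
      ≤ κ * δ * nsq v / 32 + 64 * K ^ 2 * (ν⁻¹ * nsq f₂) + 64 * K ^ 2 * (ν * nsq p) := by
    have : κ * δ * nsq v / 32 + 64 * K ^ 2 * (ν⁻¹ * nsq f₂) + 64 * K ^ 2 * (ν * nsq p)
      = κ * δ / 32 * nsq v + (κ * δ / 32)⁻¹ * ((K / δ) ^ 2 *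
        (2 * nsq f₂ + 2 * ν ^ 2 * nsq p)) := by
      rw [hν]; field_simp; ring
    rw [this]
    have : nsq (fun y => ((deriv χ y : ℝ) : ℂ) * G₁ y)
      ≤ (K / δ) ^ 2 * (2 * nsq f₂ + 2 * ν ^ 2 * nsq p) := nG3.trans (by gcongr)
    gcongr
  have s5 : ν * nsq (fun y => ((deriv χ y : ℝ) : ℂ) * v y + (χ y : ℂ) * p y)
      + ν⁻¹ * nsq (fun y => (χ y : ℂ) * G₁ y)
      ≤ (6 * K ^ 2 + 2) * (ν * nsq p) + 2 * (ν⁻¹ * nsq f₂) := by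
    have : (6 * K ^ 2 + 2) * (ν * nsq p) + 2 * (ν⁻¹ * nsq f₂)
      = ν * (6 * K ^ 2 * nsq p) + ν⁻¹ * (2 * nsq f₂ + 2 * ν ^ 2 * nsq p) := by
      field_simp; ring
    rw [this]
    have := nG2.trans nG
    gcongr
  have a1 := (abs_le.mp t1).2
  have a2 := (abs_le.mp t2).1
  have a3 : -((ν * η ^ 2 - b) * mForm (arctanMult σ η δ⁻¹) f f)
    ≤ |ν * η ^ 2 - b| * |mForm (arctanMult σ η δ⁻¹) f f| := by
    rw [← abs_mul]; exact neg_le_abs _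
  have a4 := (abs_le.mp t4).2
  have a5 := (abs_le.mp t5).2
  rw [h0', tr]
  change _ ≤ -(κ * lorForm η f) / 8 - κ * δ * nsq v / 8
        + 74 * K ^ 2 * (ν * nsq p) + 2 * (ν * η ^ 2 + b) * nsq v + κ * δ * nsq v / 32
        + c / 64 * (μ * nsq v) + 64 / c * (μ⁻¹ * nsq g) + 66 * K ^ 2 * (ν⁻¹ * nsq f₂)
        + 48 * K ^ 2 * (κ⁻¹ * (η * nsq f₄ + η⁻¹ * nsq f₄'))
  change -((κ / 8 * lorForm η f + _) / 2) ≤ _ at a2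
  have u1 : 0 ≤ (K ^ 2 - 1) * (ν * nsq p) :=
    mul_nonneg (by linarith) (mul_nonneg hν0.le P0)
  have u2 : 0 ≤ (K ^ 2 - 1) * (ν⁻¹ * nsq f₂) :=
    mul_nonneg (by linarith) (mul_nonneg (by positivity) N20)
  linarith

/-- If `δη ≤ 1` the multiplier energy recovers the enhanced dissipation `κδ‖v‖²`. -/
theorem rate_le_of_small_frequency (hχ : IsCutoff K δ χ) (hK : 1 ≤ K) (hδ : 0 < δ)
    (hκ : 0 < κ) (hσ : |σ| = 1) (hν : ν = κ * δ ^ 3) (hη : 0 < η) (hδη : δ * η ≤ 1) (hμ : 0 < μ)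
    (hμ' : μ ≤ ν * η ^ 2 + κ * δ) (hc : c = 1 / (148 * K ^ 2)) (hb : 0 ≤ b)
    (hb' : b ≤ c / 256 * (κ * δ))
    (hv : IsH10 v p) (hg : MemLp g 2 volI) (hf₂ : MemLp f₂ 2 volI) (hf₄ : IsH10 f₄ f₄') :
    energyRate v p (shearForce (ν * η ^ 2 - b) (σ * κ) g f₄ v) (fun y => f₂ y - ν * p y)
      + c * multiplierRate χ (arctanMult σ η δ⁻¹) v p
        (shearForce (ν * η ^ 2 - b) (σ * κ) g f₄ v) (fun y => f₂ y - ν * p y)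
      ≤ -(c / 32 * (ν * nsq p + (ν * η ^ 2 + κ * δ) * nsq v))
        + 1000 * K ^ 2 / c * dataSize ν κ η μ g f₂ f₄ f₄' := by
  have hν0 : 0 < ν := by rw [hν]; positivity
  have hK2 : 1 ≤ K ^ 2 := by nlinarith
  have hc0 : 0 < c := by rw [hc]; positivity
  -- with this `c`, the loss `74 c K² ν‖∂_y v‖²` is half of the viscous dissipation
  have hcK : c * K ^ 2 = 1 / 148 := by rw [hc]; field_simp
  have hc1 : c ≤ 1 / 148 := by rw [← hcK]; exact le_mul_of_one_le_right hc0.le hK2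
  have h1 := energyRate_le_of_small_frequency (b := b) (k := σ * κ) hχ hK hδ hκ hν hη hδη hμ hc0
    hv hg hf₂ hf₄
  have h2 := mul_le_mul_of_nonneg_left
    (multiplierRate_le hχ hK hδ hκ hσ hν hη hμ hc0 hb hv hg hf₂ hf₄) hc0.le
  have V0 := nsq_nonneg v
  have hW : 0 ≤ κ * δ * nsq v := by positivity
  have hD : 0 ≤ ν * η ^ 2 * nsq v := by positivity
  have hP : 0 ≤ ν * nsq p := mul_nonneg hν0.le (nsq_nonneg p)
  have hN2 : 0 ≤ ν⁻¹ * nsq f₂ := mul_nonneg (by positivity) (nsq_nonneg _)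
  have hNg : 0 ≤ μ⁻¹ * nsq g := mul_nonneg (by positivity) (nsq_nonneg _)
  have hQ : 0 ≤ κ⁻¹ * (η * nsq f₄ + η⁻¹ * nsq f₄') := by
    have := nsq_nonneg f₄; have := nsq_nonneg f₄'; positivity
  rw [dataSize]
  set W := κ * δ * nsq v with hWd
  set D := ν * η ^ 2 * nsq v with hDd
  set P := ν * nsq p
  set N := ν⁻¹ * nsq f₂
  set M := μ⁻¹ * nsq g
  set Q := κ⁻¹ * (η * nsq f₄ + η⁻¹ * nsq f₄')
  set L := κ * lorForm η (fun y => (χ y : ℂ) * v y)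
  set B := b * nsq v with hB
  have hBW : B ≤ c / 256 * W := by
    rw [hB, hWd, ← mul_assoc]; exact mul_le_mul_of_nonneg_right hb' V0
  have hB0 : 0 ≤ B := mul_nonneg hb V0
  have hU : μ * nsq v ≤ D + W := by
    rw [hDd, hWd, ← add_mul]; exact mul_le_mul_of_nonneg_right hμ' V0
  have hU0 : 0 ≤ μ * nsq v := mul_nonneg hμ.le V0
  set U := μ * nsq v
  have e1 : 2 * (ν * η ^ 2 - b) * nsq v = 2 * D - 2 * B := by rw [hDd, hB]; ring
  have e2 : 2 * (ν * η ^ 2 + b) * nsq v = 2 * D + 2 * B := by rw [hDd, hB]; ring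
  have e3 : (ν * η ^ 2 + κ * δ) * nsq v = D + W := by rw [hDd, hWd]; ring
  rw [e1] at h1
  rw [e2] at h2
  rw [e3]
  have e4 : c * (-L / 8 - W / 8 + 74 * K ^ 2 * P + (2 * D + 2 * B) + W / 32
        + c / 64 * U + 64 / c * M + 66 * K ^ 2 * N + 48 * K ^ 2 * Q)
      = -(c / 8 * L) - 3 / 32 * (c * W) + 74 / 148 * P + 2 * (c * D) + 2 * (c * B)
        + c * c / 64 * U + 64 * M + 66 / 148 * N + 48 / 148 * Q := by
    have : c * (64 / c * M) = 64 * M := by field_simp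
    linear_combination (74 * P + 66 * N + 48 * Q) * hcK + this
  rw [e4] at h2
  have q1 : c * D ≤ 1 / 148 * D := mul_le_mul_of_nonneg_right hc1 hD
  have q2 : c * B ≤ 1 / 148 * B := mul_le_mul_of_nonneg_right hc1 hB0
  have q3 : c * U ≤ c * (D + W) := mul_le_mul_of_nonneg_left hU hc0.le
  have q4 : c * c / 64 * U ≤ c / 64 * U := by
    refine mul_le_mul_of_nonneg_right ?_ hU0
    nlinarith
  have q5 : c * P ≤ 1 / 148 * P := mul_le_mul_of_nonneg_right hc1 hP
  have cW : 0 ≤ c * W := mul_nonneg hc0.le hW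
  have hci : 1 ≤ 1 / c := by rw [le_div_iff₀ hc0]; linarith
  have hci2 : 1 / c ≤ K ^ 2 / c := by gcongr
  have r1 : 64 / c * M + 64 * M ≤ 1000 * K ^ 2 / c * M := by
    have : 64 / c + 64 ≤ 1000 * K ^ 2 / c := by
      have a1 : 64 / c = 64 * (1 / c) := by ring
      have a2 : 1000 * K ^ 2 / c = 1000 * (K ^ 2 / c) := by ring
      rw [a1, a2]; linarith
    rw [← add_mul]; exact mul_le_mul_of_nonneg_right this hNg
  have r2 : 3 * N ≤ 1000 * K ^ 2 / c * N := by
    refine mul_le_mul_of_nonneg_right ?_ hN2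
    have a2 : 1000 * K ^ 2 / c = 1000 * (K ^ 2 / c) := by ring
    rw [a2]; linarith
  have r3 : (48 * K ^ 2 / c + 8) * Q + Q ≤ 1000 * K ^ 2 / c * Q := by
    have : 48 * K ^ 2 / c + 8 + 1 ≤ 1000 * K ^ 2 / c := by
      have a1 : 48 * K ^ 2 / c = 48 * (K ^ 2 / c) := by ring
      have a2 : 1000 * K ^ 2 / c = 1000 * (K ^ 2 / c) := by ring
      rw [a1, a2]; linarith
    have h := mul_le_mul_of_nonneg_right this hQ
    linarith
  rw [show c / 32 * (P + (D + W)) = (c * P) / 32 + (c * D) / 32 + (c * W) / 32 by ring,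
    mul_add, mul_add]
  linarith

/-- If `δη ≥ 1`, viscosity alone dominates the enhanced dissipation. -/
theorem energyRate_le_of_large_frequency (hδ : 0 < δ) (hκ : 0 < κ) (hν : ν = κ * δ ^ 3)
    (hη : 0 < η) (hδη : 1 ≤ δ * η) (hμ : 0 < μ) (hμ' : μ ≤ ν * η ^ 2 + κ * δ)
    (hb' : b ≤ 1 / 8 * (κ * δ)) (hv : IsH10 v p) (hg : MemLp g 2 volI) (hf₂ : MemLp f₂ 2 volI)
    (hf₄ : IsH10 f₄ f₄') {k : ℝ} :
    energyRate v p (shearForce (ν * η ^ 2 - b) k g f₄ v) (fun y => f₂ y - ν * p y)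
      ≤ -(1 / 2 * (ν * nsq p + (ν * η ^ 2 + κ * δ) * nsq v))
        + 8 * dataSize ν κ η μ g f₂ f₄ f₄' := by
  have hν0 : 0 < ν := by rw [hν]; positivity
  have h0 := energy_rate_eq (a := ν * η ^ 2 - b) (k := k) hv.memLp hv.memLp_deriv hg hf₂ hf₄.memLp
    (ν := ν)
  have h0' : energyRate v p (shearForce (ν * η ^ 2 - b) k g f₄ v) (fun y => f₂ y - ν * p y) = _ := h0
  have V0 := nsq_nonneg v
  have hle : κ * δ ≤ ν * η ^ 2 := by
    have : ν * η ^ 2 = κ * δ * (δ * η) ^ 2 := by rw [hν]; ring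
    rw [this]; exact le_mul_of_one_le_right (by positivity) (one_le_pow₀ hδη)
  have t1 := abs_re_inner_le hv.memLp (hg.const_mul (-Complex.I)) (ε := 1 / 8 * μ) (by positivity)
  rw [nsq_neg_I_mul] at t1
  have t2 := abs_re_inner_le hv.memLp hf₄.memLp (ε := ν * η ^ 2 / 2) (by positivity)
  have t3 := abs_re_inner_le hv.memLp_deriv hf₂ (ε := ν / 2) (by positivity)
  have hW : κ * δ * nsq v ≤ ν * η ^ 2 * nsq v := mul_le_mul_of_nonneg_right hle V0
  have hU : μ * nsq v ≤ (ν * η ^ 2 + κ * δ) * nsq v := mul_le_mul_of_nonneg_right hμ' V0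
  have hB : b * nsq v ≤ 1 / 8 * (κ * δ) * nsq v := mul_le_mul_of_nonneg_right hb' V0
  have hP : 0 ≤ ν * nsq p := mul_nonneg hν0.le (nsq_nonneg p)
  have hN2 : 0 ≤ ν⁻¹ * nsq f₂ := mul_nonneg (by positivity) (nsq_nonneg _)
  have e2 : (1 / 8 * μ)⁻¹ * nsq g = 8 * (μ⁻¹ * nsq g) := by field_simp
  have e4 : (ν * η ^ 2 / 2)⁻¹ * nsq f₄ ≤ 2 * (κ⁻¹ * (η * nsq f₄ + η⁻¹ * nsq f₄')) := by
    have h1 : (ν * η ^ 2 / 2)⁻¹ ≤ 2 * (κ⁻¹ * η) := by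
      rw [inv_le_comm₀ (by positivity) (by positivity), hν]
      have : (2 * (κ⁻¹ * η))⁻¹ = κ / (2 * η) := by field_simp
      rw [this, div_le_iff₀ (by positivity)]
      have : κ * δ ^ 3 * η ^ 2 / 2 * (2 * η) = κ * (δ * η) ^ 3 := by ring
      rw [this]
      exact le_mul_of_one_le_right hκ.le (one_le_pow₀ hδη)
    have h2 := mul_le_mul_of_nonneg_right h1 (nsq_nonneg f₄)
    have h3 : 0 ≤ κ⁻¹ * (η⁻¹ * nsq f₄') := by have := nsq_nonneg f₄'; positivity
    linarith
  have hQ : 0 ≤ κ⁻¹ * (η * nsq f₄ + η⁻¹ * nsq f₄') := by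
    have := nsq_nonneg f₄; have := nsq_nonneg f₄'; positivity
  have e7 : (ν / 2)⁻¹ * nsq f₂ = 2 * (ν⁻¹ * nsq f₂) := by field_simp
  rw [e2] at t1
  rw [e7] at t3
  have s1 := (abs_le.mp t1).2
  have s2 := (abs_le.mp t2).1
  have s3 := (abs_le.mp t3).2
  rw [h0', dataSize]
  linarith

end rates

/-! ### Enhanced dissipation -/

/-- Solutions of `∂_t v = ν(∂_y² - η²)v - ikyv + bv - ig - ∂_y f₂ - f₄` on `(0, τ) × I` with
`v = 0` on the boundary and initial datum `v₀`; here `p = ∂_y v` and `f₄' = ∂_y f₄`. -/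
structure ShearEvolution (τ ν η k b : ℝ) (v₀ : ℝ → ℂ) (v p g f₂ f₄ f₄' : ℝ → ℝ → ℂ) : Prop where
  evolution : IsEvolution τ v₀ v p (fun t => shearForce (ν * η ^ 2 - b) k (g t) (f₄ t) (v t))
    (fun t y => f₂ t y - ν * p t y)
  measurable_init : Measurable v₀
  g_mem : L2Q τ g
  f₂_mem : L2Q τ f₂
  f₄_mem : L2Q τ f₄
  f₄'_mem : L2Q τ f₄'
  f₄_isH10 : ∀ᵐ t ∂muT τ, IsH10 (f₄ t) (f₄' t)

/-- The dissipation, including its enhanced part `κδ‖v‖²`. -/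
def dissipation (ν κ δ η : ℝ) (v p : ℝ → ℂ) : ℝ :=
  ν * nsq p + (ν * η ^ 2 + κ * δ) * nsq v

theorem integrable_dissipation {τ : ℝ} {v p : ℝ → ℝ → ℂ} (hv : L2Q τ v) (hp : L2Q τ p)
    (ν κ δ η : ℝ) : Integrable (fun s => dissipation ν κ δ η (v s) (p s)) (muT τ) :=
  (hp.integrable_nsq.const_mul _).add (hv.integrable_nsq.const_mul _)

theorem integrable_dataSize {τ : ℝ} {g f₂ f₄ f₄' : ℝ → ℝ → ℂ} (hg : L2Q τ g) (hf₂ : L2Q τ f₂)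
    (hf₄ : L2Q τ f₄) (hf₄' : L2Q τ f₄') (ν κ η μ : ℝ) :
    Integrable (fun s => dataSize ν κ η μ (g s) (f₂ s) (f₄ s) (f₄' s)) (muT τ) :=
  ((hf₂.integrable_nsq.const_mul _).add (((hf₄.integrable_nsq.const_mul _).add
    (hf₄'.integrable_nsq.const_mul _)).const_mul _)).add (hg.integrable_nsq.const_mul _)

theorem dataSize_nonneg {ν κ η μ : ℝ} (hν : 0 < ν) (hκ : 0 < κ) (hη : 0 < η) (hμ : 0 < μ)
    (g f₂ f₄ f₄' : ℝ → ℂ) : 0 ≤ dataSize ν κ η μ g f₂ f₄ f₄' := by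
  have := nsq_nonneg g
  have := nsq_nonneg f₂
  have := nsq_nonneg f₄
  have := nsq_nonneg f₄'
  unfold dataSize; positivity

/-- Integration of a differential inequality for `E + cM`, where `M` is dominated by `E`. -/
theorem ae_le_of_rate_le {τ : ℝ} {E M r₁ r₂ D R : ℝ → ℝ} {E₀ M₀ c c₀ C₀ : ℝ}
    (h₁ : Integrable r₁ (muT τ)) (h₂ : Integrable r₂ (muT τ)) (hD : Integrable D (muT τ))
    (hR : Integrable R (muT τ))
    (hE : ∀ᵐ t ∂muT τ, E t = E₀ + ∫ s in (0 : ℝ)..t, r₁ s)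
    (hM : ∀ᵐ t ∂muT τ, M t = M₀ + ∫ s in (0 : ℝ)..t, r₂ s)
    (hME : ∀ᵐ t ∂muT τ, |M t| ≤ E t) (hM₀ : |M₀| ≤ E₀) (hc : 0 ≤ c) (hc' : c ≤ 1 / 2)
    (hrate : ∀ᵐ s ∂muT τ, r₁ s + c * r₂ s ≤ -(c₀ * D s) + C₀ * R s) :
    ∀ᵐ t ∂muT τ, 1 / 2 * E t + c₀ * ∫ s in (0 : ℝ)..t, D s
      ≤ 3 / 2 * E₀ + C₀ * ∫ s in (0 : ℝ)..t, R s := by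
  filter_upwards [hE, hM, hME, ae_muT_mem τ] with t e m me ht
  have i := fun {f : ℝ → ℝ} (hf : Integrable f (muT τ)) => hf.mono_measure (muT_mono ht.2.le)
  have key : ∫ s, (r₁ s + c * r₂ s) ∂muT t ≤ ∫ s, (-(c₀ * D s) + C₀ * R s) ∂muT t :=
    integral_mono_ae ((i h₁).add ((i h₂).const_mul c))
      (((i hD).const_mul c₀).neg.add ((i hR).const_mul C₀)) (ae_mono (muT_mono ht.2.le) hrate)
  rw [integral_add (i h₁) ((i h₂).const_mul c),
    integral_add (f := fun s => -(c₀ * D s)) ((i hD).const_mul c₀).neg ((i hR).const_mul C₀),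
    integral_neg,
    integral_const_mul, integral_const_mul, integral_const_mul] at key
  rw [intervalIntegral_eq_muT ht.1.le] at e m ⊢
  rw [intervalIntegral_eq_muT ht.1.le]
  have a1 := abs_le.mp me
  have a2 := abs_le.mp hM₀
  have E0 : 0 ≤ E t := (abs_nonneg _).trans me
  have E00 : 0 ≤ E₀ := (abs_nonneg _).trans hM₀
  have b1 : -(1 / 2 * E t) ≤ c * M t := by nlinarith
  have b2 : c * M₀ ≤ 1 / 2 * E₀ := by nlinarith
  have e3 : c * M t = c * M₀ + c * ∫ s, r₂ s ∂muT t := by rw [m]; ring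
  linarith

theorem abs_multiplier_energy_le {K δ : ℝ} {χ m : ℝ → ℝ} (hχ : IsCutoff K δ χ)
    (hm1 : ∀ ξ, |m ξ| ≤ 1) {v : ℝ → ℂ} (hv : MemLp v 2 volI) :
    |∫ ξ, m ξ * ‖coef fourierKer (fun y => (χ y : ℂ) * v y) ξ‖ ^ 2| ≤ nsq v := by
  have L := hχ.memLp_mul hv
  have hF := isParsevalFrame_fourierKer
  have h1 : |∫ ξ, m ξ * ‖coef fourierKer (fun y => (χ y : ℂ) * v y) ξ‖ ^ 2|
      ≤ ∫ ξ, ‖coef fourierKer (fun y => (χ y : ℂ) * v y) ξ‖ ^ 2 := by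
    refine abs_integral_le_integral_abs.trans (integral_mono_of_nonneg
      (Filter.Eventually.of_forall fun _ => abs_nonneg _) (integrable_normSq (hF.memLp _ L))
      (Filter.Eventually.of_forall fun ξ => ?_))
    simp only [abs_mul, abs_of_nonneg (sq_nonneg ‖coef fourierKer _ ξ‖)]
    exact mul_le_of_le_one_left (by positivity) (hm1 ξ)
  refine h1.trans ?_
  rw [hF.parseval _ L, one_mul]
  have := integral_normSq_ofReal_mul_le hχ.abs_le_one hv
  simpa [nsq] using this

/-- The estimate in `L^∞L² ∩ L²H¹` with enhanced dissipation, for exponential weights `e^{bt}` up to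
the enhanced dissipation rate. -/
theorem exists_energy_estimate : ∃ ε : ℝ, 0 < ε ∧ ∃ C : ℝ, 1 ≤ C ∧
    ∀ {τ ν η κ δ σ b μ : ℝ} {v₀ : ℝ → ℂ} {v p g f₂ f₄ f₄' : ℝ → ℝ → ℂ},
      0 < δ → 0 < κ → |σ| = 1 → ν = κ * δ ^ 3 → 1 ≤ η → 0 < μ → μ ≤ ν * η ^ 2 + κ * δ → 0 ≤ b →
      b ≤ ε * (κ * δ) → ShearEvolution τ ν η (σ * κ) b v₀ v p g f₂ f₄ f₄' →
      ∀ᵐ t ∂muT τ, nsq (v t) + ∫ s in (0 : ℝ)..t, dissipation ν κ δ η (v s) (p s)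
        ≤ C * (nsq v₀
          + ∫ s in (0 : ℝ)..t, dataSize ν κ η μ (g s) (f₂ s) (f₄ s) (f₄' s)) := by
  obtain ⟨K, hK, hcut⟩ := exists_cutoff
  have hK2 : 1 ≤ K ^ 2 := by nlinarith
  set c : ℝ := 1 / (148 * K ^ 2) with hc
  have hc0 : 0 < c := by positivity
  have hc1 : c ≤ 1 / 148 := by
    rw [hc, div_le_div_iff₀ (by positivity) (by norm_num)]; linarith
  set C₀ : ℝ := 1000 * K ^ 2 / c with hC₀
  have hC₀' : 8 ≤ C₀ := by
    rw [hC₀, le_div_iff₀ hc0]; nlinarith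
  refine ⟨c / 256, by positivity, 32 / c * (3 / 2 + C₀), ?_, ?_⟩
  · have : 1 ≤ 32 / c := by rw [le_div_iff₀ hc0]; linarith
    nlinarith
  intro τ ν η κ δ σ b μ v₀ v p g f₂ f₄ f₄' hδ hκ hσ hν hη hμ hμ' hb hb' h
  have hη0 : 0 < η := by linarith
  have hν0 : 0 < ν := by rw [hν]; positivity
  have hev := h.evolution
  have iD := integrable_dissipation hev.v_mem hev.p_mem ν κ δ η
  have iR := integrable_dataSize h.g_mem h.f₂_mem h.f₄_mem h.f₄'_mem ν κ η μ
  have iE : Integrable (fun s => energyRate (v s) (p s)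
      (shearForce (ν * η ^ 2 - b) (σ * κ) (g s) (f₄ s) (v s))
      (fun y => f₂ s y - ν * p s y)) (muT τ) :=
    (((hev.v_mem.integrable_pairing hev.G₀_mem).add
      (hev.p_mem.integrable_pairing hev.G₁_mem)).re).const_mul 2
  have key : ∀ᵐ t ∂muT τ, 1 / 2 * nsq (v t)
      + c / 32 * ∫ s in (0 : ℝ)..t, dissipation ν κ δ η (v s) (p s)
      ≤ 3 / 2 * nsq v₀
        + C₀ * ∫ s in (0 : ℝ)..t, dataSize ν κ η μ (g s) (f₂ s) (f₄ s) (f₄' s) := by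
    rcases le_total (δ * η) 1 with hδη | hδη
    · obtain ⟨χ, hχ⟩ := hcut δ hδ ((le_mul_of_one_le_right hδ.le hη).trans hδη)
      have hm1 := abs_arctanMult_le hσ η δ⁻¹
      obtain ⟨iM, hM⟩ := hev.multiplier_energy hχ h.measurable_init
        (continuous_arctanMult σ η δ⁻¹).measurable hm1
      refine ae_le_of_rate_le (c := c) iE iM iD iR hev.energy hM ?_
        (abs_multiplier_energy_le hχ hm1 hev.v₀_mem) hc0.le (by linarith) ?_
      · filter_upwards [hev.v_mem.slice] with t ht
        exact abs_multiplier_energy_le hχ hm1 ht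
      · filter_upwards [hev.isH10, h.g_mem.slice, h.f₂_mem.slice, h.f₄_isH10] with s h1 h2 h3 h4
        exact rate_le_of_small_frequency hχ hK hδ hκ hσ hν hη0 hδη hμ hμ' hc hb hb' h1 h2 h3 h4
    · refine ae_le_of_rate_le (c := 0) (M := fun _ => 0) (M₀ := 0) (r₂ := fun _ => 0) iE
        (integrable_zero _ _ _) iD iR hev.energy (by simp) ?_ ?_ le_rfl (by norm_num) ?_
      · exact Filter.Eventually.of_forall fun t => by simpa using nsq_nonneg (v t)
      · simpa using nsq_nonneg v₀
      · filter_upwards [hev.isH10, h.g_mem.slice, h.f₂_mem.slice, h.f₄_isH10] with s h1 h2 h3 h4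
        have hκδ : 0 < κ * δ := by positivity
        have := energyRate_le_of_large_frequency hδ hκ hν hη0 hδη hμ hμ' (b := b)
          (by nlinarith) h1 h2 h3 h4 (k := σ * κ)
        have hR := dataSize_nonneg hν0 hκ hη0 hμ (g s) (f₂ s) (f₄ s) (f₄' s)
        have hD : 0 ≤ ν * nsq (p s) + (ν * η ^ 2 + κ * δ) * nsq (v s) := by
          have := nsq_nonneg (p s); have := nsq_nonneg (v s); positivity
        have d1 := mul_le_mul_of_nonneg_right hC₀' hR
        have d2 : c / 32 * (ν * nsq (p s) + (ν * η ^ 2 + κ * δ) * nsq (v s))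
          ≤ 1 / 2 * (ν * nsq (p s) + (ν * η ^ 2 + κ * δ) * nsq (v s)) :=
          mul_le_mul_of_nonneg_right (by linarith) hD
        rw [dissipation]
        linarith
  filter_upwards [key, ae_muT_mem τ] with t ht htτ
  have V0 := nsq_nonneg (v t)
  have V00 := nsq_nonneg v₀
  have hR : 0 ≤ ∫ s in (0 : ℝ)..t, dataSize ν κ η μ (g s) (f₂ s) (f₄ s) (f₄' s) :=
    intervalIntegral.integral_nonneg htτ.1.le fun s _ => dataSize_nonneg hν0 hκ hη0 hμ _ _ _ _
  set D := ∫ s in (0 : ℝ)..t, dissipation ν κ δ η (v s) (p s)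
  set R := ∫ s in (0 : ℝ)..t, dataSize ν κ η μ (g s) (f₂ s) (f₄ s) (f₄' s)
  have h1 := mul_le_mul_of_nonneg_left ht (show 0 ≤ 32 / c by positivity)
  have e1 : 32 / c * (1 / 2 * nsq (v t) + c / 32 * D) = 16 / c * nsq (v t) + D := by
    field_simp; ring
  have e2 : nsq (v t) ≤ 16 / c * nsq (v t) := by
    refine le_mul_of_one_le_left V0 ?_
    rw [le_div_iff₀ hc0]; linarith
  have e3 : 3 / 2 * nsq v₀ + C₀ * R ≤ (3 / 2 + C₀) * (nsq v₀ + R) := by nlinarith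
  have e4 := mul_le_mul_of_nonneg_left e3 (show 0 ≤ 32 / c by positivity)
  rw [e1] at h1
  linarith

/-! ### Second derivatives -/

section synthesis
variable {X : Type*} [MeasurableSpace X] {μ : Measure X} {ψ : X → ℝ → ℂ} {κ : ℝ}
  (hψ : IsParsevalFrame μ ψ κ)

/-- The analysis operator `g ↦ (∫_I g ψ_x)_x` as a bounded map between `L²` spaces. -/
def IsParsevalFrame.analysis : Lp ℂ 2 volI →L[ℂ] Lp ℂ 2 μ :=
  LinearMap.mkContinuous
    { toFun := fun g => (hψ.memLp g (Lp.memLp g)).toLp (coef ψ g)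
      map_add' := fun f g => by
        rw [← MemLp.toLp_add]
        congr 1
        ext x
        rw [coef_congr (Lp.coeFn_add f g) x]
        exact hψ.coef_add (Lp.memLp f) (Lp.memLp g) x
      map_smul' := fun c g => by
        rw [RingHom.id_apply, ← MemLp.toLp_const_smul]
        congr 1
        ext x
        rw [coef_congr (Lp.coeFn_smul c g) x]
        exact coef_const_mul c g x }
    (√κ) fun g => by
      refine le_of_sq_le_sq ?_ (by positivity)
      change ‖(hψ.memLp g (Lp.memLp g)).toLp (coef ψ g)‖ ^ 2 ≤ _
      have h2 : ‖g‖ ^ 2 = nsq g := by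
        rw [nsq, ← norm_toLp_sq (Lp.memLp g), Lp.toLp_coeFn]
      rw [norm_toLp_sq, hψ.parseval _ (Lp.memLp g), mul_pow, h2]
      refine mul_le_mul_of_nonneg_right ?_ (nsq_nonneg _)
      rw [Real.sq_sqrt']
      exact le_max_left _ _

include hψ in
/-- Riesz–Fischer for a Parseval frame, through the adjoint of the analysis operator. -/
theorem IsParsevalFrame.exists_synthesis (hκ : 0 ≤ κ) {a : X → ℂ} (ha : MemLp a 2 μ) :
    ∃ r : ℝ → ℂ, MemLp r 2 volI ∧ nsq r ≤ κ * ∫ x, ‖a x‖ ^ 2 ∂μ ∧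
      ∀ g, MemLp g 2 volI → ∫ y, (starRingEnd ℂ) (r y) * g y ∂volI
        = ∫ x, (starRingEnd ℂ) (a x) * coef ψ g x ∂μ := by
  set A := hψ.analysis with hA
  set r := (ContinuousLinearMap.adjoint A) (ha.toLp a) with hr
  have hn : ‖A‖ ≤ √κ := LinearMap.mkContinuous_norm_le _ (Real.sqrt_nonneg _) _
  refine ⟨r, Lp.memLp r, ?_, fun g hg => ?_⟩
  · have h1 : ‖r‖ ≤ √κ * ‖ha.toLp a‖ := by
      refine ((ContinuousLinearMap.adjoint A).le_opNorm _).trans ?_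
      rw [LinearIsometryEquiv.norm_map]
      gcongr
    have h2 : ‖r‖ ^ 2 = nsq r := by
      rw [nsq, ← norm_toLp_sq (Lp.memLp r), Lp.toLp_coeFn]
    rw [← h2, ← norm_toLp_sq ha]
    calc ‖r‖ ^ 2 ≤ (√κ * ‖ha.toLp a‖) ^ 2 := by gcongr
      _ = κ * ‖ha.toLp a‖ ^ 2 := by rw [mul_pow, Real.sq_sqrt hκ]
  · have h1 := ContinuousLinearMap.adjoint_inner_left A (hg.toLp g) (ha.toLp a)
    rw [← hr, L2.inner_def, L2.inner_def] at h1
    have e1 : ∫ y, Inner.inner ℂ ((r : ℝ → ℂ) y) ((hg.toLp g : ℝ → ℂ) y) ∂volI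
        = ∫ y, (starRingEnd ℂ) (r y) * g y ∂volI := by
      refine integral_congr_ae (hg.coeFn_toLp.mono fun y hy => ?_)
      simp only [hy, RCLike.inner_apply]
      ring
    rw [e1] at h1
    rw [h1]
    have hc : ∀ x, coef ψ (hg.toLp g) x = coef ψ g x := fun x => coef_congr hg.coeFn_toLp x
    have hAg : (A (hg.toLp g) : X → ℂ) =ᵐ[μ] coef ψ g :=
      (hψ.memLp _ (Lp.memLp (hg.toLp g))).coeFn_toLp.trans (Filter.Eventually.of_forall hc)
    refine integral_congr_ae ?_
    filter_upwards [ha.coeFn_toLp, hAg] with x h1 h2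
    simp only [h1, h2, RCLike.inner_apply]
    ring

end synthesis

theorem isH10_of_contDiff {φ : ℝ → ℂ} (hφ : ContDiff ℝ 1 φ) (h0 : φ (-1) = 0) (h1 : φ 1 = 0) :
    IsH10 φ (deriv φ) := by
  have hc : Continuous (deriv φ) := hφ.continuous_deriv le_rfl
  have hd : ∀ a b : ℝ, ∫ s in a..b, deriv φ s = φ b - φ a := fun a b =>
    intervalIntegral.integral_deriv_eq_sub (fun x _ => (hφ.differentiable one_ne_zero) x)
      (hc.intervalIntegrable _ _)
  refine ⟨?_, ?_, Filter.Eventually.of_forall fun y => ?_⟩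
  · obtain ⟨B, hB⟩ := (isCompact_Icc (a := (-1 : ℝ)) (b := 1)).exists_bound_of_continuousOn
      hc.continuousOn
    exact MemLp.of_bound hc.aestronglyMeasurable B
      (ae_volI_mem.mono fun y hy => hB y ⟨hy.1.le, hy.2.le⟩)
  · rw [integral_volI, hd, h0, h1, sub_zero]
  · rw [hd, h0, sub_zero]

theorem conj_cosKer (n : ℤ) (y : ℝ) : (starRingEnd ℂ) (cosKer n y) = cosKer n y := by
  rw [cosKer, Complex.conj_ofReal]

theorem coef_conj_cosKer (g : ℝ → ℂ) (n : ℤ) :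
    coef cosKer (fun y => (starRingEnd ℂ) (g y)) n = (starRingEnd ℂ) (coef cosKer g n) := by
  rw [coef, coef, ← integral_conj]
  congr 1; ext y
  rw [map_mul, conj_cosKer]

/-- An `H¹₀(I)` function whose sine coefficients `c_n` satisfy `∑ |λ_n² c_n|² < ∞` is in `H²(I)`. -/
theorem IsH10.exists_hasH1Deriv {u p : ℝ → ℂ} (h : IsH10 u p)
    (hs : MemLp (fun n => (wave n : ℂ) ^ 2 * coef sinKer u n) 2 Measure.count) :
    ∃ r, HasH1Deriv p r ∧
      nsq r ≤ 1 / 2 * ∫ n, ‖(wave n : ℂ) ^ 2 * coef sinKer u n‖ ^ 2 ∂Measure.count := by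
  obtain ⟨r, hr, hn, hi⟩ := isParsevalFrame_sinKer.exists_synthesis zero_le_two (memLp_conj hs)
  refine ⟨fun y => (-(1 / 2) : ℂ) * (starRingEnd ℂ) (r y),
    ⟨h.memLp_deriv, (memLp_conj hr).const_mul _, fun φ h1 h2 h3 => ?_⟩, ?_⟩
  · have hb : ∀ y, y ∉ Set.Ioo (-1 : ℝ) 1 → φ y = 0 := fun y hy =>
      image_eq_zero_of_notMem_tsupport fun h => hy (h3 h)
    have hφ := isH10_of_contDiff (h1.of_le (by exact_mod_cast le_top)) (hb _ (by simp))
      (hb _ (by simp))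
    have e1 := isParsevalFrame_cosKer.inner (memLp_conj hφ.memLp_deriv) h.memLp_deriv
    have e2 := hi φ hφ.memLp
    simp only [Complex.conj_conj] at e1 e2
    have e3 : ∫ n, (starRingEnd ℂ) (coef cosKer (fun y => (starRingEnd ℂ) (deriv φ y)) n)
        * coef cosKer p n ∂Measure.count
        = ∫ n, (wave n : ℂ) ^ 2 * coef sinKer u n * coef sinKer φ n ∂Measure.count := by
      congr 1; ext n
      rw [coef_conj_cosKer, Complex.conj_conj, h.coef_cosKer, hφ.coef_cosKer]
      ring
    have e4 : ∀ y, (-(1 / 2) : ℂ) * (starRingEnd ℂ) (r y) * φ y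
      = (-(1 / 2) : ℂ) * ((starRingEnd ℂ) (r y) * φ y) := fun y => mul_assoc _ _ _
    have e5 : ∀ y, p y * deriv φ y = deriv φ y * p y := fun y => mul_comm _ _
    simp only [e4, e5]
    rw [integral_const_mul, e2, ← e3, e1]
    push_cast
    ring
  · have e : nsq (fun y => (-(1 / 2) : ℂ) * (starRingEnd ℂ) (r y)) = 1 / 4 * nsq r := by
      rw [nsq, nsq, ← integral_const_mul]
      congr 1; ext y
      rw [norm_mul, Complex.norm_conj, norm_neg, mul_pow]
      norm_num
    simp only [Complex.norm_conj] at hn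
    rw [e]
    linarith

/-- The weak derivative of a Borel family of functions can be chosen as a Borel family: by Lebesgue's
theorem, it is almost everywhere the limit of difference quotients. -/
theorem exists_measurable_weak_deriv {p : ℝ → ℝ → ℂ} (hp : Measurable (Function.uncurry p)) :
    ∃ W : ℝ → ℝ → ℂ, Measurable (Function.uncurry W) ∧
      ∀ t r, HasH1Deriv (p t) r → W t =ᵐ[volI] r := by
  set D : ℕ → ℝ × ℝ → ℂ := fun n q =>
    ((n : ℂ) + 1) * (p q.1 (q.2 + 1 / ((n : ℝ) + 1)) - p q.1 q.2) with hD
  have hDm : ∀ n, Measurable (D n) := fun n =>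
    ((hp.comp (f := fun q : ℝ × ℝ => (q.1, q.2 + 1 / ((n : ℝ) + 1))) (by fun_prop)).sub
      hp).const_mul _
  refine ⟨fun t y => ((Filter.limsup (fun n => (D n (t, y)).re) Filter.atTop : ℝ) : ℂ)
    + ((Filter.limsup (fun n => (D n (t, y)).im) Filter.atTop : ℝ) : ℂ) * Complex.I, ?_, ?_⟩
  · refine (Complex.measurable_ofReal.comp ?_).add
      ((Complex.measurable_ofReal.comp ?_).mul_const _)
    · exact Measurable.limsup fun n => Complex.measurable_re.comp (hDm n)
    · exact Measurable.limsup fun n => Complex.measurable_im.comp (hDm n)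
  intro t r hr
  obtain ⟨C, hC⟩ := hr.exists_primitive
  have hri := intervalIntegrable_of_volI (memLp_integrable hr.2.1)
  have hd := hri.ae_hasDerivAt_integral
  have hg : ∀ᵐ y, y ∈ Set.Ioo (-1 : ℝ) 1 → p t y = C + ∫ s in (-1 : ℝ)..y, r s :=
    (ae_restrict_iff' measurableSet_Ioo).mp hC
  have hg' : ∀ᵐ y, ∀ n : ℕ, y + 1 / ((n : ℝ) + 1) ∈ Set.Ioo (-1 : ℝ) 1 →
      p t (y + 1 / ((n : ℝ) + 1)) = C + ∫ s in (-1 : ℝ)..(y + 1 / ((n : ℝ) + 1)), r s :=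
    ae_all_iff.mpr fun n =>
      (measurePreserving_add_right volume (1 / ((n : ℝ) + 1))).quasiMeasurePreserving.ae hg
  have hmem : ∀ᵐ y ∂volI, y ∈ Set.Ioo (-1 : ℝ) 1 := ae_volI_mem
  filter_upwards [hmem, ae_restrict_of_ae hd, hC, ae_restrict_of_ae hg'] with y hy h1 h2 h3
  rw [Set.uIcc_of_le (by norm_num)] at h1
  have h4 := (h1 ⟨hy.1.le, hy.2.le⟩ (-1) ⟨le_rfl, by norm_num⟩).tendsto_slope_zero
  have hseq : Filter.Tendsto (fun n : ℕ => 1 / ((n : ℝ) + 1)) Filter.atTop (nhdsWithin 0 {0}ᶜ) :=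
    tendsto_nhdsWithin_iff.mpr ⟨tendsto_one_div_add_atTop_nhds_zero_nat,
      Filter.Eventually.of_forall fun n => by
        simp only [Set.mem_compl_iff, Set.mem_singleton_iff]; positivity⟩
  have h5 : Filter.Tendsto (fun n => D n (t, y)) Filter.atTop (nhds (r y)) := by
    refine (h4.comp hseq).congr' ?_
    have hsmall : ∀ᶠ n : ℕ in Filter.atTop, 1 / ((n : ℝ) + 1) < 1 - y :=
      tendsto_one_div_add_atTop_nhds_zero_nat.eventually (gt_mem_nhds (by linarith [hy.2]))
    filter_upwards [hsmall] with n hn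
    have hpos : 0 < 1 / ((n : ℝ) + 1) := by positivity
    simp only [hD, Function.comp]
    rw [h3 n ⟨by linarith [hy.1], by linarith⟩, h2, one_div, inv_inv, Complex.real_smul]
    push_cast
    ring
  have hre := ((Complex.continuous_re.tendsto _).comp h5).limsup_eq
  have him := ((Complex.continuous_im.tendsto _).comp h5).limsup_eq
  simp only [Function.comp_def] at hre him
  rw [hre, him, Complex.re_add_im]

/-! ### The `H¹` estimate -/

/-- The derivative of the `H¹₀` part `w = (b - iky)v - f₄` of the force, where `p = ∂_y v`. -/
def shearDeriv (b k : ℝ) (v p f₄' : ℝ → ℂ) (y : ℝ) : ℂ :=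
  b * p y - f₄' y - Complex.I * k * (v y + y * p y)

theorem memLp_coord_mul {f : ℝ → ℂ} (hf : MemLp f 2 volI) :
    MemLp (fun y : ℝ => (y : ℂ) * f y) 2 volI := by
  refine hf.of_le_mul (c := 1) ((Complex.measurable_ofReal.aestronglyMeasurable).mul hf.1) ?_
  filter_upwards [ae_volI_mem] with y hy
  rw [norm_mul, Complex.norm_real, Real.norm_eq_abs]
  gcongr
  exact abs_le.mpr ⟨hy.1.le, hy.2.le⟩

theorem memLp_shearDeriv {b k : ℝ} {v p f₄' : ℝ → ℂ} (hv : MemLp v 2 volI) (hp : MemLp p 2 volI)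
    (hf₄' : MemLp f₄' 2 volI) : MemLp (shearDeriv b k v p f₄') 2 volI := by
  exact ((hp.const_mul _).sub hf₄').sub ((hv.add (memLp_coord_mul hp)).const_mul _)

/-- The multiplication by `y` does not spoil the boundary condition. -/
theorem IsH10.wave_mul_coef_sinKer_mul {u p : ℝ → ℂ} (h : IsH10 u p) (n : ℤ) :
    wave n * coef sinKer (fun y => y * u y) n = coef cosKer (fun y => u y + y * p y) n := by
  have hC := isParsevalFrame_cosKer
  have hd : ∀ y : ℝ, HasDerivAt (fun y : ℝ => (y : ℂ) * cosKer n y)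
      (cosKer n y - wave n * (y * sinKer n y)) y := fun y => by
    refine ((hasDerivAt_id' y).ofReal_comp.mul (hasDerivAt_cosKer n y)).congr_deriv ?_
    push_cast; ring
  have hcd : ContDiff ℝ 1 (fun y : ℝ => (y : ℂ) * cosKer n y) :=
    Complex.ofRealCLM.contDiff.mul ((contDiff_cosKer n).of_le (by exact_mod_cast le_top))
  have hy := fun {f : ℝ → ℂ} => memLp_coord_mul (f := f)
  have key := h.integral_mul_deriv hcd
  rw [show deriv (fun y : ℝ => (y : ℂ) * cosKer n y)
    = fun y : ℝ => cosKer n y - wave n * (y * sinKer n y) from funext fun y => (hd y).deriv] at key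
  have i1 := hC.integrable h.memLp n
  have i2 := isParsevalFrame_sinKer.integrable (hy h.memLp) n
  have i3 := hC.integrable (hy h.memLp_deriv) n
  have e1 : ∫ y : ℝ, u y * (cosKer n y - wave n * (y * sinKer n y)) ∂volI
      = (∫ y, u y * cosKer n y ∂volI) - wave n * ∫ y : ℝ, (y : ℂ) * u y * sinKer n y ∂volI := by
    rw [← integral_const_mul, ← integral_sub i1 (i2.const_mul _)]
    congr 1; ext y; ring
  have e2 : ∫ y : ℝ, p y * ((y : ℂ) * cosKer n y) ∂volI
      = ∫ y : ℝ, (y : ℂ) * p y * cosKer n y ∂volI := by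
    congr 1; ext y; ring
  rw [e1, e2] at key
  rw [hC.coef_add h.memLp (hy h.memLp_deriv), coef, coef, coef]
  linear_combination -key

section rate
variable {ν η b k : ℝ} {v p g f₂ f₂' f₄ f₄' : ℝ → ℂ}

/-- The equation for the sine coefficients of the solution, multiplied by the wave number. -/
theorem wave_mul_rate_eq (hv : IsH10 v p) (hg : MemLp g 2 volI) (hf₂ : HasH1Deriv f₂ f₂')
    (hf₄ : IsH10 f₄ f₄') (n : ℤ) :
    wave n * (coef sinKer (shearForce (ν * η ^ 2 - b) k g f₄ v) n
        + wave n * coef cosKer (fun y => f₂ y - ν * p y) n)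
      = wave n * coef sinKer (fun y => -Complex.I * g y - f₂' y) n
        + coef cosKer (shearDeriv b k v p f₄') n
        - ν * (η ^ 2 + wave n ^ 2) * coef cosKer p n := by
  have hS := isParsevalFrame_sinKer
  have hC := isParsevalFrame_cosKer
  have hy := fun {f : ℝ → ℂ} => memLp_coord_mul (f := f)
  have a1 : coef sinKer (shearForce (ν * η ^ 2 - b) k g f₄ v) n
      = -Complex.I * coef sinKer g n + (-1 * coef sinKer f₄ n
        + ((-(ν * η ^ 2 - b) : ℂ) * coef sinKer v n
          + -(Complex.I * k) * coef sinKer (fun y => y * v y) n)) := by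
    rw [← coef_const_mul, ← coef_const_mul, ← coef_const_mul, ← coef_const_mul,
      ← hS.coef_add (hv.memLp.const_mul _) ((hy hv.memLp).const_mul _),
      ← hS.coef_add (hf₄.memLp.const_mul _)
        (memLp_add (hv.memLp.const_mul _) ((hy hv.memLp).const_mul _)),
      ← hS.coef_add (hg.const_mul _) (memLp_add (hf₄.memLp.const_mul _)
        (memLp_add (hv.memLp.const_mul _) ((hy hv.memLp).const_mul _)))]
    congr 1; ext y
    simp only [shearForce]
    push_cast; ring
  have a2 : coef cosKer (fun y => f₂ y - ν * p y) n
      = coef cosKer f₂ n + (-(ν : ℂ)) * coef cosKer p n := by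
    rw [← coef_const_mul, ← hC.coef_add hf₂.1 (hv.memLp_deriv.const_mul _)]
    congr 1; ext y; ring
  have a3 : coef sinKer (fun y => -Complex.I * g y - f₂' y) n
      = -Complex.I * coef sinKer g n + -1 * coef sinKer f₂' n := by
    rw [← coef_const_mul, ← coef_const_mul,
      ← hS.coef_add (hg.const_mul _) (hf₂.2.1.const_mul _)]
    congr 1; ext y; ring
  have a4 : coef cosKer (shearDeriv b k v p f₄') n
      = b * coef cosKer p n + (-1 * coef cosKer f₄' n
        + -(Complex.I * k) * coef cosKer (fun y => v y + y * p y) n) := by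
    have L : MemLp (fun y : ℝ => v y + y * p y) 2 volI := hv.memLp.add (hy hv.memLp_deriv)
    rw [← coef_const_mul, ← coef_const_mul, ← coef_const_mul,
      ← hC.coef_add (hf₄.memLp_deriv.const_mul _) (L.const_mul _),
      ← hC.coef_add (hv.memLp_deriv.const_mul _)
        (memLp_add (hf₄.memLp_deriv.const_mul _) (L.const_mul _))]
    congr 1; ext y
    simp only [shearDeriv]
    ring
  have a5 : wave n * coef cosKer f₂ n = -coef sinKer f₂' n := by
    have := hf₂.integral_mul_deriv ((contDiff_sinKer n).of_le (by exact_mod_cast le_top))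
      (sinKer_neg_one n) (sinKer_one n)
    rw [show deriv (sinKer n) = fun y => wave n * cosKer n y from
      funext fun y => (hasDerivAt_sinKer n y).deriv] at this
    rw [coef, coef, ← this, ← integral_const_mul]
    congr 1; ext y; ring
  have b1 := hv.coef_cosKer n
  have b2 := hf₄.coef_cosKer n
  have b3 := hv.wave_mul_coef_sinKer_mul n
  rw [a1, a2, a3, a4, ← b3, b2, b1]
  linear_combination (wave n : ℂ) * a5

/-- Young's inequality for the pairing of `∂_y v` with the derivative of the force; transport drops
out of the real part except for the commutator `-ik v`. -/
theorem re_inner_shearDeriv_le {κ δ : ℝ} (hk : |k| = κ) (hκ : 0 < κ) (hδ : 0 < δ) (hη : 0 < η)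
    (hν : ν = κ * δ ^ 3) (hv : MemLp v 2 volI) (hp : MemLp p 2 volI) (hf₄' : MemLp f₄' 2 volI) :
    4 * (∫ y, (starRingEnd ℂ) (p y) * shearDeriv b k v p f₄' y ∂volI).re
      ≤ 4 * b * nsq p + ν * η ^ 2 * nsq p
        + (δ ^ 2)⁻¹ * (3 * (ν * nsq p) + 2 * (κ * δ * nsq v)
          + 2 * (κ⁻¹ * (η⁻¹ * nsq f₄'))) := by
  have hw := memLp_shearDeriv (b := b) (k := k) hv hp hf₄'
  have h0 := Complex.reCLM.integral_comp_comm (integrable_conj_mul hp hw)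
  simp only [Complex.reCLM_apply] at h0
  rw [← h0, ← integral_const_mul]
  have ip := integrable_normSq hp
  have iv := integrable_normSq hv
  have i4 := integrable_normSq hf₄'
  have hr : 4 * b * nsq p + ν * η ^ 2 * nsq p
        + (δ ^ 2)⁻¹ * (3 * (ν * nsq p) + 2 * (κ * δ * nsq v)
          + 2 * (κ⁻¹ * (η⁻¹ * nsq f₄')))
      = ∫ y, ((4 * b + ν * η ^ 2 + (δ ^ 2)⁻¹ * (3 * ν)) * ‖p y‖ ^ 2
        + (δ ^ 2)⁻¹ * (2 * (κ * δ)) * ‖v y‖ ^ 2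
        + (δ ^ 2)⁻¹ * (2 * (κ⁻¹ * η⁻¹)) * ‖f₄' y‖ ^ 2) ∂volI := by
    have i12 : Integrable (fun y => (4 * b + ν * η ^ 2 + (δ ^ 2)⁻¹ * (3 * ν)) * ‖p y‖ ^ 2
        + (δ ^ 2)⁻¹ * (2 * (κ * δ)) * ‖v y‖ ^ 2) volI := (ip.const_mul _).add (iv.const_mul _)
    rw [integral_add i12 (i4.const_mul _), integral_add (ip.const_mul _) (iv.const_mul _), integral_const_mul, integral_const_mul,
      integral_const_mul, nsq, nsq, nsq]
    ring
  rw [hr]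
  refine integral_mono ((integrable_conj_mul hp hw).re.const_mul 4)
    (((ip.const_mul _).add (iv.const_mul _)).add (i4.const_mul _)) fun y => ?_
  have e : ((starRingEnd ℂ) (p y) * shearDeriv b k v p f₄' y).re
      = b * ‖p y‖ ^ 2 - ((starRingEnd ℂ) (p y) * f₄' y).re
        + k * ((starRingEnd ℂ) (p y) * v y).im := by
    rw [shearDeriv, Complex.sq_norm, Complex.normSq_apply]
    simp
    ring
  have n1 : -((starRingEnd ℂ) (p y) * f₄' y).re ≤ ‖p y‖ * ‖f₄' y‖ := by
    refine (neg_le_abs _).trans ((Complex.abs_re_le_norm _).trans ?_)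
    rw [norm_mul, Complex.norm_conj]
  have n2 : k * ((starRingEnd ℂ) (p y) * v y).im ≤ κ * (‖p y‖ * ‖v y‖) := by
    refine (le_abs_self _).trans ?_
    rw [abs_mul, hk]
    refine mul_le_mul_of_nonneg_left ((Complex.abs_im_le_norm _).trans ?_) hκ.le
    rw [norm_mul, Complex.norm_conj]
  simp only
  change 4 * ((starRingEnd ℂ) (p y) * shearDeriv b k v p f₄' y).re ≤ _
  rw [e]
  set P := ‖p y‖
  set V := ‖v y‖
  set F := ‖f₄' y‖
  have hq : 4 * (P * F) ≤ 2 * (κ * δ ^ 2 * η) * P ^ 2 + 2 * (κ * δ ^ 2 * η)⁻¹ * F ^ 2 := by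
    have : 0 ≤ 2 * (κ * δ ^ 2 * η)⁻¹ * (κ * δ ^ 2 * η * P - F) ^ 2 := by positivity
    have e : 2 * (κ * δ ^ 2 * η)⁻¹ * (κ * δ ^ 2 * η * P - F) ^ 2
      = 2 * (κ * δ ^ 2 * η) * P ^ 2 + 2 * (κ * δ ^ 2 * η)⁻¹ * F ^ 2 - 4 * (P * F) := by
      field_simp; ring
    linarith
  have hq2 : 4 * (κ * (P * V)) ≤ 2 * κ * δ * P ^ 2 + 2 * κ * δ⁻¹ * V ^ 2 := by
    have : 0 ≤ 2 * κ * δ⁻¹ * (δ * P - V) ^ 2 := by positivity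
    have e : 2 * κ * δ⁻¹ * (δ * P - V) ^ 2
      = 2 * κ * δ * P ^ 2 + 2 * κ * δ⁻¹ * V ^ 2 - 4 * (κ * (P * V)) := by
      field_simp; ring
    linarith
  -- `2κδ²η ≤ κδ(1 + δ²η²)`: the weight for `∂_y f₄` is absorbed by both dissipation terms
  have hq3 : 2 * (κ * δ ^ 2 * η) * P ^ 2 ≤ (κ * δ + ν * η ^ 2) * P ^ 2 := by
    refine mul_le_mul_of_nonneg_right ?_ (sq_nonneg P)
    have : 0 ≤ κ * δ * (1 - δ * η) ^ 2 := by positivity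
    rw [hν]
    nlinarith
  have f1 : (δ ^ 2)⁻¹ * (3 * ν) = 3 * κ * δ := by rw [hν]; field_simp
  have f2 : (δ ^ 2)⁻¹ * (2 * (κ * δ)) = 2 * κ * δ⁻¹ := by field_simp
  have f3 : (δ ^ 2)⁻¹ * (2 * (κ⁻¹ * η⁻¹)) = 2 * (κ * δ ^ 2 * η)⁻¹ := by field_simp
  rw [f1, f2, f3]
  linarith

end rate

section second
variable {τ ν η b k : ℝ} {v₀ v₀' : ℝ → ℂ} {v p g f₂ f₂' f₄ f₄' : ℝ → ℝ → ℂ}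

/-- The `ℓ²` sum `∑ |λ_n² c_n|²` over the sine coefficients `c_n` of `u`, twice the square of
`‖∂_y² u‖`. -/
def sineH2 (u : ℝ → ℂ) : ℝ := ∫ n, ‖(wave n : ℂ) ^ 2 * coef sinKer u n‖ ^ 2 ∂Measure.count

theorem L2Q.shearDeriv {b k : ℝ} (hv : L2Q τ v) (hp : L2Q τ p) (hf : L2Q τ f₄') :
    L2Q τ (fun t => shearDeriv b k (v t) (p t) (f₄' t)) :=
  ((hp.const_mul _).sub hf).sub ((hv.add (hp.mul_space Complex.measurable_ofReal (B := 1)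
    fun y hy => by
      rw [Complex.norm_real, Real.norm_eq_abs]
      exact abs_le.mpr ⟨hy.1.le, hy.2.le⟩)).const_mul _)

theorem L2Q.memLp_coef_mode {F : ℝ → ℝ → ℂ} {ψ : ℤ → ℝ → ℂ} (n : ℤ) (hF : L2Q τ F)
    (hψ : IsParsevalFrame Measure.count ψ 2) : MemLp (fun s => coef ψ (F s) n) 2 (muT τ) := by
  have hm : Measurable (fun s => coef ψ (F s) n) :=
    (hF.measurable_coef hψ).comp measurable_prodMk_right
  rw [← memLp_norm_iff hm.aestronglyMeasurable,
    memLp_two_iff_integrable_sq hm.norm.aestronglyMeasurable]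
  refine (hF.integrable_nsq.const_mul 2).mono' (hm.norm.pow_const 2).aestronglyMeasurable ?_
  filter_upwards [hF.slice] with s hs
  have := integrable_normSq (hψ.memLp _ hs)
  rw [Real.norm_eq_abs, abs_of_nonneg (by positivity), ← hψ.parseval _ hs, integral_countable this]
  simp only [Measure.real, Measure.count_singleton, ENNReal.toReal_one, one_smul]
  rw [integrable_count_iff] at this
  exact this.of_norm.le_tsum n fun _ _ => by positivity

/-- The energy inequality of one Fourier mode, weighted by the square of its wave number. -/
theorem ShearEvolution.mode_le (hν : 0 < ν) (h : ShearEvolution τ ν η k b v₀ v p g f₂ f₄ f₄')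
    (hv₀ : IsH10 v₀ v₀') (hf₂' : L2Q τ f₂') (hf₂ : ∀ᵐ t ∂muT τ, HasH1Deriv (f₂ t) (f₂' t))
    (n : ℤ) :
    ∀ᵐ t ∂muT τ, ‖coef cosKer (p t) n‖ ^ 2 + ∫ s, (ν * ‖(wave n : ℂ) ^ 2 * coef sinKer (v s) n‖ ^ 2
        + 2 * (ν * η ^ 2) * ‖coef cosKer (p s) n‖ ^ 2) ∂muT t
      ≤ ‖coef cosKer v₀' n‖ ^ 2
        + ∫ s, (ν⁻¹ * ‖coef sinKer (fun y => -Complex.I * g s y - f₂' s y) n‖ ^ 2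
          + 2 * ((starRingEnd ℂ) (coef cosKer (p s) n)
            * coef cosKer (shearDeriv b k (v s) (p s) (f₄' s)) n).re) ∂muT t := by
  have hS := isParsevalFrame_sinKer
  have hC := isParsevalFrame_cosKer
  have hev := h.evolution
  have hGa : L2Q τ (fun t y => -Complex.I * g t y - f₂' t y) := (h.g_mem.const_mul _).sub hf₂'
  have hw := L2Q.shearDeriv (b := b) (k := k) hev.v_mem hev.p_mem h.f₄'_mem
  have hode := hev.coef_sinKer n
  have hint : Integrable (fun s => coef sinKer (shearForce (ν * η ^ 2 - b) k (g s) (f₄ s) (v s)) n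
      + wave n * coef cosKer (fun y => f₂ s y - ν * p s y) n) (muT τ) :=
    (integrable_muT_coef hev.G₀_mem hS n).add
    ((integrable_muT_coef hev.G₁_mem hC n).const_mul (wave n : ℂ))
  have hu : ∀ᵐ t ∂muT τ, wave n * coef sinKer (v t) n = wave n * coef sinKer v₀ n
      + ∫ s in (0 : ℝ)..t, wave n * (coef sinKer (shearForce (ν * η ^ 2 - b) k (g s) (f₄ s) (v s)) n
        + wave n * coef cosKer (fun y => f₂ s y - ν * p s y) n) := by
    filter_upwards [hode] with t ht
    rw [ht, intervalIntegral.integral_const_mul, mul_add]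
  have hE := ae_normSq_eq (hint.const_mul (wave n : ℂ)) hu
  have is := integrable_normSq ((L2Q.memLp_coef_mode n hev.v_mem hS).const_mul ((wave n : ℂ) ^ 2))
  have ic := integrable_normSq (L2Q.memLp_coef_mode n hev.p_mem hC)
  have ig := integrable_normSq (L2Q.memLp_coef_mode n hGa hS)
  have iw := (integrable_conj_mul (L2Q.memLp_coef_mode n hev.p_mem hC) (L2Q.memLp_coef_mode n hw hC)).re
  have id := (integrable_conj_mul ((L2Q.memLp_coef_mode n hev.v_mem hS).const_mul ((wave n : ℂ) ^ 2)) (L2Q.memLp_coef_mode n hGa hS)).re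
  have iA : Integrable (fun s => ν * ‖(wave n : ℂ) ^ 2 * coef sinKer (v s) n‖ ^ 2
      + 2 * (ν * η ^ 2) * ‖coef cosKer (p s) n‖ ^ 2) (muT τ) :=
    (is.const_mul ν).add (ic.const_mul (2 * (ν * η ^ 2)))
  have iB := (ig.const_mul ν⁻¹).add (iw.const_mul 2)
  have iX : Integrable (fun s =>
      2 * ((starRingEnd ℂ) ((wave n : ℂ) ^ 2 * coef sinKer (v s) n)
          * coef sinKer (fun y => -Complex.I * g s y - f₂' s y) n).re
        + 2 * ((starRingEnd ℂ) (coef cosKer (p s) n)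
            * coef cosKer (shearDeriv b k (v s) (p s) (f₄' s)) n).re
        - 2 * (ν * ‖(wave n : ℂ) ^ 2 * coef sinKer (v s) n‖ ^ 2
          + ν * η ^ 2 * ‖coef cosKer (p s) n‖ ^ 2)) (muT τ) :=
    ((id.const_mul 2).add (iw.const_mul 2)).sub
      (((is.const_mul ν).add (ic.const_mul (ν * η ^ 2))).const_mul 2)
  have hX : ∀ᵐ s ∂muT τ, 2 * ((starRingEnd ℂ) (wave n * coef sinKer (v s) n)
      * (wave n * (coef sinKer (shearForce (ν * η ^ 2 - b) k (g s) (f₄ s) (v s)) n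
        + wave n * coef cosKer (fun y => f₂ s y - ν * p s y) n))).re
      = 2 * ((starRingEnd ℂ) ((wave n : ℂ) ^ 2 * coef sinKer (v s) n)
          * coef sinKer (fun y => -Complex.I * g s y - f₂' s y) n).re
        + 2 * ((starRingEnd ℂ) (coef cosKer (p s) n)
            * coef cosKer (shearDeriv b k (v s) (p s) (f₄' s)) n).re
        - 2 * (ν * ‖(wave n : ℂ) ^ 2 * coef sinKer (v s) n‖ ^ 2
          + ν * η ^ 2 * ‖coef cosKer (p s) n‖ ^ 2) := by
    filter_upwards [hev.isH10, h.g_mem.slice, hf₂, h.f₄_isH10] with s h1 h2 h3 h4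
    have hq := h1.coef_cosKer n
    rw [wave_mul_rate_eq h1 h2 h3 h4, ← hq]
    set P := coef cosKer (p s) n
    set S := coef sinKer (v s) n
    set G := coef sinKer (fun y => -Complex.I * g s y - f₂' s y) n
    set W := coef cosKer (shearDeriv b k (v s) (p s) (f₄' s)) n
    have hd : (wave n : ℂ) ^ 2 * S = wave n * P := by rw [hq]; ring
    have e : ((starRingEnd ℂ) P * (wave n * G + W - ν * (η ^ 2 + wave n ^ 2) * P)).re
        = ((starRingEnd ℂ) ((wave n : ℂ) ^ 2 * S) * G).re + ((starRingEnd ℂ) P * W).re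
          - ν * η ^ 2 * ‖P‖ ^ 2 - ν * ‖(wave n : ℂ) ^ 2 * S‖ ^ 2 := by
      rw [hd, norm_mul, mul_pow, Complex.sq_norm P, Complex.normSq_apply, Complex.norm_real,
        Real.norm_eq_abs, sq_abs]
      have : (ν : ℂ) * (η ^ 2 + wave n ^ 2) = ((ν * (η ^ 2 + wave n ^ 2) : ℝ) : ℂ) := by
        push_cast; ring
      rw [this]
      simp only [Complex.mul_re, Complex.conj_re, Complex.conj_im, Complex.add_re, Complex.sub_re,
        Complex.add_im, Complex.sub_im, Complex.mul_im, Complex.ofReal_re, Complex.ofReal_im,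
        map_mul, Complex.conj_ofReal]
      ring
    rw [e]; ring
  filter_upwards [hE, hev.isH10, ae_muT_mem τ] with t ht hH htτ
  have hle := muT_mono htτ.2.le
  rw [← hH.coef_cosKer, ← hv₀.coef_cosKer, intervalIntegral_eq_muT htτ.1.le] at ht
  rw [ht, add_assoc]
  refine add_le_add le_rfl ?_
  rw [integral_congr_ae (ae_mono hle hX),
    ← integral_add (iX.mono_measure hle) (iA.mono_measure hle)]
  refine integral_mono ((iX.add iA).mono_measure hle) (iB.mono_measure hle) fun s => ?_
  simp only
  change _ ≤ ν⁻¹ * ‖coef sinKer (fun y => -Complex.I * g s y - f₂' s y) n‖ ^ 2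
    + 2 * ((starRingEnd ℂ) (coef cosKer (p s) n)
      * coef cosKer (shearDeriv b k (v s) (p s) (f₄' s)) n).re
  have n1 : ((starRingEnd ℂ) ((wave n : ℂ) ^ 2 * coef sinKer (v s) n)
      * coef sinKer (fun y => -Complex.I * g s y - f₂' s y) n).re
      ≤ ‖(wave n : ℂ) ^ 2 * coef sinKer (v s) n‖
        * ‖coef sinKer (fun y => -Complex.I * g s y - f₂' s y) n‖ := by
    refine (Complex.re_le_norm _).trans ?_
    rw [norm_mul, Complex.norm_conj]
  set D := ‖(wave n : ℂ) ^ 2 * coef sinKer (v s) n‖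
  set G := ‖coef sinKer (fun y => -Complex.I * g s y - f₂' s y) n‖
  have : 0 ≤ ν⁻¹ * (ν * D - G) ^ 2 := by positivity
  have e2 : ν⁻¹ * (ν * D - G) ^ 2 = ν * D ^ 2 + ν⁻¹ * G ^ 2 - 2 * (D * G) := by
    field_simp; ring
  linarith

/-- The `H¹` energy inequality, obtained by summing over the Fourier modes; it contains the
`L²(H²)` regularity of the solution. -/
theorem ShearEvolution.h1_energy_le (hν : 0 < ν)
    (h : ShearEvolution τ ν η k b v₀ v p g f₂ f₄ f₄') (hv₀ : IsH10 v₀ v₀') (hf₂' : L2Q τ f₂')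
    (hf₂ : ∀ᵐ t ∂muT τ, HasH1Deriv (f₂ t) (f₂' t)) :
    ∀ᵐ t ∂muT τ,
      (∀ᵐ s ∂muT t, MemLp (fun n => (wave n : ℂ) ^ 2 * coef sinKer (v s) n) 2 Measure.count) ∧
      Integrable (fun s => sineH2 (v s)) (muT t) ∧
      2 * nsq (p t) + ∫ s, (ν * sineH2 (v s) + 4 * (ν * η ^ 2) * nsq (p s)) ∂muT t
        ≤ 2 * nsq v₀' + ∫ s, (2 * ν⁻¹ * nsq (fun y => -Complex.I * g s y - f₂' s y)
          + 4 * (∫ y, (starRingEnd ℂ) (p s y)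
            * Couette.shearDeriv b k (v s) (p s) (f₄' s) y ∂volI).re) ∂muT t := by
  have hS := isParsevalFrame_sinKer
  have hC := isParsevalFrame_cosKer
  have hev := h.evolution
  have hGa : L2Q τ (fun t y => -Complex.I * g t y - f₂' t y) := (h.g_mem.const_mul _).sub hf₂'
  have hw := L2Q.shearDeriv (b := b) (k := k) hev.v_mem hev.p_mem h.f₄'_mem
  have hw_meas : Measurable (fun q : ℝ × ℤ => (wave q.2 : ℂ) ^ 2 * coef sinKer (v q.1) q.2) :=
    ((Complex.measurable_ofReal.comp ((measurable_of_countable wave).comp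
      measurable_snd)).pow_const 2).mul (hev.v_mem.measurable_coef hS)
  have iP0 := integrable_normSq (hev.p_mem.memLp_coef hC)
  have iG0 := integrable_normSq (hGa.memLp_coef hS)
  have iW0 := (integrable_conj_mul (hev.p_mem.memLp_coef hC) (hw.memLp_coef hC)).re
  filter_upwards [ae_all_iff.mpr (h.mode_le hν hv₀ hf₂' hf₂), hev.p_mem.slice, ae_muT_mem τ]
    with t ht hpt htτ
  have hle := muT_mono htτ.2.le
  have hlep : (muT t).prod (Measure.count : Measure ℤ) ≤ (muT τ).prod Measure.count :=
    Measure.prod_mono hle le_rfl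
  have iP := iP0.mono_measure hlep
  have iG := iG0.mono_measure hlep
  have iW := iW0.mono_measure hlep
  set A₁ : ℝ × ℤ → ℝ := fun q => ‖(wave q.2 : ℂ) ^ 2 * coef sinKer (v q.1) q.2‖ ^ 2 with hA₁
  set A : ℝ × ℤ → ℝ := fun q => ν * A₁ q
    + 2 * (ν * η ^ 2) * ‖coef cosKer (p q.1) q.2‖ ^ 2 with hA
  set B : ℝ × ℤ → ℝ := fun q =>
    ν⁻¹ * ‖coef sinKer (fun y => -Complex.I * g q.1 y - f₂' q.1 y) q.2‖ ^ 2
      + 2 * ((starRingEnd ℂ) (coef cosKer (p q.1) q.2)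
        * coef cosKer (Couette.shearDeriv b k (v q.1) (p q.1) (f₄' q.1)) q.2).re with hB
  have iB : Integrable B ((muT t).prod Measure.count) := (iG.const_mul _).add (iW.const_mul 2)
  have iv0 := integrable_normSq (hC.memLp _ hv₀.memLp_deriv)
  have hAm : Measurable A := ((hw_meas.norm.pow_const 2).const_mul ν).add
    (((hev.p_mem.measurable_coef hC).norm.pow_const 2).const_mul _)
  have hA0 : ∀ q, 0 ≤ A q := fun q => by simp only [hA, hA₁]; positivity
  have hAn : ∀ n, 0 ≤ ∫ s, A (s, n) ∂muT t := fun n => integral_nonneg fun s => hA0 _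
  have hmode : ∀ n, ‖coef cosKer (p t) n‖ ^ 2 + ∫ s, A (s, n) ∂muT t
      ≤ ‖coef cosKer v₀' n‖ ^ 2 + ∫ s, B (s, n) ∂muT t := ht
  have iR : Integrable (fun n => ‖coef cosKer v₀' n‖ ^ 2 + ∫ s, B (s, n) ∂muT t)
      Measure.count := iv0.add iB.integral_prod_right
  have iAn : Integrable (fun n => ∫ s, A (s, n) ∂muT t) Measure.count := by
    refine iR.mono' (measurable_of_countable _).aestronglyMeasurable
      (Filter.Eventually.of_forall fun n => ?_)
    rw [Real.norm_eq_abs, abs_of_nonneg (hAn n)]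
    have : 0 ≤ ‖coef cosKer (p t) n‖ ^ 2 := by positivity
    linarith [hmode n]
  have iA : Integrable A ((muT t).prod Measure.count) := by
    rw [integrable_prod_iff' hAm.aestronglyMeasurable]
    refine ⟨Filter.Eventually.of_forall fun n => ?_, ?_⟩
    · exact ((integrable_normSq ((L2Q.memLp_coef_mode n hev.v_mem hS).const_mul
        ((wave n : ℂ) ^ 2))).const_mul ν |>.add ((integrable_normSq
        (L2Q.memLp_coef_mode n hev.p_mem hC)).const_mul (2 * (ν * η ^ 2)))).mono_measure hle
    · simpa only [Real.norm_eq_abs, abs_of_nonneg (hA0 _)] using iAn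
  have iA₁ : Integrable A₁ ((muT t).prod Measure.count) := by
    have := (iA.sub (iP.const_mul (2 * (ν * η ^ 2)))).const_mul ν⁻¹
    refine this.congr (Filter.Eventually.of_forall fun q => ?_)
    simp only [hA, Pi.sub_apply, Function.uncurry]
    field_simp
    ring
  have hsum := integral_mono
    ((integrable_normSq (hC.memLp _ hpt)).add iAn) iR hmode
  simp only [Pi.add_apply] at hsum
  rw [integral_add (integrable_normSq (hC.memLp _ hpt)) iAn, integral_add iv0
    iB.integral_prod_right, hC.parseval _ hpt, hC.parseval _ hv₀.memLp_deriv,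
    ← integral_prod_symm _ iA, ← integral_prod_symm _ iB, integral_prod _ iA,
    integral_prod _ iB] at hsum
  refine ⟨?_, iA₁.integral_prod_left, ?_⟩
  · filter_upwards [iA₁.prod_right_ae] with s hs
    rw [← memLp_norm_iff (measurable_of_countable _).aestronglyMeasurable,
      memLp_two_iff_integrable_sq (measurable_of_countable _).aestronglyMeasurable]
    exact hs
  · have eA : ∫ s, ∫ n, A (s, n) ∂Measure.count ∂muT t
        = ∫ s, (ν * sineH2 (v s) + 4 * (ν * η ^ 2) * nsq (p s)) ∂muT t := by
      refine integral_congr_ae ?_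
      filter_upwards [iA₁.prod_right_ae, ae_mono hle hev.p_mem.slice] with s h1 h2
      simp only [hA]
      rw [integral_add (h1.const_mul _) ((integrable_normSq (hC.memLp _ h2)).const_mul _),
        integral_const_mul, integral_const_mul, hC.parseval _ h2, sineH2]
      ring
    have eB : ∫ s, ∫ n, B (s, n) ∂Measure.count ∂muT t
        = ∫ s, (2 * ν⁻¹ * nsq (fun y => -Complex.I * g s y - f₂' s y)
          + 4 * (∫ y, (starRingEnd ℂ) (p s y)
            * Couette.shearDeriv b k (v s) (p s) (f₄' s) y ∂volI).re) ∂muT t := by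
      refine integral_congr_ae ?_
      filter_upwards [ae_mono hle hGa.slice, ae_mono hle hev.p_mem.slice,
        ae_mono hle hw.slice] with s h1 h2 h3
      simp only [hB]
      have i3 := integrable_conj_mul (hC.memLp _ h2) (hC.memLp _ h3)
      have hre := Complex.reCLM.integral_comp_comm i3
      simp only [Complex.reCLM_apply] at hre
      have i3r : Integrable (fun n => ((starRingEnd ℂ) (coef cosKer (p s) n)
        * coef cosKer (Couette.shearDeriv b k (v s) (p s) (f₄' s)) n).re) Measure.count := i3.re
      rw [integral_add ((integrable_normSq (hS.memLp _ h1)).const_mul _) (i3r.const_mul 2),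
        integral_const_mul, integral_const_mul, hS.parseval _ h1, hre, hC.inner h2 h3, Complex.re_ofReal_mul]
      ring
    rw [eA, eB] at hsum
    linarith

end second

theorem nsq_force_le {g f : ℝ → ℂ} (hg : MemLp g 2 volI) (hf : MemLp f 2 volI) :
    nsq (fun y => -Complex.I * g y - f y) ≤ 2 * nsq g + 2 * nsq f := by
  have h : nsq (fun y => -Complex.I * g y + -f y)
      ≤ 2 * nsq (fun y => -Complex.I * g y) + 2 * nsq (fun y => -f y) :=
    integral_normSq_add_le (hg.const_mul _) hf.neg
  have e : nsq (fun y => -f y) = nsq f := by simp [nsq]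
  rw [nsq_neg_I_mul, e] at h
  simpa only [sub_eq_add_neg] using h

/-- The estimate in `L^∞H¹ ∩ L²H²`, given the dissipation estimate with weight `μ = κδ` for the
force `g`.  The family `W` selects the second derivatives. -/
theorem ShearEvolution.h1_estimate {τ ν η κ δ k b C : ℝ} {v₀ v₀' : ℝ → ℂ}
    {v p g f₂ f₂' f₄ f₄' W : ℝ → ℝ → ℂ} (hδ : 0 < δ) (hκ : 0 < κ) (hk : |k| = κ)
    (hν : ν = κ * δ ^ 3) (hη : 0 < η) (hC : 0 ≤ C) (hb : b ≤ κ * δ)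
    (h : ShearEvolution τ ν η k b v₀ v p g f₂ f₄ f₄') (hv₀ : IsH10 v₀ v₀') (hf₂' : L2Q τ f₂')
    (hf₂ : ∀ᵐ t ∂muT τ, HasH1Deriv (f₂ t) (f₂' t)) (hW : Measurable (Function.uncurry W))
    (hWp : ∀ t r, HasH1Deriv (p t) r → W t =ᵐ[volI] r)
    (hE : ∀ᵐ t ∂muT τ, nsq (v t) + ∫ s in (0 : ℝ)..t, dissipation ν κ δ η (v s) (p s)
        ≤ C * (nsq v₀
          + ∫ s in (0 : ℝ)..t, dataSize ν κ η (κ * δ) (g s) (f₂ s) (f₄ s) (f₄' s))) :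
    ∀ᵐ t ∂muT τ, L2Q t W ∧ (∀ᵐ s ∂muT t, HasH1Deriv (p s) (W s)) ∧
      nsq (p t) + ∫ s in (0 : ℝ)..t, (ν * nsq (W s) + ν * η ^ 2 * nsq (p s))
        ≤ nsq v₀' + (7 * C + 2) * (δ ^ 2)⁻¹ * (nsq v₀
            + ∫ s in (0 : ℝ)..t, dataSize ν κ η (κ * δ) (g s) (f₂ s) (f₄ s) (f₄' s))
          + 2 * ν⁻¹ * ∫ s in (0 : ℝ)..t, (nsq (g s) + nsq (f₂' s)) := by
  have hν0 : 0 < ν := by rw [hν]; positivity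
  have hev := h.evolution
  have iD := integrable_dissipation hev.v_mem hev.p_mem ν κ δ η
  have iR := integrable_dataSize h.g_mem h.f₂_mem h.f₄_mem h.f₄'_mem ν κ η (κ * δ)
  have iF : Integrable (fun s => nsq (g s) + nsq (f₂' s)) (muT τ) :=
    h.g_mem.integrable_nsq.add hf₂'.integrable_nsq
  have iP := hev.p_mem.integrable_nsq
  have hGa : L2Q τ (fun t y => -Complex.I * g t y - f₂' t y) := (h.g_mem.const_mul _).sub hf₂'
  have hw := L2Q.shearDeriv (b := b) (k := k) hev.v_mem hev.p_mem h.f₄'_mem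
  have iG := hGa.integrable_nsq
  have iw : Integrable (fun s => (∫ y, (starRingEnd ℂ) (p s y)
      * shearDeriv b k (v s) (p s) (f₄' s) y ∂volI).re) (muT τ) :=
    (hev.p_mem.integrable_pairing hw).re
  have hpt : ∀ᵐ s ∂muT τ, 2 * ν⁻¹ * nsq (fun y => -Complex.I * g s y - f₂' s y)
      + 4 * (∫ y, (starRingEnd ℂ) (p s y) * shearDeriv b k (v s) (p s) (f₄' s) y ∂volI).re
      ≤ ν * η ^ 2 * nsq (p s) + ((δ ^ 2)⁻¹ * 7 * dissipation ν κ δ η (v s) (p s)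
        + (δ ^ 2)⁻¹ * 2 * dataSize ν κ η (κ * δ) (g s) (f₂ s) (f₄ s) (f₄' s))
        + 4 * ν⁻¹ * (nsq (g s) + nsq (f₂' s)) := by
    filter_upwards [hev.v_mem.slice, hev.p_mem.slice, h.g_mem.slice, hf₂'.slice,
      h.f₄'_mem.slice] with s h1 h2 h3 h4 h5
    have a1 := nsq_force_le h3 h4
    have a2 := re_inner_shearDeriv_le (b := b) (k := k) hk hκ hδ hη hν h1 h2 h5
    have V0 := nsq_nonneg (v s)
    have P0 := nsq_nonneg (p s)
    have G0 := nsq_nonneg (g s)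
    have F0 := nsq_nonneg (f₂ s)
    have F4 := nsq_nonneg (f₄ s)
    have F4' := nsq_nonneg (f₄' s)
    have a3 : 2 * ν⁻¹ * nsq (fun y => -Complex.I * g s y - f₂' s y)
        ≤ 2 * ν⁻¹ * (2 * nsq (g s) + 2 * nsq (f₂' s)) := by gcongr
    have a4 : 4 * b * nsq (p s) ≤ (δ ^ 2)⁻¹ * 4 * (ν * nsq (p s)) := by
      have : (δ ^ 2)⁻¹ * 4 * (ν * nsq (p s)) = 4 * (κ * δ) * nsq (p s) := by
        rw [hν]; field_simp
      rw [this]; gcongr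
    have a5 : (δ ^ 2)⁻¹ * 7 * dissipation ν κ δ η (v s) (p s)
        = (δ ^ 2)⁻¹ * 7 * (ν * nsq (p s)) + (δ ^ 2)⁻¹ * 7 * (κ * δ * nsq (v s))
          + (δ ^ 2)⁻¹ * 7 * (ν * η ^ 2 * nsq (v s)) := by rw [dissipation]; ring
    have a6 : (δ ^ 2)⁻¹ * 2 * dataSize ν κ η (κ * δ) (g s) (f₂ s) (f₄ s) (f₄' s)
        = (δ ^ 2)⁻¹ * 2 * (κ⁻¹ * (η⁻¹ * nsq (f₄' s))) + (δ ^ 2)⁻¹ * 2 * (ν⁻¹ * nsq (f₂ s))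
          + (δ ^ 2)⁻¹ * 2 * (κ⁻¹ * (η * nsq (f₄ s))) + (δ ^ 2)⁻¹ * 2 * ((κ * δ)⁻¹ * nsq (g s)) := by
      rw [dataSize]; ring
    have b1 : 0 ≤ (δ ^ 2)⁻¹ * (κ * δ * nsq (v s)) := by positivity
    have b2 : 0 ≤ (δ ^ 2)⁻¹ * (ν * η ^ 2 * nsq (v s)) := by positivity
    have b3 : 0 ≤ (δ ^ 2)⁻¹ * (ν⁻¹ * nsq (f₂ s)) := by positivity
    have b4 : 0 ≤ (δ ^ 2)⁻¹ * (κ⁻¹ * (η * nsq (f₄ s))) := by positivity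
    have b5 : 0 ≤ (δ ^ 2)⁻¹ * ((κ * δ)⁻¹ * nsq (g s)) := by positivity
    rw [a5, a6]
    linarith
  filter_upwards [h.h1_energy_le hν0 hv₀ hf₂' hf₂, hE, ae_muT_mem τ, hev.v_mem.slice]
    with t ht hEt htτ hvt
  obtain ⟨m1, m2, m3⟩ := ht
  have hle := muT_mono htτ.2.le
  have hreg : ∀ᵐ s ∂muT t, HasH1Deriv (p s) (W s) ∧ nsq (W s) ≤ 1 / 2 * sineH2 (v s) := by
    filter_upwards [m1, ae_mono hle hev.isH10] with s h1 h2
    obtain ⟨r, hr, hn⟩ := h2.exists_hasH1Deriv h1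
    have hWr := hWp s r hr
    refine ⟨⟨hr.1, hr.2.1.ae_eq hWr.symm, fun φ c1 c2 c3 => ?_⟩, ?_⟩
    · rw [hr.2.2 φ c1 c2 c3]
      congr 1
      exact integral_congr_ae (hWr.mono fun y hy => by simp only [hy])
    · rw [nsq_congr hWr]; exact hn
  have hWm : ∀ s, Measurable (W s) := fun s => hW.comp measurable_prodMk_left
  have hWL : L2Q t W := by
    refine ⟨hW, ?_⟩
    rw [← memLp_norm_iff hW.aestronglyMeasurable,
      memLp_two_iff_integrable_sq hW.norm.aestronglyMeasurable,
      integrable_prod_iff (hW.norm.pow_const 2).aestronglyMeasurable]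
    constructor
    · filter_upwards [hreg] with s hs
      exact integrable_normSq hs.1.2.1
    · refine (m2.const_mul (1 / 2)).mono' ?_ ?_
      · refine (StronglyMeasurable.integral_prod_right (f := fun (s y : ℝ) => ‖‖W s y‖ ^ 2‖)
          ?_).aestronglyMeasurable
        exact ((hW.norm.pow_const 2).norm).stronglyMeasurable
      · filter_upwards [hreg] with s hs
        have e : ∫ y, ‖‖Function.uncurry W (s, y)‖ ^ 2‖ ∂volI = nsq (W s) := by simp [nsq]
        rw [e, Real.norm_eq_abs, abs_of_nonneg (nsq_nonneg _)]
        exact hs.2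
  refine ⟨hWL, hreg.mono fun s hs => hs.1, ?_⟩
  rw [intervalIntegral_eq_muT htτ.1.le] at hEt ⊢
  rw [intervalIntegral_eq_muT htτ.1.le] at hEt ⊢
  rw [intervalIntegral_eq_muT htτ.1.le]
  have iP' := iP.mono_measure hle
  have iD' := iD.mono_measure hle
  have iR' := iR.mono_measure hle
  have iF' := iF.mono_measure hle
  have iW' := hWL.integrable_nsq
  have k1 : ∫ s, (2 * (ν * nsq (W s) + ν * η ^ 2 * nsq (p s))
      + 2 * (ν * η ^ 2) * nsq (p s)) ∂muT t
      ≤ ∫ s, (ν * sineH2 (v s) + 4 * (ν * η ^ 2) * nsq (p s)) ∂muT t := by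
    refine integral_mono_ae ((((iW'.const_mul ν).add (iP'.const_mul _)).const_mul 2).add
      (iP'.const_mul _)) ((m2.const_mul ν).add (iP'.const_mul _)) ?_
    filter_upwards [hreg] with s hs
    have := mul_le_mul_of_nonneg_left hs.2 hν0.le
    linarith
  have iWP : Integrable (fun s => ν * nsq (W s) + ν * η ^ 2 * nsq (p s)) (muT t) :=
    (iW'.const_mul ν).add (iP'.const_mul _)
  rw [integral_add (iWP.const_mul 2) (iP'.const_mul _), integral_const_mul,
    integral_const_mul] at k1
  have iDR : Integrable (fun s => (δ ^ 2)⁻¹ * 7 * dissipation ν κ δ η (v s) (p s)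
        + (δ ^ 2)⁻¹ * 2 * dataSize ν κ η (κ * δ) (g s) (f₂ s) (f₄ s) (f₄' s)) (muT t) :=
    (iD'.const_mul _).add (iR'.const_mul _)
  have iPDR : Integrable (fun s => ν * η ^ 2 * nsq (p s)
        + ((δ ^ 2)⁻¹ * 7 * dissipation ν κ δ η (v s) (p s)
        + (δ ^ 2)⁻¹ * 2 * dataSize ν κ η (κ * δ) (g s) (f₂ s) (f₄ s) (f₄' s))) (muT t) :=
    (iP'.const_mul _).add iDR
  have k2 := integral_mono_ae (((iG.const_mul (2 * ν⁻¹)).add (iw.const_mul 4)).mono_measure hle)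
    (iPDR.add (iF'.const_mul (4 * ν⁻¹))) (ae_mono hle hpt)
  have k3 : ∫ s, (ν * η ^ 2 * nsq (p s)
        + ((δ ^ 2)⁻¹ * 7 * dissipation ν κ δ η (v s) (p s)
        + (δ ^ 2)⁻¹ * 2 * dataSize ν κ η (κ * δ) (g s) (f₂ s) (f₄ s) (f₄' s))
        + 4 * ν⁻¹ * (nsq (g s) + nsq (f₂' s))) ∂muT t
      = ν * η ^ 2 * (∫ s, nsq (p s) ∂muT t)
        + ((δ ^ 2)⁻¹ * 7 * (∫ s, dissipation ν κ δ η (v s) (p s) ∂muT t)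
          + (δ ^ 2)⁻¹ * 2 * ∫ s, dataSize ν κ η (κ * δ) (g s) (f₂ s) (f₄ s) (f₄' s) ∂muT t)
        + 4 * ν⁻¹ * ∫ s, (nsq (g s) + nsq (f₂' s)) ∂muT t := by
    rw [integral_add iPDR (iF'.const_mul _), integral_add (iP'.const_mul _) iDR,
      integral_add (iD'.const_mul _) (iR'.const_mul _)]
    simp only [integral_const_mul]
  have k4 := k2.trans_eq k3
  simp only [Pi.add_apply] at k4
  have hP0 : 0 ≤ ν * η ^ 2 * ∫ s, nsq (p s) ∂muT t :=
    mul_nonneg (by positivity) (integral_nonneg fun s => nsq_nonneg _)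
  have hR0 : 0 ≤ ∫ s, dataSize ν κ η (κ * δ) (g s) (f₂ s) (f₄ s) (f₄' s) ∂muT t :=
    integral_nonneg fun s => dataSize_nonneg hν0 hκ hη (by positivity) _ _ _ _
  have hv0 := nsq_nonneg v₀
  have hvt0 := nsq_nonneg (v t)
  set R := ∫ s, dataSize ν κ η (κ * δ) (g s) (f₂ s) (f₄ s) (f₄' s) ∂muT t
  set D := ∫ s, dissipation ν κ δ η (v s) (p s) ∂muT t
  have k5 : (δ ^ 2)⁻¹ * 7 * D ≤ (δ ^ 2)⁻¹ * 7 * (C * (nsq v₀ + R)) := by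
    gcongr; linarith
  have k6 : 0 ≤ (7 * C + 2) * (δ ^ 2)⁻¹ * (nsq v₀ + R) := by positivity
  have k7 : 0 ≤ (δ ^ 2)⁻¹ * nsq v₀ := by positivity
  have k8 : (7 * C + 2) * (δ ^ 2)⁻¹ * (nsq v₀ + R)
    = (δ ^ 2)⁻¹ * 7 * (C * (nsq v₀ + R)) + (δ ^ 2)⁻¹ * 2 * R + 2 * ((δ ^ 2)⁻¹ * nsq v₀) := by ring
  linarith

/-! ### From weak solutions to evolutions -/

/-- A weak formulation in time with test functions that do not vanish at `t = 0` determines the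
initial value. -/
theorem ae_eq_init_add_primitive {τ : ℝ} (hτ : 0 < τ) {c h : ℝ → ℂ} {c₀ : ℂ}
    (hc : Integrable c (muT τ)) (hh : Integrable h (muT τ))
    (H : ∀ θ : ℝ → ℝ, ContDiff ℝ (⊤ : ℕ∞) θ → HasCompactSupport θ → tsupport θ ⊆ Set.Iio τ →
      ∫ t, c t * ((deriv θ t : ℝ) : ℂ) ∂muT τ = -(c₀ * θ 0) - ∫ t, h t * (θ t : ℂ) ∂muT τ) :
    ∀ᵐ t ∂muT τ, c t = c₀ + ∫ s in (0 : ℝ)..t, h s := by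
  obtain ⟨C, hC⟩ := ae_eq_const_add_primitive hτ hc hh fun φ h1 h2 h3 => by
    have h0 : φ 0 = 0 := image_eq_zero_of_notMem_tsupport fun h => lt_irrefl _ (h3 h).1
    have := H φ h1 h2 fun x hx => (h3 hx).2
    rw [h0] at this
    simpa [muT] using this
  let β : ContDiffBump (0 : ℝ) := ⟨τ / 3, τ / 2, by positivity, by linarith⟩
  have hβs : tsupport β ⊆ Set.Iio τ := by
    rw [β.tsupport_eq]
    intro x hx
    rw [Metric.mem_closedBall, Real.dist_eq, sub_zero] at hx
    have : β.rOut = τ / 2 := rfl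
    exact (le_abs_self x).trans_lt (by linarith)
  have hβd : ContDiff ℝ (⊤ : ℕ∞) β := β.contDiff
  have hβ0 : β 0 = 1 := β.one_of_mem_closedBall (by simp [β.rIn_pos.le])
  have hβτ : β τ = 0 := image_eq_zero_of_notMem_tsupport fun h => lt_irrefl τ (hβs h)
  have h1 := H β hβd β.hasCompactSupport hβs
  have h2 := integral_primitive_mul_deriv (g := fun t => (β t : ℂ))
    (intervalIntegrable_of_muT hτ.le le_rfl hh)
    ((Complex.ofRealCLM.contDiff.comp hβd).of_le (by exact_mod_cast le_top)) C
  rw [deriv_ofReal_comp (hβd.differentiable (by simp)), hβ0, hβτ] at h2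
  have h3 : ∫ t, c t * ((deriv β t : ℝ) : ℂ) ∂muT τ
      = ∫ t in (0 : ℝ)..τ, (C + ∫ s in (0 : ℝ)..t, h s) * ((deriv β t : ℝ) : ℂ) := by
    rw [intervalIntegral_eq_muT hτ.le]
    exact integral_congr_ae (hC.mono fun t ht => by simp only [ht])
  rw [h3, h2, intervalIntegral_eq_muT hτ.le (fun x => h x * (β x : ℂ)), hβ0] at h1
  have hCc : C = c₀ := by
    simp only [Complex.ofReal_zero, Complex.ofReal_one, mul_zero, mul_one] at h1
    linear_combination -h1
  rw [hCc] at hC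
  exact hC

theorem integrable_mul_continuous {f φ : ℝ → ℂ} (hf : MemLp f 2 volI) (hφ : Continuous φ) :
    Integrable (fun y => f y * φ y) volI := by
  obtain ⟨M, hM⟩ := (isCompact_Icc (a := (-1 : ℝ)) (b := 1)).exists_bound_of_continuousOn
    hφ.continuousOn
  exact (memLp_integrable hf).mul_bdd (c := M) hφ.aestronglyMeasurable
    (ae_volI_mem.mono fun y hy => hM y ⟨hy.1.le, hy.2.le⟩)

/-- Fubini for the pairing with a product of functions of time and space. -/
theorem L2Q.integral_sep {τ : ℝ} {F : ℝ → ℝ → ℂ} (hF : L2Q τ F) {θ ψ : ℝ → ℂ}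
    (hθ : Continuous θ) (hψ : Continuous ψ) :
    Integrable (fun q : ℝ × ℝ => F q.1 q.2 * (θ q.1 * ψ q.2)) ((muT τ).prod volI) ∧
    Integrable (fun t => ∫ y, F t y * ψ y ∂volI) (muT τ) ∧
    MemLp (fun y => ∫ t, F t y * θ t ∂muT τ) 2 volI ∧
    ∫ q, F q.1 q.2 * (θ q.1 * ψ q.2) ∂(muT τ).prod volI
      = ∫ t, (∫ y, F t y * ψ y ∂volI) * θ t ∂muT τ ∧
    ∫ q, F q.1 q.2 * (θ q.1 * ψ q.2) ∂(muT τ).prod volI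
      = ∫ y, (∫ t, F t y * θ t ∂muT τ) * ψ y ∂volI := by
  obtain ⟨A, hA⟩ := (isCompact_Icc (a := (0 : ℝ)) (b := τ)).exists_bound_of_continuousOn
    hθ.continuousOn
  obtain ⟨B, hB⟩ := (isCompact_Icc (a := (-1 : ℝ)) (b := 1)).exists_bound_of_continuousOn
    hψ.continuousOn
  have hA' : ∀ᵐ t ∂muT τ, ‖θ t‖ ≤ A := (ae_muT_mem τ).mono fun t ht => hA t ⟨ht.1.le, ht.2.le⟩
  have hB' : ∀ᵐ y ∂volI, ‖ψ y‖ ≤ B := ae_volI_mem.mono fun y hy => hB y ⟨hy.1.le, hy.2.le⟩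
  have hAq : ∀ᵐ q ∂(muT τ).prod volI, ‖θ q.1‖ ≤ A := Measure.quasiMeasurePreserving_fst.ae hA'
  have hBq : ∀ᵐ q ∂(muT τ).prod volI, ‖ψ q.2‖ ≤ B := Measure.quasiMeasurePreserving_snd.ae hB'
  have mθ : MemLp (fun q : ℝ × ℝ => θ q.1) 2 ((muT τ).prod volI) :=
    MemLp.of_bound (hθ.comp continuous_fst).aestronglyMeasurable A hAq
  have mψ : MemLp (fun q : ℝ × ℝ => ψ q.2) 2 ((muT τ).prod volI) :=
    MemLp.of_bound (hψ.comp continuous_snd).aestronglyMeasurable B hBq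
  have mθψ : MemLp (fun q : ℝ × ℝ => θ q.1 * ψ q.2) 2 ((muT τ).prod volI) := by
    refine MemLp.of_bound ((hθ.comp continuous_fst).mul
      (hψ.comp continuous_snd)).aestronglyMeasurable (A * B) ?_
    filter_upwards [hAq, hBq] with q h1 h2
    rw [norm_mul]
    exact mul_le_mul h1 h2 (norm_nonneg _) ((norm_nonneg _).trans h1)
  have i0 : Integrable (fun q : ℝ × ℝ => F q.1 q.2 * (θ q.1 * ψ q.2)) ((muT τ).prod volI) :=
    integrable_mul_of_memLp hF.memLp mθψ
  have iψ : Integrable (fun q : ℝ × ℝ => F q.1 q.2 * ψ q.2) ((muT τ).prod volI) :=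
    integrable_mul_of_memLp hF.memLp mψ
  refine ⟨i0, iψ.integral_prod_left, ?_, ?_, ?_⟩
  · -- Cauchy–Schwarz in time
    have hm : StronglyMeasurable (fun y => ∫ t, F t y * θ t ∂muT τ) := by
      refine StronglyMeasurable.integral_prod_right (f := fun (y t : ℝ) => F t y * θ t) ?_
      refine Measurable.stronglyMeasurable ?_
      exact (hF.measurable.comp measurable_swap).mul (hθ.measurable.comp measurable_snd)
    rw [← memLp_norm_iff hm.aestronglyMeasurable,
      memLp_two_iff_integrable_sq hm.norm.aestronglyMeasurable]
    have isq := (integrable_normSq hF.memLp)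
    refine (isq.integral_prod_right.mul_const (∫ t, ‖θ t‖ ^ 2 ∂muT τ)).mono'
      (hm.norm.pow 2).aestronglyMeasurable ?_
    filter_upwards [isq.prod_left_ae] with y hy
    have hFy : MemLp (fun t => F t y) 2 (muT τ) := by
      have hmy : Measurable (fun t => F t y) := hF.measurable.comp measurable_prodMk_right
      rw [← memLp_norm_iff hmy.aestronglyMeasurable,
        memLp_two_iff_integrable_sq hmy.norm.aestronglyMeasurable]
      exact hy
    have hθL : MemLp θ 2 (muT τ) := MemLp.of_bound hθ.aestronglyMeasurable A hA'
    have := norm_integral_mul_le hFy hθL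
    rw [Real.norm_eq_abs, abs_of_nonneg (by positivity)]
    calc ‖∫ t, F t y * θ t ∂muT τ‖ ^ 2
        ≤ (√(∫ t, ‖F t y‖ ^ 2 ∂muT τ) * √(∫ t, ‖θ t‖ ^ 2 ∂muT τ)) ^ 2 := by gcongr
      _ = _ := by
          rw [mul_pow, Real.sq_sqrt (integral_nonneg fun _ => by positivity),
            Real.sq_sqrt (integral_nonneg fun _ => by positivity)]
          rfl
  · rw [integral_prod _ i0]
    congr 1; ext t
    rw [← integral_mul_const]
    congr 1; ext y; ring
  · rw [integral_prod_symm _ i0]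
    congr 1; ext y
    rw [← integral_mul_const]
    congr 1; ext t; ring

/-- A weak solution in space-time, tested with products of functions of time and space, is an
evolution in the integrated sense. -/
theorem isEvolution_of_weak {τ : ℝ} (hτ : 0 < τ) {v₀ : ℝ → ℂ} {v p G₀ G₁ : ℝ → ℝ → ℂ}
    (hv : L2Q τ v) (hp : L2Q τ p) (hG₀ : L2Q τ G₀) (hG₁ : L2Q τ G₁) (hv₀ : MemLp v₀ 2 volI)
    (hvp : ∀ᵐ t ∂muT τ, IsH10 (v t) (p t))
    (H : ∀ θ : ℝ → ℝ, ContDiff ℝ (⊤ : ℕ∞) θ → HasCompactSupport θ → tsupport θ ⊆ Set.Iio τ →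
      ∀ ψ : ℝ → ℂ, ContDiff ℝ (⊤ : ℕ∞) ψ → HasCompactSupport ψ → tsupport ψ ⊆ Set.Ioo (-1) 1 →
      ∫ q, (-(v q.1 q.2 * (((deriv θ q.1 : ℝ) : ℂ) * ψ q.2))
        - G₀ q.1 q.2 * ((θ q.1 : ℂ) * ψ q.2)
        - G₁ q.1 q.2 * ((θ q.1 : ℂ) * deriv ψ q.2)) ∂(muT τ).prod volI
        = θ 0 * ∫ y, v₀ y * ψ y ∂volI) :
    IsEvolution τ v₀ v p G₀ G₁ := by
  refine ⟨hv, hp, hG₀, hG₁, hv₀, hvp, fun ψ hψ hψ0 hψ1 => ?_⟩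
  have hψc := hψ.continuous
  have hψ'c : Continuous (deriv ψ) := hψ.continuous_deriv (by simp)
  have s0 := hG₀.integral_sep (θ := fun _ => 1) continuous_const hψc
  have s1 := hG₁.integral_sep (θ := fun _ => 1) continuous_const hψ'c
  have sv := hv.integral_sep (θ := fun _ => 1) continuous_const hψc
  have hsum : ∀ᵐ s ∂muT τ, ∫ y, (G₀ s y * ψ y + G₁ s y * deriv ψ y) ∂volI
      = (∫ y, G₀ s y * ψ y ∂volI) + ∫ y, G₁ s y * deriv ψ y ∂volI := by
    filter_upwards [hG₀.slice, hG₁.slice] with s h0 h1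
    exact integral_add (integrable_mul_continuous h0 hψc) (integrable_mul_continuous h1 hψ'c)
  refine ae_eq_init_add_primitive hτ sv.2.1 ((s0.2.1.add s1.2.1).congr
    (hsum.mono fun s hs => hs.symm)) fun θ hθ hθc hθs => ?_
  have hθC : Continuous (fun t => (θ t : ℂ)) := Complex.continuous_ofReal.comp hθ.continuous
  have hθ'C : Continuous (fun t => ((deriv θ t : ℝ) : ℂ)) :=
    Complex.continuous_ofReal.comp (hθ.continuous_deriv (by simp))
  -- for fixed `θ`, the weak formulation says that `B` has the weak derivative `A`
  set A : ℝ → ℂ := fun y => -(∫ t, v t y * ((deriv θ t : ℝ) : ℂ) ∂muT τ)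
    - (∫ t, G₀ t y * (θ t : ℂ) ∂muT τ) - θ 0 * v₀ y with hA
  set B : ℝ → ℂ := fun y => -∫ t, G₁ t y * (θ t : ℂ) ∂muT τ with hB
  have mem : ∀ {F : ℝ → ℝ → ℂ} {ϑ : ℝ → ℂ}, L2Q τ F → Continuous ϑ →
      MemLp (fun y => ∫ t, F t y * ϑ t ∂muT τ) 2 volI := fun hF hϑ =>
    (hF.integral_sep hϑ hψc).2.2.1
  have hAm : MemLp A 2 volI := ((mem hv hθ'C).neg.sub (mem hG₀ hθC)).sub (hv₀.const_mul _)
  have hBm : MemLp B 2 volI := (mem hG₁ hθC).neg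
  have split : ∀ {φ : ℝ → ℂ}, Continuous φ → ∫ y, A y * φ y ∂volI
      = -(∫ y, (∫ t, v t y * ((deriv θ t : ℝ) : ℂ) ∂muT τ) * φ y ∂volI)
        - (∫ y, (∫ t, G₀ t y * (θ t : ℂ) ∂muT τ) * φ y ∂volI)
        - θ 0 * ∫ y, v₀ y * φ y ∂volI := by
    intro φ hφ
    have j1 := integrable_mul_continuous (mem hv hθ'C) hφ
    have j2 := integrable_mul_continuous (mem hG₀ hθC) hφ
    have j3 := integrable_mul_continuous hv₀ hφ
    have j12 : Integrable (fun y => -((∫ t, v t y * ((deriv θ t : ℝ) : ℂ) ∂muT τ) * φ y)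
      - (∫ t, G₀ t y * (θ t : ℂ) ∂muT τ) * φ y) volI := j1.neg.sub j2
    have j1n : Integrable (fun y => -((∫ t, v t y * ((deriv θ t : ℝ) : ℂ) ∂muT τ) * φ y)) volI :=
      j1.neg
    rw [← integral_neg, ← integral_sub j1n j2, ← integral_const_mul,
      ← integral_sub j12 (j3.const_mul _)]
    congr 1; ext y
    simp only [hA]
    ring
  have hweak : HasH1Deriv B A := by
    refine ⟨hBm, hAm, fun φ h1 h2 h3 => ?_⟩
    have hφ'c : Continuous (deriv φ) := h1.continuous_deriv (by simp)
    have a1 := hv.integral_sep hθ'C h1.continuous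
    have a2 := hG₀.integral_sep hθC h1.continuous
    have a3 := hG₁.integral_sep hθC hφ'c
    have key := H θ hθ hθc hθs φ h1 h2 h3
    have a12 : Integrable (fun q : ℝ × ℝ => -(v q.1 q.2 * (((deriv θ q.1 : ℝ) : ℂ) * φ q.2))
        - G₀ q.1 q.2 * ((θ q.1 : ℂ) * φ q.2)) ((muT τ).prod volI) := a1.1.neg.sub a2.1
    have a1n : Integrable (fun q : ℝ × ℝ => -(v q.1 q.2 * (((deriv θ q.1 : ℝ) : ℂ) * φ q.2)))
      ((muT τ).prod volI) := a1.1.neg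
    rw [integral_sub a12 a3.1, integral_sub a1n a2.1, integral_neg, a1.2.2.2.2, a2.2.2.2.2,
      a3.2.2.2.2] at key
    rw [split h1.continuous]
    have : ∫ y, B y * deriv φ y ∂volI
        = -∫ y, (∫ t, G₁ t y * (θ t : ℂ) ∂muT τ) * deriv φ y ∂volI := by
      rw [← integral_neg]
      congr 1; ext y
      simp only [hB, neg_mul]
    rw [this]
    linear_combination key
  have hfin := hweak.integral_mul_deriv (hψ.of_le (by exact_mod_cast le_top)) hψ0 hψ1
  have hBψ : ∫ y, B y * deriv ψ y ∂volI
      = -∫ y, (∫ t, G₁ t y * (θ t : ℂ) ∂muT τ) * deriv ψ y ∂volI := by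
    rw [← integral_neg]
    congr 1; ext y
    simp only [hB, neg_mul]
  have b1 := hv.integral_sep hθ'C hψc
  have b2 := hG₀.integral_sep hθC hψc
  have b3 := hG₁.integral_sep hθC hψ'c
  rw [split hψc, hBψ, ← b1.2.2.2.2, ← b2.2.2.2.2, ← b3.2.2.2.2, b1.2.2.2.1, b2.2.2.2.1,
    b3.2.2.2.1] at hfin
  obtain ⟨M, hM⟩ := hθc.exists_bound_of_continuous hθ.continuous
  have hMC : ∀ᵐ t ∂muT τ, ‖(θ t : ℂ)‖ ≤ M :=
    Filter.Eventually.of_forall fun t => by simpa using hM t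
  have e : ∫ t, (∫ y, (G₀ t y * ψ y + G₁ t y * deriv ψ y) ∂volI) * (θ t : ℂ) ∂muT τ
      = (∫ t, (∫ y, G₀ t y * ψ y ∂volI) * (θ t : ℂ) ∂muT τ)
        + ∫ t, (∫ y, G₁ t y * deriv ψ y ∂volI) * (θ t : ℂ) ∂muT τ := by
    rw [← integral_add (s0.2.1.mul_bdd (c := M) hθC.aestronglyMeasurable hMC)
      (s1.2.1.mul_bdd (c := M) hθC.aestronglyMeasurable hMC)]
    refine integral_congr_ae (hsum.mono fun t ht => ?_)
    simp only [ht]; ring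
  rw [e]
  linear_combination -hfin

/-! ### Borel representatives and exponential weights -/

/-- An increasing sequence of finite times that exhausts `(0, T)`. -/
theorem exists_times {T : EReal} (hT : 0 < T) : ∃ τ : ℕ → ℝ, Monotone τ ∧
    (∀ n, 0 < τ n ∧ (τ n : EReal) < T) ∧ ∀ t : ℝ, (t : EReal) < T → ∃ n, t < τ n := by
  obtain ⟨u, hu, huT, hlim⟩ := exists_seq_strictMono_tendsto' hT
  have hcoe : ∀ n, (((u n).toReal : ℝ) : EReal) = u n := fun n =>
    EReal.coe_toReal ((huT n).2.trans_le le_top).ne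
      (bot_lt_iff_ne_bot.mp (EReal.bot_lt_zero.trans (huT n).1))
  refine ⟨fun n => (u n).toReal, fun m n hmn => ?_, fun n => ⟨?_, ?_⟩, fun t ht => ?_⟩
  · rw [← EReal.coe_le_coe_iff, hcoe, hcoe]; exact hu.monotone hmn
  · rw [← EReal.coe_lt_coe_iff, hcoe]; exact (huT n).1
  · rw [hcoe]; exact (huT n).2
  · obtain ⟨n, hn⟩ := (hlim.eventually (lt_mem_nhds ht)).exists
    exact ⟨n, by rw [← EReal.coe_lt_coe_iff, hcoe]; exact hn⟩

theorem timeInterval_eq_iUnion {T : EReal} {τ : ℕ → ℝ} (h1 : ∀ n, 0 < τ n ∧ (τ n : EReal) < T)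
    (h2 : ∀ t : ℝ, (t : EReal) < T → ∃ n, t < τ n) :
    timeInterval T = ⋃ n, Set.Ioo 0 (τ n) := by
  ext t
  simp only [timeInterval, Set.mem_ofPred_eq, Set.mem_iUnion, Set.mem_Ioo]
  constructor
  · rintro ⟨h0, ht⟩
    obtain ⟨n, hn⟩ := h2 t ht
    exact ⟨n, h0, hn⟩
  · rintro ⟨n, h0, hn⟩
    exact ⟨h0, (EReal.coe_lt_coe_iff.mpr hn).trans (h1 n).2⟩

theorem measurableSet_timeInterval (T : EReal) : MeasurableSet (timeInterval T) := by
  have h1 : Measurable (fun t : ℝ => (t : EReal)) := measurable_coe_real_ereal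
  exact measurableSet_Ioi.inter (measurableSet_lt h1 measurable_const)

theorem volume_domQ (T : EReal) : volume.restrict (domQ T) = (volT T).prod volI := by
  rw [domQ, volT, volI, Measure.prod_restrict, Measure.volume_eq_prod]

theorem volume_box (τ : ℝ) :
    volume.restrict (Set.Ioo 0 τ ×ˢ Set.Ioo (-1 : ℝ) 1) = (muT τ).prod volI := by
  rw [muT, volI, Measure.prod_restrict, Measure.volume_eq_prod]

theorem muT_le_volT {T : EReal} {τ : ℝ} (hτ : (τ : EReal) < T) : muT τ ≤ volT T := by
  have hsub : Set.Ioo 0 τ ⊆ timeInterval T := fun t ht =>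
    ⟨ht.1, (EReal.coe_lt_coe_iff.mpr ht.2).trans hτ⟩
  exact Measure.restrict_mono hsub le_rfl

/-- `R` is a Borel function that agrees almost everywhere on `(0, T) × I` with
`F ∈ L²_loc([0, T); L²(I))`. -/
structure IsRep (T : EReal) (F R : ℝ → ℝ → ℂ) : Prop where
  l2q : ∀ τ : ℝ, 0 < τ → (τ : EReal) < T → L2Q τ R
  ae_eq : Function.uncurry F =ᵐ[(volT T).prod volI] Function.uncurry R

theorem IsRep.slice {T : EReal} {F R : ℝ → ℝ → ℂ} (h : IsRep T F R) :
    ∀ᵐ t ∂volT T, F t =ᵐ[volI] R t :=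
  Measure.ae_ae_of_ae_prod h.ae_eq

theorem IsRep.box {T : EReal} {F R : ℝ → ℝ → ℂ} (h : IsRep T F R) {τ : ℝ} (hτ : (τ : EReal) < T) :
    Function.uncurry F =ᵐ[(muT τ).prod volI] Function.uncurry R :=
  ae_mono (Measure.prod_mono (muT_le_volT hτ) le_rfl) h.ae_eq

theorem L2Loc.exists_isRep {T : EReal} (hT : 0 < T) {F : ℝ → ℝ → ℂ} (hF : L2Loc T F) :
    ∃ R, IsRep T F R := by
  obtain ⟨τ, -, h1, h2⟩ := exists_times hT
  have hdom : domQ T = ⋃ n, Set.Ioo 0 (τ n) ×ˢ Set.Ioo (-1 : ℝ) 1 := by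
    rw [domQ, timeInterval_eq_iUnion h1 h2, Set.iUnion_prod_const]
  have hm : AEStronglyMeasurable (Function.uncurry F) ((volT T).prod volI) := by
    rw [← volume_domQ, hdom, aestronglyMeasurable_iUnion_iff]
    exact fun n => (hF (τ n) (h1 n).1 (h1 n).2).1
  refine ⟨fun t y => hm.mk _ (t, y), fun σ h0 hσ => ⟨hm.stronglyMeasurable_mk.measurable, ?_⟩,
    hm.ae_eq_mk⟩
  have := hF σ h0 hσ
  rw [volume_box] at this
  exact this.ae_eq (ae_mono (Measure.prod_mono (muT_le_volT hσ) le_rfl) hm.ae_eq_mk)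

/-- The function `e^{bt} F`. -/
def weighted (b : ℝ) (F : ℝ → ℝ → ℂ) (t y : ℝ) : ℂ := (Real.exp (b * t) : ℂ) * F t y

theorem L2Q.weighted {τ : ℝ} {F : ℝ → ℝ → ℂ} (hF : L2Q τ F) (b : ℝ) : L2Q τ (weighted b F) := by
  have hm : Measurable (fun q : ℝ × ℝ => (Real.exp (b * q.1) : ℂ)) :=
    Complex.measurable_ofReal.comp (Real.measurable_exp.comp (measurable_fst.const_mul b))
  have hm' : Measurable (Function.uncurry (Couette.weighted b F)) := hm.mul hF.measurable
  refine ⟨hm', hF.memLp.of_le_mul (c := Real.exp (|b| * τ)) hm'.aestronglyMeasurable ?_⟩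
  have h : ∀ᵐ p ∂(muT τ).prod volI, p.1 ∈ Set.Ioo (0 : ℝ) τ :=
    Measure.quasiMeasurePreserving_fst.ae (ae_muT_mem τ)
  filter_upwards [h] with q hq
  simp only [Function.uncurry, Couette.weighted, norm_mul, Complex.norm_real, Real.norm_eq_abs,
    Real.abs_exp]
  gcongr
  · exact hq.1.le
  · exact le_abs_self b
  · exact hq.2.le

theorem IsH10.const_mul {u p : ℝ → ℂ} (h : IsH10 u p) (c : ℂ) :
    IsH10 (fun y => c * u y) (fun y => c * p y) := by
  refine ⟨h.1.const_mul c, by rw [integral_const_mul, h.2, mul_zero], ?_⟩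
  filter_upwards [h.3] with y hy
  rw [hy, intervalIntegral.integral_const_mul]

/-- The exponentially weighted representatives of a weak solution and its data form an evolution. -/
theorem IsWeakSolution.shearEvolution {ν b : ℝ} {k ℓ : ℤ} {T : EReal}
    {f₁ f₂ f₃ f₄ f₄' ω ω' r₁ r₂ r₃ r₄ r₄' o o' : ℝ → ℝ → ℂ} {ωin v₀ : ℝ → ℂ}
    (h : IsWeakSolution ν k ℓ T f₁ f₂ f₃ f₄ ωin ω ω')
    (hb₄ : ∀ᵐ t ∂volT T, HasH10Deriv (f₄ t) (f₄' t)) (hin : MemLp ωin 2 volI)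
    (h₁ : IsRep T f₁ r₁) (h₂ : IsRep T f₂ r₂) (h₃ : IsRep T f₃ r₃) (h₄ : IsRep T f₄ r₄)
    (h₄' : IsRep T f₄' r₄') (ho : IsRep T ω o) (ho' : IsRep T ω' o') (hv₀m : Measurable v₀)
    (hv₀ : ωin =ᵐ[volI] v₀) {τ : ℝ} (hτ0 : 0 < τ) (hτ : (τ : EReal) < T) :
    ShearEvolution τ ν (eta k ℓ) k b v₀ (weighted b o) (weighted b o')
      (weighted b fun t y => (k : ℂ) * r₁ t y + (ℓ : ℂ) * r₃ t y) (weighted b r₂) (weighted b r₄)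
      (weighted b r₄') := by
  have lo := (ho.l2q τ hτ0 hτ).weighted b
  have lo' := (ho'.l2q τ hτ0 hτ).weighted b
  have l₂ := (h₂.l2q τ hτ0 hτ).weighted b
  have l₄ := (h₄.l2q τ hτ0 hτ).weighted b
  have l₄' := (h₄'.l2q τ hτ0 hτ).weighted b
  have lg := (((h₁.l2q τ hτ0 hτ).const_mul (k : ℂ)).add
    ((h₃.l2q τ hτ0 hτ).const_mul (ℓ : ℂ))).weighted b
  set v := weighted b o with hv
  set p := weighted b o' with hp
  set g := weighted b (fun t y => (k : ℂ) * r₁ t y + (ℓ : ℂ) * r₃ t y) with hg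
  set F₂ := weighted b r₂ with hF₂
  set F₄ := weighted b r₄ with hF₄
  set η := eta k ℓ with hη
  have hbox : ∀ {P : ℝ → Prop}, (∀ᵐ t ∂volT T, P t) → ∀ᵐ t ∂muT τ, P t := fun hP =>
    ae_mono (muT_le_volT hτ) hP
  have lin : L2Q τ (fun t y => ((((ν * η ^ 2 - b : ℝ) : ℂ)) + Complex.I * ((k : ℝ) : ℂ) * y) * v t y) := by
    refine lo.mul_space (κ := fun y : ℝ => (((ν * η ^ 2 - b : ℝ) : ℂ)) + Complex.I * ((k : ℝ) : ℂ) * y)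
      (by fun_prop) (B := |ν * η ^ 2 - b| + |(k : ℝ)|) fun y hy => ?_
    refine (norm_add_le _ _).trans ?_
    simp only [norm_mul, Complex.norm_I, one_mul, Complex.norm_real, Real.norm_eq_abs]
    have : |y| ≤ 1 := abs_le.mpr ⟨hy.1.le, hy.2.le⟩
    nlinarith [abs_nonneg (k : ℝ)]
  have ldat : L2Q τ (fun t y => -Complex.I * g t y - F₄ t y) := (lg.const_mul _).sub l₄
  have lG₀ : L2Q τ (fun t => shearForce (ν * η ^ 2 - b) (k : ℝ) (g t) (F₄ t) (v t)) := ldat.sub lin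
  have lνp : L2Q τ (fun t y => (ν : ℂ) * p t y) := lo'.const_mul _
  have lG₁ : L2Q τ (fun t y => F₂ t y - ν * p t y) := l₂.sub lνp
  refine ⟨isEvolution_of_weak hτ0 lo lo' lG₀ lG₁ (hin.ae_eq hv₀) ?_ ?_, hv₀m, lg, l₂, l₄, l₄', ?_⟩
  · filter_upwards [hbox h.boundary, hbox ho.slice, hbox ho'.slice] with t a1 a2 a3
    exact (a1.isH10.congr a2 a3).const_mul _
  · intro θ hθ hθc hθs ψ hψ hψc hψs
    have hθz : ∀ t, τ ≤ t → θ t = 0 ∧ deriv θ t = 0 := fun t ht => by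
      have : t ∉ tsupport θ := fun h => absurd (hθs h) (not_lt.mpr ht)
      exact ⟨image_eq_zero_of_notMem_tsupport this,
        by_contra fun h => this (support_deriv_subset h)⟩
    set φ : ℝ → ℝ → ℂ := fun t y => ((θ t * Real.exp (b * t) : ℝ) : ℂ) * ψ y with hφ
    have hφd : ContDiff ℝ (⊤ : ℕ∞) (Function.uncurry φ) := by
      have hθe : ContDiff ℝ (⊤ : ℕ∞) (fun t : ℝ => θ t * Real.exp (b * t)) :=
        hθ.mul (Real.contDiff_exp.comp (contDiff_const.mul contDiff_id))
      exact (Complex.ofRealCLM.contDiff.comp (hθe.comp contDiff_fst)).mul (hψ.comp contDiff_snd)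
    have hφ0 : ∀ q, q ∉ tsupport θ ×ˢ tsupport ψ → Function.uncurry φ q = 0 := by
      intro q hq
      rw [Set.mem_prod, not_and_or] at hq
      simp only [Function.uncurry, hφ]
      rcases hq with hq | hq
      · rw [image_eq_zero_of_notMem_tsupport hq]; simp
      · rw [image_eq_zero_of_notMem_tsupport hq]; simp
    have hKc : IsCompact (tsupport θ ×ˢ tsupport ψ) := hθc.isCompact.prod hψc.isCompact
    have hφs : tsupport (Function.uncurry φ)
        ⊆ {p | (p.1 : EReal) < T ∧ p.2 ∈ Set.Ioo (-1 : ℝ) 1} := by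
      have h1 : tsupport (Function.uncurry φ) ⊆ tsupport θ ×ˢ tsupport ψ :=
        closure_minimal (fun q hq => by_contra fun h => hq (hφ0 q h)) hKc.isClosed
      intro q hq
      have h2 := h1 hq
      exact ⟨(EReal.coe_lt_coe_iff.mpr (hθs h2.1)).trans hτ, hψs h2.2⟩
    have key := h.weak_eq φ hφd (HasCompactSupport.intro hKc hφ0) hφs
    have hdt : ∀ t y, deriv (fun s => φ s y) t
        = ((deriv θ t * Real.exp (b * t) + θ t * (b * Real.exp (b * t)) : ℝ) : ℂ) * ψ y := by
      intro t y
      have e1 : HasDerivAt (fun s => Real.exp (b * s)) (b * Real.exp (b * t)) t := by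
        have := ((hasDerivAt_id' t).const_mul b).exp
        simpa [mul_comm] using this
      have e2 := ((hθ.differentiable (by simp)) t).hasDerivAt.mul e1
      exact (e2.ofReal_comp.mul_const (ψ y)).deriv
    have hdy : ∀ t y, deriv (φ t) y = ((θ t * Real.exp (b * t) : ℝ) : ℂ) * deriv ψ y := by
      intro t y
      exact (((hψ.differentiable (by simp)) y).hasDerivAt.const_mul _).deriv
    simp only [hdt, hdy] at key
    have hsub : Set.Ioo 0 τ ×ˢ Set.Ioo (-1 : ℝ) 1 ⊆ domQ T := fun q hq =>
      ⟨⟨hq.1.1, (EReal.coe_lt_coe_iff.mpr hq.1.2).trans hτ⟩, hq.2⟩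
    have hmeas : MeasurableSet (domQ T) := (measurableSet_timeInterval T).prod measurableSet_Ioo
    have hout : ∀ q ∈ domQ T \ Set.Ioo 0 τ ×ˢ Set.Ioo (-1 : ℝ) 1,
        θ q.1 = 0 ∧ deriv θ q.1 = 0 := by
      rintro q ⟨hq1, hq2⟩
      refine hθz _ (not_lt.mp fun hlt => hq2 ⟨⟨hq1.1.1, hlt⟩, hq1.2⟩)
    rw [setIntegral_eq_of_subset_of_forall_sdiff_eq_zero hmeas hsub fun q hq => by
        simp only [hφ, (hout q hq).1, (hout q hq).2]; simp,
      setIntegral_eq_of_subset_of_forall_sdiff_eq_zero hmeas hsub fun q hq => by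
        simp only [hφ, (hout q hq).1]; simp, volume_box] at key
    have hθC : Continuous (fun t => (θ t : ℂ)) := Complex.continuous_ofReal.comp hθ.continuous
    have hθ'C : Continuous (fun t => ((deriv θ t : ℝ) : ℂ)) :=
      Complex.continuous_ofReal.comp (hθ.continuous_deriv (by simp))
    have hψ'C : Continuous (deriv ψ) := hψ.continuous_deriv (by simp)
    have i1 := (lo.integral_sep hθ'C hψ.continuous).1
    have i2 := (lin.integral_sep hθC hψ.continuous).1
    have i3 := (lνp.integral_sep hθC hψ'C).1
    have i4 := (ldat.integral_sep hθC hψ.continuous).1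
    have i5 := (l₂.integral_sep hθC hψ'C).1
    have iL : Integrable (fun q : ℝ × ℝ => -(v q.1 q.2 * (((deriv θ q.1 : ℝ) : ℂ) * ψ q.2))
        + ((((ν * η ^ 2 - b : ℝ) : ℂ)) + Complex.I * ((k : ℝ) : ℂ) * q.2) * v q.1 q.2
          * ((θ q.1 : ℂ) * ψ q.2)
        + (ν : ℂ) * p q.1 q.2 * ((θ q.1 : ℂ) * deriv ψ q.2)) ((muT τ).prod volI) :=
      (i1.neg.add i2).add i3
    have iR : Integrable (fun q : ℝ × ℝ =>
        (-Complex.I * g q.1 q.2 - F₄ q.1 q.2) * ((θ q.1 : ℂ) * ψ q.2)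
        + F₂ q.1 q.2 * ((θ q.1 : ℂ) * deriv ψ q.2)) ((muT τ).prod volI) := i4.add i5
    have eL : ∫ q, (-ω q.1 q.2
            * (((deriv θ q.1 * Real.exp (b * q.1) + θ q.1 * (b * Real.exp (b * q.1)) : ℝ) : ℂ)
              * ψ q.2)
          + (ν : ℂ) * ω' q.1 q.2 * (((θ q.1 * Real.exp (b * q.1) : ℝ) : ℂ) * deriv ψ q.2)
          + ((ν : ℂ) * (eta k ℓ : ℂ) ^ 2 + Complex.I * (k : ℂ) * (q.2 : ℂ))
              * ω q.1 q.2 * φ q.1 q.2) ∂(muT τ).prod volI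
        = ∫ q, (-(v q.1 q.2 * (((deriv θ q.1 : ℝ) : ℂ) * ψ q.2))
        + ((((ν * η ^ 2 - b : ℝ) : ℂ)) + Complex.I * ((k : ℝ) : ℂ) * q.2) * v q.1 q.2
          * ((θ q.1 : ℂ) * ψ q.2)
        + (ν : ℂ) * p q.1 q.2 * ((θ q.1 : ℂ) * deriv ψ q.2)) ∂(muT τ).prod volI := by
      refine integral_congr_ae ?_
      filter_upwards [ho.box hτ, ho'.box hτ] with q e1 e2
      simp only [Function.uncurry] at e1 e2
      simp only [e1, e2, hφ, hv, hp, weighted, hη]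
      push_cast
      ring
    have eR : ∫ q, ((-Complex.I * (k : ℂ) * f₁ q.1 q.2 - Complex.I * (ℓ : ℂ) * f₃ q.1 q.2
              - f₄ q.1 q.2) * φ q.1 q.2
            + f₂ q.1 q.2 * (((θ q.1 * Real.exp (b * q.1) : ℝ) : ℂ) * deriv ψ q.2))
            ∂(muT τ).prod volI
        = ∫ q, ((-Complex.I * g q.1 q.2 - F₄ q.1 q.2) * ((θ q.1 : ℂ) * ψ q.2)
        + F₂ q.1 q.2 * ((θ q.1 : ℂ) * deriv ψ q.2)) ∂(muT τ).prod volI := by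
      refine integral_congr_ae ?_
      filter_upwards [h₁.box hτ, h₂.box hτ, h₃.box hτ, h₄.box hτ] with q e1 e2 e3 e4
      simp only [Function.uncurry] at e1 e2 e3 e4
      simp only [e1, e2, e3, e4, hφ, hg, hF₂, hF₄, weighted]
      push_cast
      ring
    have e0 : ∫ y, ωin y * φ 0 y ∂volI = θ 0 * ∫ y, v₀ y * ψ y ∂volI := by
      rw [← integral_const_mul]
      refine integral_congr_ae (hv₀.mono fun y hy => ?_)
      simp only [hφ, hy, mul_zero, Real.exp_zero, mul_one]
      ring
    rw [eL, eR, e0] at key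
    rw [← sub_eq_iff_eq_add.mpr key, ← integral_sub iL iR]
    refine integral_congr_ae (Filter.Eventually.of_forall fun q => ?_)
    simp only [shearForce]
    push_cast
    ring
  · filter_upwards [hbox hb₄, hbox h₄.slice, hbox h₄'.slice] with t a1 a2 a3
    exact (a1.isH10.congr a2 a3).const_mul _

/-! ### Norms on the whole time interval -/

theorem HasH1Deriv.congr {f g f' g' : ℝ → ℂ} (h : HasH1Deriv f g) (hf : f =ᵐ[volI] f')
    (hg : g =ᵐ[volI] g') : HasH1Deriv f' g' := by
  refine ⟨h.1.ae_eq hf, h.2.1.ae_eq hg, fun φ c1 c2 c3 => ?_⟩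
  have e1 : ∫ y, f y * deriv φ y ∂volI = ∫ y, f' y * deriv φ y ∂volI :=
    integral_congr_ae (hf.mono fun y hy => by simp only [hy])
  have e2 : ∫ y, g y * φ y ∂volI = ∫ y, g' y * φ y ∂volI :=
    integral_congr_ae (hg.mono fun y hy => by simp only [hy])
  rw [← e1, h.2.2 φ c1 c2 c3, e2]

theorem HasH1Deriv.const_mul {f g : ℝ → ℂ} (h : HasH1Deriv f g) (c : ℂ) :
    HasH1Deriv (fun y => c * f y) (fun y => c * g y) := by
  refine ⟨h.1.const_mul c, h.2.1.const_mul c, fun φ c1 c2 c3 => ?_⟩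
  simp only [mul_assoc, integral_const_mul, h.2.2 φ c1 c2 c3, mul_neg]

theorem weighted_neg_weighted (b : ℝ) (F : ℝ → ℝ → ℂ) : weighted b (weighted (-b) F) = F := by
  ext t y
  have : (Real.exp (b * t) : ℂ) * (Real.exp (-b * t) : ℂ) = 1 := by
    rw [← Complex.ofReal_mul, ← Real.exp_add]; simp
  rw [weighted, weighted, ← mul_assoc, this, one_mul]

theorem eLpNorm_two_sq {f : ℝ → ℂ} (hf : MemLp f 2 volI) :
    eLpNorm f 2 volI ^ 2 = ENNReal.ofReal (nsq f) := by
  rw [nsq, ofReal_integral_eq_lintegral_ofReal (integrable_normSq hf)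
    (Filter.Eventually.of_forall fun _ => by positivity),
    eLpNorm_eq_lintegral_rpow_enorm_toReal (by norm_num) (by norm_num), ← ENNReal.rpow_natCast,
    ← ENNReal.rpow_mul]
  norm_num

/-- The squared norm of `F` in `L²(0, T; L²(I))`, with values in `[0, ∞]`. -/
def normSqT (T : EReal) (F : ℝ → ℝ → ℂ) : ENNReal := ∫⁻ t, ENNReal.ofReal (nsq (F t)) ∂volT T

theorem ae_volT {T : EReal} (hT : 0 < T) {P : ℝ → Prop}
    (h : ∀ τ : ℝ, 0 < τ → (τ : EReal) < T → ∀ᵐ t ∂muT τ, P t) : ∀ᵐ t ∂volT T, P t := by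
  obtain ⟨τ, -, h1, h2⟩ := exists_times hT
  rw [volT, timeInterval_eq_iUnion h1 h2, ae_restrict_iUnion_iff]
  exact fun n => h (τ n) (h1 n).1 (h1 n).2

theorem ae_volT_lt (T : EReal) : ∀ᵐ t : ℝ ∂volT T, 0 < t ∧ (t : EReal) < T :=
  ae_restrict_mem (measurableSet_timeInterval T)

/-- A property that holds at almost every time holds at some time beyond `τ`. -/
theorem exists_good_time {T : EReal} {τ : ℝ} (h0 : 0 < τ) (hτ : (τ : EReal) < T) {P : ℝ → Prop}
    (h : ∀ᵐ t ∂volT T, P t) : ∃ t, τ < t ∧ (t : EReal) < T ∧ P t := by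
  obtain ⟨σ, h1, h2⟩ : ∃ σ : ℝ, (τ : EReal) < σ ∧ (σ : EReal) < T :=
    EReal.lt_iff_exists_real_btwn.mp hτ
  rw [EReal.coe_lt_coe_iff] at h1
  have hm : ∀ᵐ t ∂((volume : Measure ℝ).restrict (Set.Ioo τ σ)), P t := by
    have hsub : Set.Ioo τ σ ⊆ timeInterval T := fun t ht =>
      ⟨h0.trans ht.1, (EReal.coe_lt_coe_iff.mpr ht.2).trans h2⟩
    exact ae_mono (Measure.restrict_mono hsub le_rfl) h
  have : (volume : Measure ℝ).restrict (Set.Ioo τ σ) ≠ 0 := by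
    rw [Ne, Measure.restrict_eq_zero, Real.volume_Ioo, ENNReal.ofReal_eq_zero, not_le]
    linarith
  have : Filter.NeBot (ae (volume.restrict (Set.Ioo τ σ))) := ae_neBot.mpr this
  obtain ⟨t, ht, hp⟩ := ((ae_restrict_mem measurableSet_Ioo).and hm).exists
  exact ⟨t, ht.1, (EReal.coe_lt_coe_iff.mpr ht.2).trans h2, hp⟩

theorem ofReal_intervalIntegral_nsq {t : ℝ} {R : ℝ → ℝ → ℂ} (ht : 0 ≤ t) (hR : L2Q t R) :
    ENNReal.ofReal (∫ s in (0 : ℝ)..t, nsq (R s)) = ∫⁻ s, ENNReal.ofReal (nsq (R s)) ∂muT t := by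
  rw [intervalIntegral_eq_muT ht, ofReal_integral_eq_lintegral_ofReal hR.integrable_nsq
    (Filter.Eventually.of_forall fun _ => nsq_nonneg _)]

theorem ofReal_intervalIntegral_nsq_le {T : EReal} {t : ℝ} {R : ℝ → ℝ → ℂ} (ht : 0 ≤ t)
    (htT : (t : EReal) < T) (hR : L2Q t R) :
    ENNReal.ofReal (∫ s in (0 : ℝ)..t, nsq (R s)) ≤ normSqT T R := by
  rw [ofReal_intervalIntegral_nsq ht hR]
  exact lintegral_mono' (muT_le_volT htT) le_rfl

/-- Bounds that are uniform in `t < T` pass to the limit `t → T`. -/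
theorem mul_normSqT_le {T : EReal} (hT : 0 < T) {R : ℝ → ℝ → ℂ} {c : ℝ} {M : ENNReal} (hc : 0 ≤ c)
    (hR : ∀ τ : ℝ, 0 < τ → (τ : EReal) < T → L2Q τ R)
    (h : ∀ᵐ t ∂volT T, ENNReal.ofReal (c * ∫ s in (0 : ℝ)..t, nsq (R s)) ≤ M) :
    ENNReal.ofReal c * normSqT T R ≤ M := by
  obtain ⟨τ, hmono, h1, h2⟩ := exists_times hT
  have hdir : Directed (· ⊆ ·) fun n => Set.Ioo (0 : ℝ) (τ n) :=
    directed_of_isDirected_le fun m n hmn => Set.Ioo_subset_Ioo_right (hmono hmn)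
  rw [normSqT, volT, timeInterval_eq_iUnion h1 h2, setLIntegral_iUnion_of_directed _ hdir,
    ENNReal.mul_iSup]
  refine iSup_le fun n => ?_
  obtain ⟨t, ht, htT, hM⟩ := exists_good_time (h1 n).1 (h1 n).2 h
  have h0 := (h1 n).1.trans ht
  refine le_trans ?_ hM
  rw [ENNReal.ofReal_mul hc, ofReal_intervalIntegral_nsq h0.le (hR t h0 htT)]
  exact mul_le_mul_right (lintegral_mono' (muT_mono ht.le) le_rfl) _

theorem IsRep.linearComb {T : EReal} {F G R S : ℝ → ℝ → ℂ} (hF : IsRep T F R) (hG : IsRep T G S)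
    (c d : ℂ) : IsRep T (fun t y => c * F t y + d * G t y) (fun t y => c * R t y + d * S t y) := by
  refine ⟨fun τ h0 hτ => ((hF.l2q τ h0 hτ).const_mul c).add ((hG.l2q τ h0 hτ).const_mul d), ?_⟩
  filter_upwards [hF.ae_eq, hG.ae_eq] with q h1 h2
  simp only [Function.uncurry] at h1 h2 ⊢
  rw [h1, h2]

theorem IsRep.ae_eLpNorm_sq {T : EReal} (hT : 0 < T) {F R : ℝ → ℝ → ℂ} (h : IsRep T F R) (b : ℝ) :
    ∀ᵐ t ∂volT T, eLpNorm (weighted b F t) 2 volI ^ 2 = ENNReal.ofReal (nsq (weighted b R t)) := by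
  have hm : ∀ᵐ t ∂volT T, MemLp (weighted b R t) 2 volI :=
    ae_volT hT fun τ h0 hτ => ((h.l2q τ h0 hτ).weighted b).slice
  filter_upwards [h.slice, hm] with t h1 h2
  rw [← eLpNorm_two_sq h2, eLpNorm_congr_ae (g := weighted b R t)]
  filter_upwards [h1] with y hy
  rw [weighted, weighted, hy]

theorem IsRep.wNorm_two_sq {T : EReal} (hT : 0 < T) {F R : ℝ → ℝ → ℂ} (h : IsRep T F R)
    {a ν b : ℝ} (hb : a * ν ^ (1 / 3 : ℝ) = b) :
    wNorm a ν 2 T F ^ 2 = normSqT T (weighted b R) := by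
  have e : wNorm a ν 2 T F = eLpNorm (fun t => eLpNorm (weighted b F t) 2 volI) 2 (volT T) := by
    rw [← hb]; rfl
  rw [e, eLpNorm_eq_lintegral_rpow_enorm_toReal (by norm_num) (by norm_num),
    ← ENNReal.rpow_natCast, ← ENNReal.rpow_mul]
  norm_num
  exact lintegral_congr_ae (h.ae_eLpNorm_sq hT b)

theorem IsRep.wNorm_top_sq_le {T : EReal} (hT : 0 < T) {F R : ℝ → ℝ → ℂ} (h : IsRep T F R)
    {a ν b : ℝ} (hb : a * ν ^ (1 / 3 : ℝ) = b) {M : ENNReal}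
    (hM : ∀ᵐ t ∂volT T, ENNReal.ofReal (nsq (weighted b R t)) ≤ M) :
    wNorm a ν ⊤ T F ^ 2 ≤ M := by
  have e : wNorm a ν ⊤ T F = eLpNorm (fun t => eLpNorm (weighted b F t) 2 volI) ⊤ (volT T) := by
    rw [← hb]; rfl
  have key : wNorm a ν ⊤ T F ≤ M ^ (2⁻¹ : ℝ) := by
    rw [e, eLpNorm_exponent_top]
    refine eLpNormEssSup_le_of_ae_enorm_bound ?_
    filter_upwards [hM, h.ae_eLpNorm_sq hT b] with t h1 h2
    rw [enorm_eq_self, ENNReal.le_rpow_inv_iff (by norm_num), ENNReal.rpow_two, h2]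
    exact h1
  calc wNorm a ν ⊤ T F ^ 2 ≤ (M ^ (2⁻¹ : ℝ)) ^ 2 := by gcongr
    _ = M := by rw [← ENNReal.rpow_natCast, ← ENNReal.rpow_mul]; norm_num

/-- An estimate on `(0, t)` for almost every `t < T` gives the estimate of the norms on `(0, T)`. -/
theorem IsRep.norms_le {T : EReal} (hT : 0 < T) {F G R S : ℝ → ℝ → ℂ} (hF : IsRep T F R)
    (hG : IsRep T G S) {a ν b c₁ c₂ : ℝ} (hb : a * ν ^ (1 / 3 : ℝ) = b) (hc₁ : 0 ≤ c₁)
    (hc₂ : 0 ≤ c₂) {M : ENNReal}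
    (h : ∀ᵐ t ∂volT T, ENNReal.ofReal (nsq (weighted b R t)
      + (c₁ * (∫ s in (0 : ℝ)..t, nsq (weighted b S s))
        + c₂ * ∫ s in (0 : ℝ)..t, nsq (weighted b R s))) ≤ M) :
    wNorm a ν ⊤ T F ^ 2 + ENNReal.ofReal c₁ * wNorm a ν 2 T G ^ 2
      + ENNReal.ofReal c₂ * wNorm a ν 2 T F ^ 2 ≤ 3 * M := by
  have hnn : ∀ {t : ℝ} {V : ℝ → ℝ → ℂ}, 0 < t → 0 ≤ ∫ s in (0 : ℝ)..t, nsq (V s) := fun ht =>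
    intervalIntegral.integral_nonneg ht.le fun _ _ => nsq_nonneg _
  rw [hF.wNorm_two_sq hT hb, hG.wNorm_two_sq hT hb, show (3 : ENNReal) * M = M + M + M by ring]
  refine add_le_add (add_le_add (hF.wNorm_top_sq_le hT hb ?_) (mul_normSqT_le hT hc₁
    (fun τ h0 hτ => (hG.l2q τ h0 hτ).weighted b) ?_)) (mul_normSqT_le hT hc₂
    (fun τ h0 hτ => (hF.l2q τ h0 hτ).weighted b) ?_)
  all_goals
    filter_upwards [h, ae_volT_lt T] with t h1 h2
    refine (ENNReal.ofReal_le_ofReal ?_).trans h1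
    have e1 := mul_nonneg hc₁ (hnn h2.1 (V := weighted b S))
    have e2 := mul_nonneg hc₂ (hnn h2.1 (V := weighted b R))
    have e3 := nsq_nonneg (weighted b R t)
    linarith

theorem intervalIntegral_dataSize {t : ℝ} {g f₂ f₄ f₄' : ℝ → ℝ → ℂ} (ht : 0 ≤ t) (hg : L2Q t g)
    (hf₂ : L2Q t f₂) (hf₄ : L2Q t f₄) (hf₄' : L2Q t f₄') (ν κ η μ : ℝ) :
    ∫ s in (0 : ℝ)..t, dataSize ν κ η μ (g s) (f₂ s) (f₄ s) (f₄' s)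
      = ν⁻¹ * (∫ s in (0 : ℝ)..t, nsq (f₂ s)) + (η * κ)⁻¹ * (∫ s in (0 : ℝ)..t, nsq (f₄' s))
        + η * κ⁻¹ * (∫ s in (0 : ℝ)..t, nsq (f₄ s)) + μ⁻¹ * ∫ s in (0 : ℝ)..t, nsq (g s) := by
  have i2 := hf₂.integrable_nsq.const_mul ν⁻¹
  have i4 := hf₄.integrable_nsq.const_mul η
  have i4' := hf₄'.integrable_nsq.const_mul η⁻¹
  have ig := hg.integrable_nsq.const_mul μ⁻¹
  have i44 : Integrable (fun s => η * nsq (f₄ s) + η⁻¹ * nsq (f₄' s)) (muT t) := i4.add i4'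
  have i24 : Integrable (fun s => ν⁻¹ * nsq (f₂ s)
      + κ⁻¹ * (η * nsq (f₄ s) + η⁻¹ * nsq (f₄' s))) (muT t) := i2.add (i44.const_mul _)
  simp only [intervalIntegral_eq_muT ht, dataSize]
  rw [integral_add i24 ig, integral_add i2 (i44.const_mul _), integral_const_mul κ⁻¹,
    integral_add i4 i4', mul_inv]
  simp only [integral_const_mul]
  ring

/-- The layer width `δ = (ν/κ)^{1/3}` turns the fractional powers of the statement into monomials
in `κ` and `δ`. -/
theorem exists_scale {ν κ : ℝ} (hν : 0 < ν) (hκ : 1 ≤ κ) : ∃ δ : ℝ, 0 < δ ∧ ν = κ * δ ^ 3 ∧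
    (ν * κ ^ 2) ^ (1 / 3 : ℝ) = κ * δ ∧ (ν * κ ^ 2) ^ (-(1 / 3) : ℝ) = (κ * δ)⁻¹ ∧
    ν ^ (-(2 / 3) : ℝ) * κ ^ (2 / 3 : ℝ) = (δ ^ 2)⁻¹ ∧ ν ^ (1 / 3 : ℝ) ≤ κ * δ := by
  have hκ0 : 0 < κ := by linarith
  have hδ : 0 < (ν / κ) ^ (1 / 3 : ℝ) := by positivity
  have h3 : ((ν / κ) ^ (1 / 3 : ℝ)) ^ 3 = ν / κ := by
    rw [← Real.rpow_natCast, ← Real.rpow_mul (by positivity)]; norm_num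
  generalize (ν / κ) ^ (1 / 3 : ℝ) = δ at hδ h3
  have hνδ : ν = κ * δ ^ 3 := by rw [h3]; field_simp
  have e1 : (ν * κ ^ 2) ^ (1 / 3 : ℝ) = κ * δ := by
    rw [show ν * κ ^ 2 = (κ * δ) ^ 3 by rw [hνδ]; ring, ← Real.rpow_natCast,
      ← Real.rpow_mul (by positivity)]
    norm_num
  refine ⟨δ, hδ, hνδ, e1, ?_, ?_, ?_⟩
  · rw [Real.rpow_neg (by positivity), e1]
  · rw [Real.rpow_neg hν.le, ← Real.inv_rpow hν.le, ← Real.mul_rpow (by positivity) hκ0.le,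
      show ν⁻¹ * κ = (δ⁻¹) ^ 3 by rw [hνδ]; field_simp, ← Real.rpow_natCast,
      ← Real.rpow_mul (by positivity)]
    norm_num
  · rw [← e1]
    exact Real.rpow_le_rpow hν.le (le_mul_of_one_le_right hν.le (one_le_pow₀ hκ)) (by norm_num)

/-! ### Passage to norms on `(0, T)` -/

theorem ofReal_mul_intervalIntegral_nsq_le {T : EReal} {t c : ℝ} {R : ℝ → ℝ → ℂ} (hc : 0 ≤ c)
    (ht : 0 ≤ t) (htT : (t : EReal) < T) (hR : L2Q t R) :
    ENNReal.ofReal (c * ∫ s in (0 : ℝ)..t, nsq (R s)) ≤ ENNReal.ofReal c * normSqT T R := by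
  rw [ENNReal.ofReal_mul hc]
  exact mul_le_mul_right (ofReal_intervalIntegral_nsq_le ht htT hR) _

section passage
variable {T : EReal} {ν η κ δ k b μ C : ℝ} {v₀ v₀' : ℝ → ℂ} {v p g f₂ f₂' f₄ f₄' W : ℝ → ℝ → ℂ}

/-- An energy estimate on every `(0, t)`, `t < T`, bounds the left side by the norms of the data
on the whole of `(0, T)`. -/
theorem ShearEvolution.ofReal_energy_le (hT : 0 < T) (hν : 0 < ν) (hη : 0 < η) (hκ : 0 < κ)
    (hμ : 0 < μ) (hC : 0 ≤ C)
    (h : ∀ τ : ℝ, 0 < τ → (τ : EReal) < T → ShearEvolution τ ν η k b v₀ v p g f₂ f₄ f₄')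
    (hE : ∀ τ : ℝ, 0 < τ → (τ : EReal) < T → ∀ᵐ t ∂muT τ,
      nsq (v t) + ∫ s in (0 : ℝ)..t, dissipation ν κ δ η (v s) (p s)
        ≤ C * (nsq v₀ + ∫ s in (0 : ℝ)..t, dataSize ν κ η μ (g s) (f₂ s) (f₄ s) (f₄' s))) :
    ∀ᵐ t ∂volT T, ENNReal.ofReal (nsq (v t) + (ν * (∫ s in (0 : ℝ)..t, nsq (p s))
        + (ν * η ^ 2 + κ * δ) * ∫ s in (0 : ℝ)..t, nsq (v s)))
      ≤ ENNReal.ofReal C * (ENNReal.ofReal (nsq v₀) + ENNReal.ofReal ν⁻¹ * normSqT T f₂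
        + ENNReal.ofReal (η * κ)⁻¹ * normSqT T f₄' + ENNReal.ofReal (η * κ⁻¹) * normSqT T f₄
        + ENNReal.ofReal μ⁻¹ * normSqT T g) := by
  filter_upwards [ae_volT hT hE, ae_volT_lt T] with t h1 h2
  obtain ⟨h0, htT⟩ := h2
  have ht := h t h0 htT
  have hd : ∫ s in (0 : ℝ)..t, dissipation ν κ δ η (v s) (p s)
      = ν * (∫ s in (0 : ℝ)..t, nsq (p s))
        + (ν * η ^ 2 + κ * δ) * ∫ s in (0 : ℝ)..t, nsq (v s) := by
    simp only [intervalIntegral_eq_muT h0.le, dissipation]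
    rw [integral_add (ht.evolution.p_mem.integrable_nsq.const_mul _)
      (ht.evolution.v_mem.integrable_nsq.const_mul _), integral_const_mul, integral_const_mul]
  rw [hd, intervalIntegral_dataSize h0.le ht.g_mem ht.f₂_mem ht.f₄_mem ht.f₄'_mem] at h1
  refine (ENNReal.ofReal_le_ofReal h1).trans ?_
  rw [ENNReal.ofReal_mul hC, ← add_assoc, ← add_assoc, ← add_assoc]
  refine mul_le_mul_right ?_ _
  refine ENNReal.ofReal_add_le.trans (add_le_add (ENNReal.ofReal_add_le.trans (add_le_add
    (ENNReal.ofReal_add_le.trans (add_le_add (ENNReal.ofReal_add_le.trans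
      (add_le_add le_rfl ?_)) ?_)) ?_)) ?_)
  · exact ofReal_mul_intervalIntegral_nsq_le (by positivity) h0.le htT ht.f₂_mem
  · exact ofReal_mul_intervalIntegral_nsq_le (by positivity) h0.le htT ht.f₄'_mem
  · exact ofReal_mul_intervalIntegral_nsq_le (by positivity) h0.le htT ht.f₄_mem
  · exact ofReal_mul_intervalIntegral_nsq_le (by positivity) h0.le htT ht.g_mem

/-- The `H¹` estimate, with the data measured on the whole of `(0, T)`.  The term in `g` of the
`L²` data size is absorbed by `ν⁻¹‖g‖²`, because `δ⁻²(κδ)⁻¹ = ν⁻¹`. -/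
theorem ShearEvolution.ofReal_h1_energy_le (hδ : 0 < δ) (hκ : 0 < κ)
    (hν : ν = κ * δ ^ 3) (hη : 0 < η) (hC : 0 ≤ C)
    (h : ∀ τ : ℝ, 0 < τ → (τ : EReal) < T → ShearEvolution τ ν η k b v₀ v p g f₂ f₄ f₄')
    (hf₂' : ∀ τ : ℝ, 0 < τ → (τ : EReal) < T → L2Q τ f₂')
    (hE : ∀ᵐ t ∂volT T, L2Q t W ∧
      nsq (p t) + ∫ s in (0 : ℝ)..t, (ν * nsq (W s) + ν * η ^ 2 * nsq (p s))
        ≤ nsq v₀' + (7 * C + 2) * (δ ^ 2)⁻¹ * (nsq v₀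
            + ∫ s in (0 : ℝ)..t, dataSize ν κ η (κ * δ) (g s) (f₂ s) (f₄ s) (f₄' s))
          + 2 * ν⁻¹ * ∫ s in (0 : ℝ)..t, (nsq (g s) + nsq (f₂' s))) :
    ∀ᵐ t ∂volT T, ENNReal.ofReal (nsq (p t) + (ν * (∫ s in (0 : ℝ)..t, nsq (W s))
        + ν * η ^ 2 * ∫ s in (0 : ℝ)..t, nsq (p s)))
      ≤ ENNReal.ofReal (7 * C + 4) * (ENNReal.ofReal (nsq v₀')
        + ENNReal.ofReal (δ ^ 2)⁻¹ * (ENNReal.ofReal (nsq v₀)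
          + ENNReal.ofReal (η * κ)⁻¹ * normSqT T f₄' + ENNReal.ofReal (η * κ⁻¹) * normSqT T f₄)
        + ENNReal.ofReal ν⁻¹ * (normSqT T g + ENNReal.ofReal (δ ^ 2)⁻¹ * normSqT T f₂
          + normSqT T f₂')) := by
  have hν0 : 0 < ν := by rw [hν]; positivity
  filter_upwards [hE, ae_volT_lt T] with t h1 h2
  obtain ⟨h0, htT⟩ := h2
  obtain ⟨hW, h1⟩ := h1
  have ht := h t h0 htT
  have hf := hf₂' t h0 htT
  have hp := ht.evolution.p_mem
  have hd : ∫ s in (0 : ℝ)..t, (ν * nsq (W s) + ν * η ^ 2 * nsq (p s))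
      = ν * (∫ s in (0 : ℝ)..t, nsq (W s)) + ν * η ^ 2 * ∫ s in (0 : ℝ)..t, nsq (p s) := by
    simp only [intervalIntegral_eq_muT h0.le]
    rw [integral_add (hW.integrable_nsq.const_mul _) (hp.integrable_nsq.const_mul _),
      integral_const_mul, integral_const_mul]
  have hs : ∫ s in (0 : ℝ)..t, (nsq (g s) + nsq (f₂' s))
      = (∫ s in (0 : ℝ)..t, nsq (g s)) + ∫ s in (0 : ℝ)..t, nsq (f₂' s) := by
    simp only [intervalIntegral_eq_muT h0.le]
    exact integral_add ht.g_mem.integrable_nsq hf.integrable_nsq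
  rw [hd, hs, intervalIntegral_dataSize h0.le ht.g_mem ht.f₂_mem ht.f₄_mem ht.f₄'_mem] at h1
  have hnn : ∀ V : ℝ → ℝ → ℂ, 0 ≤ ∫ s in (0 : ℝ)..t, nsq (V s) := fun V =>
    intervalIntegral.integral_nonneg h0.le fun _ _ => nsq_nonneg _
  have x2 := hnn f₂
  have x2' := hnn f₂'
  have x4 := hnn f₄
  have x4' := hnn f₄'
  have xg := hnn g
  have b2 := ofReal_intervalIntegral_nsq_le h0.le htT ht.f₂_mem
  have b2' := ofReal_intervalIntegral_nsq_le h0.le htT hf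
  have b4 := ofReal_mul_intervalIntegral_nsq_le (c := η * κ⁻¹) (by positivity) h0.le htT ht.f₄_mem
  have b4' := ofReal_mul_intervalIntegral_nsq_le (c := (η * κ)⁻¹) (by positivity) h0.le htT
    ht.f₄'_mem
  have bg := ofReal_intervalIntegral_nsq_le h0.le htT ht.g_mem
  have n0 := nsq_nonneg v₀
  have n0' := nsq_nonneg v₀'
  set X₂ := ∫ s in (0 : ℝ)..t, nsq (f₂ s)
  set X₂' := ∫ s in (0 : ℝ)..t, nsq (f₂' s)
  set X₄ := ∫ s in (0 : ℝ)..t, nsq (f₄ s)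
  set X₄' := ∫ s in (0 : ℝ)..t, nsq (f₄' s)
  set Xg := ∫ s in (0 : ℝ)..t, nsq (g s)
  have hμ : (δ ^ 2)⁻¹ * ((κ * δ)⁻¹ * Xg) = ν⁻¹ * Xg := by
    rw [hν]; field_simp
  have h3 : nsq v₀' + (7 * C + 2) * (δ ^ 2)⁻¹ * (nsq v₀ + (ν⁻¹ * X₂ + (η * κ)⁻¹ * X₄'
        + η * κ⁻¹ * X₄ + (κ * δ)⁻¹ * Xg)) + 2 * ν⁻¹ * (Xg + X₂')
      ≤ (7 * C + 4) * (nsq v₀' + (δ ^ 2)⁻¹ * (nsq v₀ + (η * κ)⁻¹ * X₄' + η * κ⁻¹ * X₄)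
        + ν⁻¹ * (Xg + (δ ^ 2)⁻¹ * X₂ + X₂')) := by
    have e : (7 * C + 2) * (δ ^ 2)⁻¹ * (nsq v₀ + (ν⁻¹ * X₂ + (η * κ)⁻¹ * X₄'
        + η * κ⁻¹ * X₄ + (κ * δ)⁻¹ * Xg))
        = (7 * C + 2) * ((δ ^ 2)⁻¹ * (nsq v₀ + (η * κ)⁻¹ * X₄' + η * κ⁻¹ * X₄)
          + ν⁻¹ * ((δ ^ 2)⁻¹ * X₂)) + (7 * C + 2) * (ν⁻¹ * Xg) := by
      rw [← hμ]; ring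
    have c1 : 0 ≤ (7 * C + 3) * nsq v₀' := by positivity
    have c2 : 0 ≤ 2 * ((δ ^ 2)⁻¹ * (nsq v₀ + (η * κ)⁻¹ * X₄' + η * κ⁻¹ * X₄)
      + ν⁻¹ * ((δ ^ 2)⁻¹ * X₂)) := by positivity
    have c3 : 0 ≤ (7 * C + 2) * (ν⁻¹ * X₂') := by positivity
    rw [e]
    linarith
  refine (ENNReal.ofReal_le_ofReal (h1.trans h3)).trans ?_
  rw [ENNReal.ofReal_mul (by positivity)]
  refine mul_le_mul_right ?_ _
  refine ENNReal.ofReal_add_le.trans (add_le_add (ENNReal.ofReal_add_le.trans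
    (add_le_add le_rfl ?_)) ?_)
  · rw [ENNReal.ofReal_mul (by positivity)]
    exact mul_le_mul_right (ENNReal.ofReal_add_le.trans (add_le_add (ENNReal.ofReal_add_le.trans
      (add_le_add le_rfl b4')) b4)) _
  · rw [ENNReal.ofReal_mul (by positivity)]
    refine mul_le_mul_right (ENNReal.ofReal_add_le.trans (add_le_add (ENNReal.ofReal_add_le.trans
      (add_le_add bg ?_)) b2')) _
    rw [ENNReal.ofReal_mul (by positivity)]
    exact mul_le_mul_right b2 _

end passage

theorem one_le_eta {k : ℤ} (hk : k ≠ 0) (ℓ : ℤ) : 1 ≤ eta k ℓ := by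
  have h : (1 : ℝ) ≤ |(k : ℝ)| := by exact_mod_cast Int.one_le_abs hk
  rw [eta, Real.one_le_sqrt]
  nlinarith [sq_abs (k : ℝ), sq_nonneg (ℓ : ℝ)]

end Couette

theorem proposition10p1 :
    ∃ ε₁ : ℝ, 0 < ε₁ ∧ ∃ C : ℝ, 0 < C ∧
      ∀ (ν : ℝ) (k ℓ : ℤ) (a : ℝ) (T : EReal),
        0 < ν → k ≠ 0 → 0 ≤ a → a ≤ ε₁ → 0 < T →
      ∀ (f₁ f₂ f₃ f₄ f₄' : ℝ → ℝ → ℂ) (ωin : ℝ → ℂ) (ω ω' : ℝ → ℝ → ℂ),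
        Couette.L2Loc T f₁ → Couette.L2Loc T f₂ → Couette.L2Loc T f₃ →
        Couette.L2Loc T f₄ → Couette.L2Loc T f₄' →
        (∀ᵐ t ∂Couette.volT T, Couette.HasH10Deriv (f₄ t) (f₄' t)) →
        MemLp ωin 2 Couette.volI →
        Couette.IsWeakSolution ν k ℓ T f₁ f₂ f₃ f₄ ωin ω ω' →
        -- the first estimate
        (Couette.wNorm a ν ⊤ T ω ^ 2
            + ENNReal.ofReal ν * Couette.wNorm a ν 2 T ω' ^ 2
            + ENNReal.ofReal (ν * Couette.eta k ℓ ^ 2 + (ν * (k : ℝ) ^ 2) ^ (1 / 3 : ℝ))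
                * Couette.wNorm a ν 2 T ω ^ 2
          ≤ ENNReal.ofReal C *
            (eLpNorm ωin 2 Couette.volI ^ 2
              + ENNReal.ofReal ν⁻¹ * Couette.wNorm a ν 2 T f₂ ^ 2
              + ENNReal.ofReal ((Couette.eta k ℓ * |(k : ℝ)|)⁻¹) * Couette.wNorm a ν 2 T f₄' ^ 2
              + ENNReal.ofReal (Couette.eta k ℓ * |(k : ℝ)|⁻¹) * Couette.wNorm a ν 2 T f₄ ^ 2
              + ENNReal.ofReal (min (ν * Couette.eta k ℓ ^ 2)⁻¹
                    ((ν * (k : ℝ) ^ 2) ^ (-(1 / 3) : ℝ)))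
                  * Couette.wNorm a ν 2 T
                      (fun t y => (k : ℂ) * f₁ t y + (ℓ : ℂ) * f₃ t y) ^ 2)) ∧
        -- the second estimate
        (∀ (ωin' : ℝ → ℂ) (f₂' : ℝ → ℝ → ℂ),
          Couette.HasH10Deriv ωin ωin' →
          Couette.L2Loc T f₂' →
          (∀ᵐ t ∂Couette.volT T, Couette.HasH1Deriv (f₂ t) (f₂' t)) →
          ∃ ω'' : ℝ → ℝ → ℂ, Couette.L2Loc T ω'' ∧
            (∀ᵐ t ∂Couette.volT T, Couette.HasH1Deriv (ω' t) (ω'' t)) ∧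
            Couette.wNorm a ν ⊤ T ω' ^ 2
                + ENNReal.ofReal ν * Couette.wNorm a ν 2 T ω'' ^ 2
                + ENNReal.ofReal (ν * Couette.eta k ℓ ^ 2) * Couette.wNorm a ν 2 T ω' ^ 2
              ≤ ENNReal.ofReal C * eLpNorm ωin' 2 Couette.volI ^ 2
                + ENNReal.ofReal (C * ν ^ (-(2 / 3) : ℝ) * |(k : ℝ)| ^ (2 / 3 : ℝ)) *
                  (eLpNorm ωin 2 Couette.volI ^ 2
                    + ENNReal.ofReal ((Couette.eta k ℓ * |(k : ℝ)|)⁻¹)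
                        * Couette.wNorm a ν 2 T f₄' ^ 2
                    + ENNReal.ofReal (Couette.eta k ℓ * |(k : ℝ)|⁻¹)
                        * Couette.wNorm a ν 2 T f₄ ^ 2)
                + ENNReal.ofReal (C * ν⁻¹) *
                  (Couette.wNorm a ν 2 T
                      (fun t y => (k : ℂ) * f₁ t y + (ℓ : ℂ) * f₃ t y) ^ 2
                    + ENNReal.ofReal (ν ^ (-(2 / 3) : ℝ) * |(k : ℝ)| ^ (2 / 3 : ℝ))
                        * Couette.wNorm a ν 2 T f₂ ^ 2
                    + Couette.wNorm a ν 2 T f₂' ^ 2)) := by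
  obtain ⟨ε, hε, C, hC, hmain⟩ := Couette.exists_energy_estimate
  have hC0 : 0 ≤ C := by linarith
  -- the factor `3` counts the three norms on the left, each bounded by the same right side
  refine ⟨min ε 1, lt_min hε one_pos, 3 * (7 * C + 4), by positivity, ?_⟩
  intro ν k ℓ a T hν hk ha ha' hT f₁ f₂ f₃ f₄ f₄' ωin ω ω' L₁ L₂ L₃ L₄ L₄' hb₄ hin hsol
  obtain ⟨r₁, h₁⟩ := L₁.exists_isRep hT
  obtain ⟨r₂, h₂⟩ := L₂.exists_isRep hT
  obtain ⟨r₃, h₃⟩ := L₃.exists_isRep hT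
  obtain ⟨r₄, h₄⟩ := L₄.exists_isRep hT
  obtain ⟨r₄', h₄'⟩ := L₄'.exists_isRep hT
  obtain ⟨o, ho⟩ := hsol.memL2.exists_isRep hT
  obtain ⟨o', ho'⟩ := hsol.deriv_memL2.exists_isRep hT
  obtain ⟨v₀, hv₀m, hv₀⟩ : ∃ v₀, Measurable v₀ ∧ ωin =ᵐ[Couette.volI] v₀ :=
    ⟨hin.1.mk ωin, hin.1.stronglyMeasurable_mk.measurable, hin.1.ae_eq_mk⟩
  set κ : ℝ := |(k : ℝ)| with hκdef
  have hκ : 1 ≤ κ := by rw [hκdef]; exact_mod_cast Int.one_le_abs hk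
  have hκ0 : 0 < κ := by linarith
  have hη := Couette.one_le_eta hk ℓ
  set η := Couette.eta k ℓ
  have hη0 : 0 < η := by linarith
  obtain ⟨δ, hδ, hνδ, s₁, s₂, s₃, s₄⟩ := Couette.exists_scale hν hκ
  have hκδ : 0 < κ * δ := by positivity
  set b : ℝ := a * ν ^ (1 / 3 : ℝ) with hb
  have hν3 : 0 ≤ ν ^ (1 / 3 : ℝ) := by positivity
  have hb0 : 0 ≤ b := by positivity
  have hbε : b ≤ ε * (κ * δ) := by
    rw [hb]; gcongr; exact ha'.trans (min_le_left _ _)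
  have hb1 : b ≤ κ * δ := by
    have : b ≤ 1 * (κ * δ) := by
      rw [hb]; gcongr; exact ha'.trans (min_le_right _ _)
    rwa [one_mul] at this
  obtain ⟨σ, hσ, hσk⟩ : ∃ σ : ℝ, |σ| = 1 ∧ σ * κ = k := by
    have hk' : (k : ℝ) ≠ 0 := by exact_mod_cast hk
    exact ⟨k / κ, by rw [abs_div, abs_of_pos hκ0, ← hκdef, div_self hκ0.ne'],
      div_mul_cancel₀ _ hκ0.ne'⟩
  have hev := fun (τ : ℝ) (h0 : 0 < τ) (hτ : (τ : EReal) < T) =>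
    hsol.shearEvolution (b := b) hb₄ hin h₁ h₂ h₃ h₄ h₄' ho ho' hv₀m hv₀ h0 hτ
  have hg := h₁.linearComb h₃ (k : ℂ) (ℓ : ℂ)
  have hE : ∀ μ : ℝ, 0 < μ → μ ≤ ν * η ^ 2 + κ * δ → _ := fun μ hμ hμ' τ h0 hτ =>
    hmain (τ := τ) hδ hκ0 hσ hνδ hη hμ hμ' hb0 hbε (hσk.symm ▸ hev τ h0 hτ)
  have hin2 : eLpNorm ωin 2 Couette.volI ^ 2 = ENNReal.ofReal (Couette.nsq v₀) := by
    rw [Couette.eLpNorm_two_sq hin, Couette.nsq_congr hv₀]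
  have hk2 : (k : ℝ) ^ 2 = κ ^ 2 := (sq_abs _).symm
  rw [hk2, s₁, s₂, hin2, h₂.wNorm_two_sq hT hb.symm, h₄.wNorm_two_sq hT hb.symm,
    h₄'.wNorm_two_sq hT hb.symm, hg.wNorm_two_sq hT hb.symm]
  constructor
  · -- the weight of `g` is `μ = max (νη²) (κδ)`, whose inverse is the minimum in the claim
    have hνη : 0 < ν * η ^ 2 := by positivity
    have hμ : 0 < max (ν * η ^ 2) (κ * δ) := lt_max_of_lt_left hνη
    have hμ' : max (ν * η ^ 2) (κ * δ) ≤ ν * η ^ 2 + κ * δ :=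
      max_le (by linarith) (by linarith)
    have hμi : min (ν * η ^ 2)⁻¹ (κ * δ)⁻¹ = (max (ν * η ^ 2) (κ * δ))⁻¹ := by
      rcases le_total (ν * η ^ 2) (κ * δ) with h | h
      · rw [max_eq_right h, min_eq_right (inv_anti₀ hνη h)]
      · rw [max_eq_left h, min_eq_left (inv_anti₀ hκδ h)]
    rw [hμi]
    refine (ho.norms_le hT ho' hb.symm hν.le (by positivity)
      (Couette.ShearEvolution.ofReal_energy_le hT hν hη0 hκ0 hμ hC0 hev (hE _ hμ hμ'))).trans ?_
    rw [← mul_assoc]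
    refine mul_le_mul_left ?_ _
    rw [← ENNReal.ofReal_ofNat, ← ENNReal.ofReal_mul (by norm_num)]
    exact ENNReal.ofReal_le_ofReal (by linarith)
  · intro ωin' f₂' hin' L₂' hf₂'
    obtain ⟨r₂', h₂'⟩ := L₂'.exists_isRep hT
    have ho'm : Measurable (Function.uncurry (Couette.weighted b o')) := by
      obtain ⟨τ, -, h1, -⟩ := Couette.exists_times hT
      exact ((ho'.l2q (τ 0) (h1 0).1 (h1 0).2).weighted b).measurable
    obtain ⟨W, hWm, hWp⟩ := Couette.exists_measurable_weak_deriv ho'm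
    have hh1 : ∀ᵐ t ∂Couette.volT T, Couette.L2Q t W ∧ _ ∧ _ :=
      Couette.ae_volT hT fun τ h0 hτ => by
        refine (hev τ h0 hτ).h1_estimate hδ hκ0 hκdef.symm hνδ hη0 hC0 hb1
          (hin'.isH10.congr hv₀ (Filter.EventuallyEq.refl _ _))
          ((h₂'.l2q τ h0 hτ).weighted b) ?_ hWm hWp (hE _ hκδ ?_ τ h0 hτ)
        · refine ae_mono (Couette.muT_le_volT hτ) ?_
          filter_upwards [hf₂', h₂.slice, h₂'.slice] with t a1 a2 a3
          exact (a1.congr a2 a3).const_mul _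
        · have : 0 ≤ ν * η ^ 2 := by positivity
          linarith
    have hWL : ∀ τ : ℝ, 0 < τ → (τ : EReal) < T → Couette.L2Q τ W := fun τ h0 hτ => by
      obtain ⟨t, ht, -, hW, -⟩ := Couette.exists_good_time h0 hτ hh1
      exact hW.mono ht.le
    have hrep : Couette.IsRep T (Couette.weighted (-b) W) (Couette.weighted (-b) W) :=
      ⟨fun τ h0 hτ => (hWL τ h0 hτ).weighted _, Filter.EventuallyEq.refl _ _⟩
    -- `W` is the weak derivative of `e^{bt} ω'`, so `ω'' = e^{-bt} W`
    refine ⟨Couette.weighted (-b) W, fun τ h0 hτ => ?_, ?_, ?_⟩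
    · rw [Couette.volume_box]
      exact (hrep.l2q τ h0 hτ).memLp
    · have hd : ∀ᵐ t ∂Couette.volT T,
          Couette.HasH1Deriv (Couette.weighted b o' t) (W t) := by
        refine Couette.ae_volT hT fun τ h0 hτ => ?_
        obtain ⟨t, ht, -, -, hW, -⟩ := Couette.exists_good_time h0 hτ hh1
        exact ae_mono (Couette.muT_mono ht.le) hW
      filter_upwards [hd, ho'.slice] with t h1 h2
      refine (h1.const_mul (Real.exp (-b * t) : ℂ)).congr ?_ (Filter.EventuallyEq.refl _ _)
      filter_upwards [h2] with y hy
      have := congrFun (congrFun (Couette.weighted_neg_weighted (-b) o') t) y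
      rw [neg_neg] at this
      rw [hy]
      exact this
    · have key := ho'.norms_le hT hrep hb.symm hν.le (c₂ := ν * η ^ 2) (by positivity)
        (M := ENNReal.ofReal (7 * C + 4) * (ENNReal.ofReal (Couette.nsq ωin')
        + ENNReal.ofReal (δ ^ 2)⁻¹ * (ENNReal.ofReal (Couette.nsq v₀)
          + ENNReal.ofReal (η * κ)⁻¹ * Couette.normSqT T (Couette.weighted b r₄')
          + ENNReal.ofReal (η * κ⁻¹) * Couette.normSqT T (Couette.weighted b r₄))
        + ENNReal.ofReal ν⁻¹ * (Couette.normSqT T (Couette.weighted b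
            fun t y => (k : ℂ) * r₁ t y + (ℓ : ℂ) * r₃ t y)
          + ENNReal.ofReal (δ ^ 2)⁻¹ * Couette.normSqT T (Couette.weighted b r₂)
          + Couette.normSqT T (Couette.weighted b r₂')))) (by
          rw [Couette.weighted_neg_weighted]
          exact Couette.ShearEvolution.ofReal_h1_energy_le hδ hκ0 hνδ hη0 hC0 hev
            (fun τ h0 hτ => (h₂'.l2q τ h0 hτ).weighted b) (hh1.mono fun t ht => ⟨ht.1, ht.2.2⟩))
      refine key.trans_eq ?_
      have e3 : (3 : ENNReal) * ENNReal.ofReal (7 * C + 4)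
          = ENNReal.ofReal (3 * (7 * C + 4)) := by
        rw [ENNReal.ofReal_mul (by norm_num), ENNReal.ofReal_ofNat]
      rw [h₂'.wNorm_two_sq hT hb.symm, Couette.eLpNorm_two_sq hin'.1.2.1, s₃, mul_assoc _ (ν ^ _),
        s₃, ENNReal.ofReal_mul (q := (δ ^ 2)⁻¹) (by positivity),
        ENNReal.ofReal_mul (q := ν⁻¹) (by positivity), ← mul_assoc, e3]
      ring

end
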